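/- Let $k$ be an algebraically closed field of characteristic $0$, let $R$ and $S$ be finitely generated commutative unital $k$-algebras, and let $S/R$ be a Galois extension with finite Galois group $\Gamma$: $\Gamma$ acts on $S$ by $R$-algebra automorphisms, $R=S^\Gamma$, and the map $S\otimes_R S\to\prod_{\gamma\in\Gamma}S$, $a\otimes b\mapsto(a\cdot{}^\gamma b)_\gamma$, is bijective. Let $\mathfrak g$ be a finite-dimensional simple Lie algebra over $k$ with a Cartan subalgebra $\mathfrak h$ and a pinning of $(\mathfrak g,\mathfrak h)$, that is, a base $B$ of the root system together with a nonzero root vector $X_\alpha\in\mathfrak g^\alpha$ for each $\alpha\in B$. Let $\mathfrak g(S)=\mathfrak g\otimes_k S$, let $\Gamma$ act on $\mathfrak g(S)$ through $S$, and let $u:\Gamma\to\mathrm{Aut}_{S\text{-Lie}}(\mathfrak g(S))$ be a $1$-cocycle, i.e. $u_{\gamma\delta}=u_\gamma\circ(\gamma\circ u_\delta\circ\gamma^{-1})$ for all $\gamma,\delta\in\Gamma$. Let $$\mathcal L=\{z\in\mathfrak g(S)\mid u_\gamma({}^\gamma z)=z\text{ for all }\gamma\in\Gamma\}$$ be the associated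 $S/R$-form of $\mathfrak g\otimes_k R$, viewed as a Lie algebra over $k$. For $M\in\mathrm{Max}(S)$ write $s(M)\in k$ for the image of $s\in S$ in $S/M\simeq k$, and let $\mathrm{ev}_M:\mathfrak g(S)\to\mathfrak g$, $x\otimes s\mapsto s(M)x$. For a $\mathfrak g$-module $W$ let $W(M)$ be the vector space $W$ on which $\mathcal L$ acts through $\mathrm{ev}_M$. For $\alpha\in\mathrm{Aut}_{S\text{-Lie}}(\mathfrak g(S))$ let $\alpha(M)\in\mathrm{Aut}(\mathfrak g)$ be $x\mapsto\mathrm{ev}_M(\alpha(x\otimes1))$. Every $\theta\in\mathrm{Aut}(\mathfrak g)$ decomposes uniquely as $\theta=\mathrm{Int}\,\theta\circ\mathrm{Out}\,\theta$, where $\mathrm{Int}\,\theta$ lies in the group generated by the $\exp(\mathrm{ad}\,x)$ with $\mathrm{ad}\,x$ nilpotent, and $\mathrm{Out}\,\theta$ preserves the pinning (it maps $\mathfrak h$ onto $\mathfrak h$ and permutes the $X_\alpha$, $\alpha\in B$). Let $P_+^\times\subset\mathfrak h^*$ be the set of nonzero dominant integral weights with respect to $B$, let $V_\lambda$ be the finite-dimensional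 simple $\mathfrak g$-module of highest weight $\lambda$, and for $\gamma\in\Gamma$, $\mu\in P_+^\times$, $N\in\mathrm{Max}(S)$ put $${}^\gamma(\mu,N)=\bigl(\mu\circ\mathrm{Out}\,(u_\gamma^{-1}({}^\gamma N)),\ {}^\gamma N\bigr),$$ where $u_\gamma^{-1}({}^\gamma N)$ is the automorphism $u_\gamma^{-1}$ evaluated at the maximal ideal ${}^\gamma N=\gamma(N)$. Let $n\ge 0$, $\lambda,\mu\in(P_+^\times)^n$ and $M,N\in\mathrm{Max}(S)^n$ be such that the $\mathcal L$-modules $$V(\lambda,M)=V_{\lambda_1}(M_1)\otimes_k\cdots\otimes_k V_{\lambda_n}(M_n),\qquad V(\mu,N)=V_{\mu_1}(N_1)\otimes_k\cdots\otimes_k V_{\mu_n}(N_n)$$ are irreducible and $M_i\cap R=N_i\cap R$ for all $i$. Then $V(\lambda,M)\simeq V(\mu,N)$ as $\mathcal L$-modules if and only if there exist $\gamma_1,\dots,\gamma_n\in\Gamma$ such that $$(\lambda_i,M_i)={}^{\gamma_i}(\mu_i,N_i)\qquad\text{for } i=1,\dots,n.$$ -/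

import Mathlib

open scoped TensorProduct

namespace TwistedForms

noncomputable section

/-! ### Galois extensions of commutative rings -/

section Galois

variable (Γ R S : Type*) [Group Γ] [CommRing R] [CommRing S] [Algebra R S]
  [MulSemiringAction Γ S] [SMulCommClass Γ R S]

/-- The canonical map `S ⊗_R S → ∏_{γ ∈ Γ} S`, `a ⊗ b ↦ (a · ᵞb)_γ`. -/
def galoisMap : S ⊗[R] S →ₗ[R] (Γ → S) :=
  LinearMap.pi fun γ => TensorProduct.lift
    ((LinearMap.mul R S).compl₂ (MulSemiringAction.toAlgHom R S γ).toLinearMap)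

/-- `S/R` is a Galois extension of commutative rings with (finite) Galois group `Γ`: the ring `R`
is identified with the invariants `S^Γ`, and `S ⊗_R S → ∏_Γ S` is bijective. -/
structure IsGaloisExtension : Prop where
  finite : Finite Γ
  injective : Function.Injective (algebraMap R S)
  invariant : ∀ s : S, (∀ γ : Γ, γ • s = s) → ∃ r : R, algebraMap R S r = s
  bijective : Function.Bijective (galoisMap Γ R S)

variable {Γ S}

/-- The action of `Γ` on `Max(S)`: `ᵞN` is the image of the ideal `N` under `γ`. -/
def galConj (γ : Γ) (N : MaximalSpectrum S) : MaximalSpectrum S :=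
  ⟨N.asIdeal.comap (MulSemiringAction.toRingEquiv Γ S γ⁻¹),
    have := N.isMaximal
    Ideal.comap_isMaximal_of_equiv _⟩

end Galois

/-! ### Evaluation at maximal ideals -/

section Evaluation

variable {k S 𝔤 : Type*} [Field k] [IsAlgClosed k] [CommRing S] [Algebra k S]
  [Algebra.FiniteType k S] [LieRing 𝔤] [LieAlgebra k 𝔤]

theorem algebraMap_quotient_bijective (M : MaximalSpectrum S) :
    Function.Bijective (Algebra.ofId k (S ⧸ M.asIdeal)) := by
  have := M.isMaximal
  let := Ideal.Quotient.field M.asIdeal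
  have : Module.Finite k (S ⧸ M.asIdeal) := finite_of_finite_type_of_isJacobsonRing _ _
  exact IsAlgClosed.algebraMap_bijective_of_isIntegral

/-- The evaluation `S → S/M ≃ k`, `s ↦ s(M)`. -/
def residue (M : MaximalSpectrum S) : S →ₐ[k] k :=
  ((AlgEquiv.ofBijective _ (algebraMap_quotient_bijective (k := k) M)).symm : _ →ₐ[k] k).comp
    (Ideal.Quotient.mkₐ k M.asIdeal)

/-- The evaluation map `ev_M : 𝔤(S) → 𝔤`, `s ⊗ x ↦ s(M) x`. -/
def evalAt (M : MaximalSpectrum S) : S ⊗[k] 𝔤 →ₗ⁅k⁆ 𝔤 :=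
  { TensorProduct.lift ((LinearMap.lsmul k 𝔤).comp (residue M).toLinearMap) with
    map_lie' := by
      intro x y
      induction x with
      | zero => simp
      | add a b ha hb =>
        simp only [AddHom.toFun_eq_coe, LinearMap.coe_toAddHom] at ha hb ⊢
        simp only [add_lie, map_add, ha, hb]
      | tmul s a =>
        induction y with
        | zero => simp
        | add c d hc hd =>
          simp only [AddHom.toFun_eq_coe, LinearMap.coe_toAddHom] at hc hd ⊢
          simp only [lie_add, map_add, hc, hd]
        | tmul t b => simp [mul_smul, smul_comm (residue (k := k) M s)] }

@[simp]
theorem evalAt_tmul (M : MaximalSpectrum S) (s : S) (x : 𝔤) :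
    evalAt M (s ⊗ₜ[k] x) = residue (k := k) M s • x := rfl

theorem evalAt_smul (M : MaximalSpectrum S) (s : S) (z : S ⊗[k] 𝔤) :
    evalAt M (s • z) = residue (k := k) M s • evalAt M z := by
  induction z with
  | zero => simp
  | add a b ha hb => simp only [smul_add, map_add, ha, hb]
  | tmul t x => simp [TensorProduct.smul_tmul', mul_smul]

/-- `x ↦ ev_M (α (1 ⊗ x))`, the specialization of `α` at `M`. -/
def specializeHom (α : S ⊗[k] 𝔤 ≃ₗ⁅S⁆ S ⊗[k] 𝔤) (M : MaximalSpectrum S) : 𝔤 →ₗ⁅k⁆ 𝔤 where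
  toFun x := evalAt M (α (1 ⊗ₜ[k] x))
  map_add' x y := by simp [TensorProduct.tmul_add]
  map_smul' c x := by
    have h : (1 : S) ⊗ₜ[k] (c • x) = algebraMap k S c • ((1 : S) ⊗ₜ[k] x) := by
      simp [TensorProduct.smul_tmul', Algebra.algebraMap_eq_smul_one]
    rw [h, map_smul, evalAt_smul]
    simp
  map_lie' {x y} := by
    have h : (1 : S) ⊗ₜ[k] ⁅x, y⁆ = ⁅(1 : S) ⊗ₜ[k] x, (1 : S) ⊗ₜ[k] y⁆ := by simp
    rw [h, LieEquiv.map_lie, LieHom.map_lie]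

theorem specializeHom_evalAt (α : S ⊗[k] 𝔤 ≃ₗ⁅S⁆ S ⊗[k] 𝔤) (M : MaximalSpectrum S)
    (z : S ⊗[k] 𝔤) : specializeHom α M (evalAt M z) = evalAt M (α z) := by
  induction z with
  | zero => simp
  | add a b ha hb => simp only [map_add, ha, hb]
  | tmul s x =>
    have h : s ⊗ₜ[k] x = s • ((1 : S) ⊗ₜ[k] x) := by simp [TensorProduct.smul_tmul']
    rw [evalAt_tmul, map_smul, h, map_smul, evalAt_smul]
    rfl

/-- The specialization `α(M) ∈ Aut(𝔤)` of `α ∈ Aut_{S-Lie}(𝔤(S))` at a maximal ideal `M`, given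
by `α(M)(x) = ev_M (α (1 ⊗ x))`. -/
def specialize (α : S ⊗[k] 𝔤 ≃ₗ⁅S⁆ S ⊗[k] 𝔤) (M : MaximalSpectrum S) : 𝔤 ≃ₗ⁅k⁆ 𝔤 :=
  { specializeHom α M with
    invFun := specializeHom α.symm M
    left_inv := fun x => by
      change specializeHom α.symm M (evalAt M (α (1 ⊗ₜ[k] x))) = x
      rw [specializeHom_evalAt]
      simp
    right_inv := fun x => by
      change specializeHom α M (evalAt M (α.symm (1 ⊗ₜ[k] x))) = x
      rw [specializeHom_evalAt]
      simp }

end Evaluation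

/-! ### Galois cocycles and twisted forms -/

section Forms

variable {k S 𝔤 Γ : Type*} [Field k] [CommRing S] [Algebra k S] [LieRing 𝔤] [LieAlgebra k 𝔤]
  [Group Γ] [MulSemiringAction Γ S] [SMulCommClass Γ k S]

variable (k 𝔤) in
/-- The action of `Γ` on `𝔤(S)` through the factor `S`, `ᵞ(s ⊗ x) = ᵞs ⊗ x`. -/
def galAct (γ : Γ) : S ⊗[k] 𝔤 →ₗ⁅k⁆ S ⊗[k] 𝔤 :=
  LieAlgebra.ExtendScalars.map (MulSemiringAction.toAlgHom k S γ) LieHom.id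

/-- The `1`-cocycle condition `u_{γδ} = u_γ ∘ ᵞu_δ`, where `ᵞα = γ ∘ α ∘ γ⁻¹`. -/
def IsCocycle (u : Γ → (S ⊗[k] 𝔤 ≃ₗ⁅S⁆ S ⊗[k] 𝔤)) : Prop :=
  ∀ (γ δ : Γ) (z : S ⊗[k] 𝔤),
    u (γ * δ) z = u γ (galAct k 𝔤 γ (u δ (galAct k 𝔤 γ⁻¹ z)))

/-- The form `𝓛_u = {z ∈ 𝔤(S) | u_γ(ᵞz) = z for all γ ∈ Γ}`, as a Lie algebra over `k`. -/
def twistedForm (u : Γ → (S ⊗[k] 𝔤 ≃ₗ⁅S⁆ S ⊗[k] 𝔤)) : LieSubalgebra k (S ⊗[k] 𝔤) where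
  carrier := {z | ∀ γ : Γ, u γ (galAct k 𝔤 γ z) = z}
  zero_mem' γ := by simp
  add_mem' ha hb γ := by rw [map_add, map_add, ha γ, hb γ]
  smul_mem' c z hz γ := by
    rw [map_smul, ← algebraMap_smul S c (galAct k 𝔤 γ z), map_smul, hz γ, algebraMap_smul]
  lie_mem' ha hb γ := by
    rw [LieHom.map_lie, LieEquiv.map_lie, ha γ, hb γ]

end Forms

/-! ### Tensor products of Lie modules and evaluation modules -/

section Modules

section PiTensor

variable {ι k L : Type*} [DecidableEq ι] [CommRing k] [LieRing L] [LieAlgebra k L]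
  {V : ι → Type*} [∀ i, AddCommGroup (V i)] [∀ i, Module k (V i)]

/-- The endomorphism `id ⊗ ⋯ ⊗ f ⊗ ⋯ ⊗ id` of `⨂ V i`, with `f` in position `i`. -/
def tensorAt (i : ι) : Module.End k (V i) →ₗ[k] Module.End k (⨂[k] i, V i) where
  toFun f := PiTensorProduct.map (Function.update (fun j => (LinearMap.id : V j →ₗ[k] V j)) i f)
  map_add' _ _ := PiTensorProduct.map_update_add _ _ _ _
  map_smul' _ _ := PiTensorProduct.map_update_smul _ _ _ _

theorem tensorAt_mul (i : ι) (f g : Module.End k (V i)) :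
    tensorAt (V := V) i (f * g) = tensorAt i f * tensorAt i g := by
  change PiTensorProduct.map _ = PiTensorProduct.map _ * PiTensorProduct.map _
  rw [← PiTensorProduct.map_mul]
  congr 1
  funext j
  by_cases h : j = i
  · subst h; simp
  · simp [Function.update_of_ne h]; rfl

theorem tensorAt_comm {i j : ι} (hij : i ≠ j) (f : Module.End k (V i)) (g : Module.End k (V j)) :
    tensorAt (V := V) i f * tensorAt j g = tensorAt j g * tensorAt i f := by
  change PiTensorProduct.map _ * PiTensorProduct.map _ =
    PiTensorProduct.map _ * PiTensorProduct.map _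
  rw [← PiTensorProduct.map_mul, ← PiTensorProduct.map_mul]
  congr 1
  funext l
  by_cases h : l = i
  · subst h; simp [Function.update_of_ne hij]; rfl
  · by_cases h' : l = j
    · subst h'; simp [Function.update_of_ne h]; rfl
    · simp [Function.update_of_ne h, Function.update_of_ne h']

variable [Fintype ι] [∀ i, LieRingModule L (V i)] [∀ i, LieModule k L (V i)]

variable (k L V) in
/-- The diagonal action `x ↦ ∑ i, id ⊗ ⋯ ⊗ x ⊗ ⋯ ⊗ id` of a Lie algebra on a tensor product of
finitely many modules. -/
def piTensorAction : L →ₗ[k] Module.End k (⨂[k] i, V i) :=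
  ∑ i, (tensorAt i).comp (LieModule.toEnd k L (V i) : L →ₗ[k] Module.End k (V i))

theorem piTensorAction_mul (x y : L) :
    piTensorAction k L V x * piTensorAction k L V y =
      piTensorAction k L V ⁅x, y⁆ + piTensorAction k L V y * piTensorAction k L V x := by
  have h : ∀ i, LieModule.toEnd k L (V i) x * LieModule.toEnd k L (V i) y =
      LieModule.toEnd k L (V i) ⁅x, y⁆ +
        LieModule.toEnd k L (V i) y * LieModule.toEnd k L (V i) x := fun i => by
    ext v
    simp
  simp only [piTensorAction, LinearMap.sum_apply, LinearMap.comp_apply, LieHom.coe_toLinearMap,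
    Finset.sum_mul_sum]
  rw [Finset.sum_comm (f := fun i j => tensorAt i (LieModule.toEnd k L (V i) y) *
    tensorAt j (LieModule.toEnd k L (V j) x)), ← Finset.sum_add_distrib]
  refine Finset.sum_congr rfl fun i _ => ?_
  rw [← Finset.add_sum_erase _ _ (Finset.mem_univ i),
    ← Finset.add_sum_erase _ (fun j => tensorAt j (LieModule.toEnd k L (V j) y) *
      tensorAt i (LieModule.toEnd k L (V i) x)) (Finset.mem_univ i),
    ← tensorAt_mul, h, map_add, tensorAt_mul, add_assoc]
  congr 2
  exact Finset.sum_congr rfl fun j hj => tensorAt_comm (Finset.ne_of_mem_erase hj).symm _ _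

instance : LieRingModule L (⨂[k] i, V i) where
  bracket x t := piTensorAction k L V x t
  add_lie x y t := by simp
  lie_add x s t := by simp
  leibniz_lie x y t := LinearMap.congr_fun (piTensorAction_mul (k := k) (V := V) x y) t

instance : LieModule k L (⨂[k] i, V i) where
  smul_lie c x t := by
    change piTensorAction k L V (c • x) t = c • piTensorAction k L V x t
    simp
  lie_smul c x t := by
    change piTensorAction k L V x (c • t) = c • piTensorAction k L V x t
    simp

end PiTensor

section EvalModule

variable {k S 𝔤 : Type*} [Field k] [CommRing S] [Algebra k S] [LieRing 𝔤] [LieAlgebra k 𝔤]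

/-- The evaluation module `W(M)`: the vector space underlying a `𝔤`-module `W`, on which a
subalgebra `𝓛 ⊆ 𝔤(S)` acts through `ev_M : 𝓛 → 𝔤`. -/
@[nolint unusedArguments]
def EvalModule (_𝓛 : LieSubalgebra k (S ⊗[k] 𝔤)) (_M : MaximalSpectrum S) (W : Type*) : Type _ := W

variable [IsAlgClosed k] [Algebra.FiniteType k S]
  (𝓛 : LieSubalgebra k (S ⊗[k] 𝔤)) (M : MaximalSpectrum S)
  (W : Type*) [AddCommGroup W] [Module k W] [LieRingModule 𝔤 W] [LieModule k 𝔤 W]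

instance : AddCommGroup (EvalModule 𝓛 M W) := inferInstanceAs (AddCommGroup W)

instance : Module k (EvalModule 𝓛 M W) := inferInstanceAs (Module k W)

instance : LieRingModule 𝓛 (EvalModule 𝓛 M W) :=
  LieRingModule.compLieHom W ((evalAt M).comp 𝓛.incl)

instance : LieModule k 𝓛 (EvalModule 𝓛 M W) :=
  LieModule.compLieHom W ((evalAt M).comp 𝓛.incl)

end EvalModule

end Modules

/-! ### Pinnings, highest weights and outer parts of automorphisms -/

section Pinning

variable {k 𝔤 : Type*} [Field k] [IsAlgClosed k] [CharZero k] [LieRing 𝔤] [LieAlgebra k 𝔤]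
  [FiniteDimensional k 𝔤] [LieAlgebra.IsSimple k 𝔤]
  (𝔥 : LieSubalgebra k 𝔤) [𝔥.IsCartanSubalgebra]

/-- A pinning (épinglage) of `(𝔤, 𝔥)`: a base of the root system together with a nonzero root
vector for each simple root. -/
structure Pinning where
  base : (LieAlgebra.IsKilling.rootSystem 𝔥).Base
  vec : base.support → 𝔤
  vec_mem : ∀ i : base.support, vec i ∈ LieAlgebra.rootSpace 𝔥 i.1.1
  vec_ne_zero : ∀ i, vec i ≠ 0

variable {𝔥} (P : Pinning 𝔥)

/-- Dominant integral weights: those taking values in `ℕ` on the simple coroots. -/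
def IsDominantIntegral (μ : Module.Dual k 𝔥) : Prop :=
  ∀ i ∈ P.base.support, ∃ m : ℕ, μ ((LieAlgebra.IsKilling.rootSystem 𝔥).coroot i) = m

/-- `V` is the finite-dimensional simple `𝔤`-module `V_μ` of highest weight `μ`: it is simple and
contains a nonzero vector of weight `μ` annihilated by the positive root spaces. -/
structure IsSimpleOfHighestWeight (μ : Module.Dual k 𝔥) (V : Type*) [AddCommGroup V] [Module k V]
    [LieRingModule 𝔤 V] [LieModule k 𝔤 V] : Prop where
  finite : FiniteDimensional k V
  irreducible : LieModule.IsIrreducible k 𝔤 V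
  exists_highest : ∃ v : V, v ≠ 0 ∧
    (∀ α : 𝔥.root, P.base.IsPos α → ∀ x ∈ LieAlgebra.rootSpace 𝔥 α.1, ⁅x, v⁆ = 0) ∧
    ∀ h : 𝔥, ⁅(h : 𝔤), v⁆ = μ h • v

/-- An automorphism of `𝔤` preserving the pinning: it maps `𝔥` onto itself and permutes the chosen
simple root vectors. -/
structure IsPinned (δ : 𝔤 ≃ₗ⁅k⁆ 𝔤) : Prop where
  mem_iff : ∀ x, δ x ∈ 𝔥 ↔ x ∈ 𝔥
  permutes : ∃ π : Equiv.Perm P.base.support, ∀ i, δ (P.vec i) = P.vec (π i)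

theorem isPinned_refl : IsPinned P LieEquiv.refl := ⟨fun _ => Iff.rfl, Equiv.refl _, fun _ => rfl⟩

/-- The action on `𝔥` of an automorphism preserving the pinning. -/
def restrictCartan (δ : {δ : 𝔤 ≃ₗ⁅k⁆ 𝔤 // IsPinned P δ}) : 𝔥 →ₗ[k] 𝔥 :=
  (δ.1 : 𝔤 →ₗ[k] 𝔤).restrict (p := 𝔥.toSubmodule) (q := 𝔥.toSubmodule)
    fun x hx => (δ.2.mem_iff x).2 hx

variable (k 𝔤) in
/-- The group of elementary (inner) automorphisms of `𝔤`, generated by the automorphisms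
`exp (ad x) = ∑ j, (ad x) ^ j / j!` for `ad x` nilpotent. -/
def elementaryGroup : Subgroup (𝔤 ≃ₗ[k] 𝔤) :=
  Subgroup.closure {e | ∃ x : 𝔤, IsNilpotent (LieAlgebra.ad k 𝔤 x) ∧
    (e : Module.End k 𝔤) = ∑ j ∈ Finset.range (nilpotencyClass (LieAlgebra.ad k 𝔤 x)),
      (j.factorial : k)⁻¹ • LieAlgebra.ad k 𝔤 x ^ j}

/-- `α = ι ∘ δ` with `ι` inner and `δ` preserving the pinning. -/
def IsOuterPart (α δ : 𝔤 ≃ₗ⁅k⁆ 𝔤) : Prop :=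
  IsPinned P δ ∧ ∃ ι : 𝔤 ≃ₗ⁅k⁆ 𝔤, ι.toLinearEquiv ∈ elementaryGroup k 𝔤 ∧ ∀ x, α x = ι (δ x)

open Classical in
/-- The outer part `Out α` of an automorphism: the automorphism `δ` preserving the pinning in the
decomposition `α = Int α ∘ Out α`. (Such a decomposition exists and is unique for every `α`, so the
default value is never taken.) -/
def outPart (α : 𝔤 ≃ₗ⁅k⁆ 𝔤) : {δ : 𝔤 ≃ₗ⁅k⁆ 𝔤 // IsPinned P δ} :=
  if h : ∃ δ, IsOuterPart P α δ then ⟨h.choose, h.choose_spec.1⟩ else ⟨_, isPinned_refl P⟩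

/-- The action of `γ ∈ Γ` on pairs of a weight and a maximal ideal of `S`, for the cocycle `u`:
`ᵞ(μ, N) = (μ ∘ Out (u_γ⁻¹(ᵞN)), ᵞN)`. -/
def galPair {S Γ : Type*} [CommRing S] [Algebra k S] [Algebra.FiniteType k S]
    [Group Γ] [MulSemiringAction Γ S] (u : Γ → (S ⊗[k] 𝔤 ≃ₗ⁅S⁆ S ⊗[k] 𝔤)) (γ : Γ)
    (p : Module.Dual k 𝔥 × MaximalSpectrum S) : Module.Dual k 𝔥 × MaximalSpectrum S :=
  (p.1 ∘ₗ restrictCartan P (outPart P (specialize (u γ).symm (galConj γ p.2))), galConj γ p.2)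

end Pinning

end

end TwistedForms

/-! On the form `twistedForm u`, evaluation at $N$ equals evaluation at ${}^\gamma N$ followed by
the automorphism $u_\gamma^{-1}({}^\gamma N)$ of $\mathfrak g$ (`evalAt_eq_specialize`). Since
$\Gamma$ is transitive on the maximal ideals of $S$ over a given ideal of $R$, each $N_i$ can be
moved to $M_i$ at the price of twisting $W_i$ by an automorphism $\theta_i$. Three facts then give
the theorem.

Separation of factors. If the $M_i$ have distinct contractions to $R$, some element of the form
takes a prescribed value at $M_i$ and vanishes at the other $M_j$: the form spans $\mathfrak g(S)$
over $S$ by Galois descent, and scalars from $R$ separate the points. Such elements act on one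
tensor factor only, so an isomorphism of tensor products, contracted against linear forms on the
other factors, yields $V_i\simeq W_i^{\theta_i}$ (`nonempty_equiv_twistModule`).

Irreducibility forces distinct contractions. If $M_i$ and $M_j$ lie over the same ideal, both
factors are acted on through the same map to $\mathfrak g$, and the mixed Casimir operator $\sum_a
x_a\otimes x^a$ on them commutes with the action. By Schur it is scalar; since simple Lie algebras
act by traceless operators, this makes the action on one factor zero, which nonzero highest weights
exclude (`eq_zero_of_isIrreducible_piTensor`).

Twisting $V_\mu$ by $\theta$ gives $V_{\mu\circ\mathrm{Out}\,\theta}$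
(`IsSimpleOfHighestWeight.twistModule`): an elementary automorphism lifts to the module by
exponentials, and a pinned one preserves the positive root vectors. The decomposition
$\theta=\mathrm{Int}\,\theta\circ\mathrm{Out}\,\theta$ itself has to be constructed
(`exists_isOuterPart`), by three elementary corrections. Genericity of elements conjugate into
$\mathfrak h$ makes the automorphism preserve $\mathfrak h$, reflections make it preserve the base,
and a torus element normalizes the root vectors. Highest weight theory finally turns isomorphisms of
factors into equalities of weights. -/

namespace TwistedForms

set_option linter.unusedSectionVars false

/-! ### Dominant polynomial maps of affine space in characteristic zero. -/

section GenericImage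

open MvPolynomial

/-- The chain rule. It carries both the Jacobian criterion and the computation of differentials
along affine subspaces. -/
theorem pderiv_aeval {σ τ k : Type*} [Fintype σ] [CommRing k] (f : σ → MvPolynomial τ k)
    (p : MvPolynomial σ k) (j : τ) :
    pderiv j (aeval f p) = ∑ i, aeval f (pderiv i p) * pderiv j (f i) := by
  classical
  induction p using MvPolynomial.induction_on with
  | C a => simp [← algebraMap_eq]
  | add p q hp hq => simp only [map_add, hp, hq, add_mul, Finset.sum_add_distrib]
  | mul_X p l hp =>
    simp only [map_mul, aeval_X, pderiv_mul, hp, pderiv_X, map_add, add_mul,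
      Finset.sum_add_distrib, Finset.sum_mul]
    congr 1
    · exact Finset.sum_congr rfl fun i _ => by ring
    · rw [Finset.sum_eq_single l]
      · simp
      · intro b _ hb
        simp [hb.symm]
      · simp

theorem totalDegree_pderiv_le {σ k : Type*} [CommRing k] (p : MvPolynomial σ k) (i : σ) (d : ℕ)
    (hp : p.totalDegree ≤ d + 1) : (pderiv i p).totalDegree ≤ d := by
  classical
  refine Finset.sup_le fun m hm => ?_
  have : m + Finsupp.single i 1 ∈ p.support := by
    rw [mem_support_iff] at hm ⊢
    intro h0
    rw [coeff_pderiv, h0, zero_mul] at hm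
    exact hm rfl
  have := (le_totalDegree this).trans hp
  rw [Finsupp.sum_add_index' (by simp) (by simp)] at this
  simpa using this

theorem eq_C_of_pderiv_eq_zero {σ k : Type*} [Field k] [CharZero k] (p : MvPolynomial σ k)
    (hp : ∀ i, pderiv i p = 0) : p = C (coeff 0 p) := by
  classical
  ext m
  rw [coeff_C]
  split_ifs with h
  · rw [h]
  · obtain ⟨i, hi⟩ : ∃ i, m i ≠ 0 := by
      by_contra! hcon
      exact h (Finsupp.ext fun i => (hcon i).symm)
    have hle : Finsupp.single i 1 ≤ m := by
      rw [Finsupp.single_le_iff]; omega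
    have h1 := coeff_pderiv (i := i) p (m - Finsupp.single i 1)
    rw [hp i, coeff_zero, tsub_add_cancel_of_le hle] at h1
    exact (mul_eq_zero.1 h1.symm).resolve_right (Nat.cast_add_one_ne_zero _)

/-- The Jacobian criterion for algebraic independence in characteristic zero. -/
theorem algebraicIndependent_of_det_pderiv_ne_zero {σ k : Type*} [Fintype σ] [DecidableEq σ]
    [Field k] [CharZero k] (f : σ → MvPolynomial σ k)
    (hf : (Matrix.of fun i j => pderiv j (f i)).det ≠ 0) : AlgebraicIndependent k f := by
  rw [algebraicIndependent_iff]
  suffices ∀ d : ℕ, ∀ p : MvPolynomial σ k, p.totalDegree ≤ d → aeval f p = 0 → p = 0 from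
    fun p hp => this _ p le_rfl hp
  have hC : ∀ a : k, aeval f (C a : MvPolynomial σ k) = 0 → (C a : MvPolynomial σ k) = 0 := by
    intro a ha
    rw [aeval_C, algebraMap_eq] at ha
    exact ha
  intro d
  induction d with
  | zero =>
    intro p hp h0
    rw [Nat.le_zero, totalDegree_eq_zero_iff_eq_C] at hp
    rw [hp] at h0 ⊢
    exact hC _ h0
  | succ d ih =>
    intro p hp h0
    -- Differentiating the relation $p(f)=0$ shows that the row $((\partial_i p)(f))_i$ is killed by
    -- the Jacobian matrix. The partial derivatives are thus relations of smaller degree, zero by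
    -- induction, so $p$ is constant.
    have key : (fun i => aeval f (pderiv i p)) = 0 := by
      refine Matrix.eq_zero_of_vecMul_eq_zero hf (funext fun j => ?_)
      have := pderiv_aeval f p j
      rw [h0, map_zero] at this
      simpa [Matrix.vecMul, dotProduct] using this.symm
    have := eq_C_of_pderiv_eq_zero p fun i =>
      ih _ (totalDegree_pderiv_le p i d hp) (congrFun key i)
    rw [this] at h0 ⊢
    exact hC _ h0

/-- A point of an algebra over an algebraically closed field lifts along an injective integral
extension. -/
theorem exists_ringHom_comp_algebraMap_eq {k A I : Type*} [Field k] [IsAlgClosed k] [CommRing A]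
    [CommRing I] [Algebra k A] [Algebra A I] [Algebra.IsIntegral A I]
    (hinj : Function.Injective (algebraMap A I)) (χ : A →ₐ[k] k) :
    ∃ χ' : I →+* k, ∀ a, χ' (algebraMap A I a) = χ a := by
  have hχs : Function.Surjective χ := fun a => ⟨algebraMap k A a, by simp⟩
  have hmax : (RingHom.ker χ).IsMaximal := RingHom.ker_isMaximal_of_surjective χ.toRingHom hχs
  obtain ⟨n, hn, hnc⟩ := Ideal.exists_ideal_over_maximal_of_isIntegral (S := I) (RingHom.ker χ)
    (by rw [(RingHom.injective_iff_ker_eq_bot _).1 hinj]; exact bot_le)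
  let := Ideal.Quotient.field n
  -- The residue field is integral over $A/\ker\chi\simeq k$, hence equal to $k$.
  let : Algebra k (I ⧸ n) := ((algebraMap A (I ⧸ n)).comp (algebraMap k A)).toAlgebra
  have hχ : ∀ a : A, algebraMap A (I ⧸ n) a = algebraMap k (I ⧸ n) (χ a) := fun a => by
    change _ = algebraMap A (I ⧸ n) (algebraMap k A (χ a))
    rw [← sub_eq_zero, ← map_sub, IsScalarTower.algebraMap_apply A I (I ⧸ n),
      Ideal.Quotient.algebraMap_eq, Ideal.Quotient.eq_zero_iff_mem]
    change _ ∈ n.comap (algebraMap A I)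
    rw [hnc]
    simp [RingHom.mem_ker]
  have hint : Algebra.IsIntegral k (I ⧸ n) := ⟨fun z => by
    obtain ⟨p, hp, hpz⟩ := Algebra.IsIntegral.isIntegral (R := A) z
    refine ⟨p.map (χ : A →+* k), hp.map _, ?_⟩
    rw [Polynomial.eval₂_map, ← hpz]
    congr 1
    ext a
    exact (hχ a).symm⟩
  have hbij : Function.Bijective (algebraMap k (I ⧸ n)) :=
    IsAlgClosed.algebraMap_bijective_of_isIntegral
  let ε := RingEquiv.ofBijective _ hbij
  refine ⟨(ε.symm : (I ⧸ n) →+* k).comp (Ideal.Quotient.mk n), fun a => ?_⟩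
  change ε.symm (Ideal.Quotient.mk n (algebraMap A I a)) = _
  rw [RingEquiv.symm_apply_eq]
  exact hχ a

/-- If a polynomial ring is algebraic over a domain `A`, then every point of `A` outside some
hypersurface lifts to a point of affine space. -/
theorem exists_ne_zero_forall_exists_eval_algebraMap_eq {σ k A : Type*} [Fintype σ] [Field k]
    [IsAlgClosed k] [CommRing A] [IsDomain A] [Algebra k A] [Algebra A (MvPolynomial σ k)]
    [IsScalarTower k A (MvPolynomial σ k)] [Algebra.IsAlgebraic A (MvPolynomial σ k)]
    (hinj : Function.Injective (algebraMap A (MvPolynomial σ k))) :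
    ∃ d : A, d ≠ 0 ∧ ∀ χ : A →ₐ[k] k, χ d ≠ 0 →
      ∃ x : σ → k, ∀ a, eval x (algebraMap A (MvPolynomial σ k) a) = χ a := by
  classical
  have hmul : ∀ i : σ, ∃ c : A, c ≠ 0 ∧ IsIntegral A (c • (X i : MvPolynomial σ k)) := fun i =>
    (Algebra.IsAlgebraic.isAlgebraic (X i)).exists_integral_multiple
  choose c hc hci using hmul
  obtain ⟨d, hdef⟩ : ∃ d : A, d = ∏ i, c i := ⟨_, rfl⟩
  have hd : d ≠ 0 := hdef ▸ Finset.prod_ne_zero_iff.2 fun i _ => hc i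
  have hdi : ∀ i, IsIntegral A (d • (X i : MvPolynomial σ k)) := fun i => by
    have : d = (∏ j ∈ Finset.univ.erase i, c j) * c i := by
      rw [hdef, Finset.prod_erase_mul _ _ (by simp)]
    rw [this, mul_smul]
    exact (hci i).smul _
  refine ⟨d, hd, fun χ hχd => ?_⟩
  let I := integralClosure A (MvPolynomial σ k)
  have hinj' : Function.Injective (algebraMap A I) := fun a b hab =>
    hinj (congrArg (fun z : I => (z : MvPolynomial σ k)) hab)
  obtain ⟨χ', hχ'⟩ := exists_ringHom_comp_algebraMap_eq hinj' χ
  have hcoe : ∀ a : A, ((algebraMap A I a : I) : MvPolynomial σ k) =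
    algebraMap A (MvPolynomial σ k) a := fun a => rfl
  let x : σ → k := fun i => χ' ⟨_, hdi i⟩ / χ d
  -- The extended point is defined only on integral elements, so values of polynomials are compared
  -- after multiplication by a power of $d$, cancelled at the end.
  have key : ∀ b : MvPolynomial σ k, ∃ N : ℕ, ∃ z : I, (z : MvPolynomial σ k) = d ^ N • b ∧
      χ' z = χ d ^ N * eval x b := by
    intro b
    induction b using MvPolynomial.induction_on with
    | C a =>
      refine ⟨0, algebraMap A I (algebraMap k A a), ?_, ?_⟩
      · rw [hcoe, ← IsScalarTower.algebraMap_apply, pow_zero, one_smul]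
        rfl
      · rw [hχ']
        simp
    | add p q hp hq =>
      obtain ⟨N, z, hz, hz'⟩ := hp
      obtain ⟨N', w, hw, hw'⟩ := hq
      refine ⟨N + N', algebraMap A I d ^ N' * z + algebraMap A I d ^ N * w, ?_, ?_⟩
      · simp only [AddMemClass.coe_add, MulMemClass.coe_mul, SubmonoidClass.coe_pow, hz, hw, hcoe]
        simp only [Algebra.smul_def, map_pow]
        ring
      · simp only [map_add, map_mul, map_pow, hχ', hz', hw']
        ring
    | mul_X p i hp =>
      obtain ⟨N, z, hz, hz'⟩ := hp
      refine ⟨N + 1, z * ⟨_, hdi i⟩, ?_, ?_⟩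
      · simp only [MulMemClass.coe_mul, hz]
        simp only [Algebra.smul_def, map_pow]
        ring
      · have hx : χ' ⟨_, hdi i⟩ = χ d * x i := (mul_div_cancel₀ _ hχd).symm
        rw [map_mul, map_mul, hz', eval_X, hx]
        ring
  refine ⟨x, fun a => ?_⟩
  obtain ⟨N, z, hz, hz'⟩ := key (algebraMap A _ a)
  have hzA : z = algebraMap A I (d ^ N * a) := Subtype.ext (by
    rw [hz, hcoe, Algebra.smul_def, map_mul])
  rw [hzA, hχ', map_mul, map_pow] at hz'
  exact (mul_left_cancel₀ (pow_ne_zero N hχd) hz').symm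

/-- A polynomial self-map of affine space whose Jacobian determinant is not identically zero hits
every point outside some hypersurface. -/
theorem exists_ne_zero_forall_exists_eval_eq {σ k : Type*} [Fintype σ] [DecidableEq σ]
    [Field k] [CharZero k] [IsAlgClosed k] (f : σ → MvPolynomial σ k)
    (hf : (Matrix.of fun i j => pderiv j (f i)).det ≠ 0) :
    ∃ g : MvPolynomial σ k, g ≠ 0 ∧
      ∀ y : σ → k, eval y g ≠ 0 → ∃ x : σ → k, ∀ i, eval x (f i) = y i := by
  have hind := algebraicIndependent_of_det_pderiv_ne_zero f hf
  -- As many independent elements as variables form a transcendence basis, so the polynomial ring is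
  -- algebraic over the subalgebra generated by the $f_i$.
  have htb : IsTranscendenceBasis k f :=
    hind.isTranscendenceBasis_of_lift_trdeg_le_of_finite (by
      rw [MvPolynomial.trdeg_of_isDomain]; simp)
  have halg := htb.isAlgebraic
  obtain ⟨d, hd, H⟩ := exists_ne_zero_forall_exists_eval_algebraMap_eq
    (A := Algebra.adjoin k (Set.range f)) (σ := σ) (k := k) Subtype.val_injective
  refine ⟨hind.aevalEquiv.symm d, by simpa using hd, fun y hy => ?_⟩
  obtain ⟨x, hx⟩ := H ((aeval y).comp
    (hind.aevalEquiv.symm : Algebra.adjoin k (Set.range f) →ₐ[k] MvPolynomial σ k))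
    (by simpa [aeval_eq_eval] using hy)
  refine ⟨x, fun i => ?_⟩
  have h1 := hx (hind.aevalEquiv (X i))
  rw [hind.algebraMap_aevalEquiv, aeval_X] at h1
  rw [h1]
  simp

end GenericImage

/-! ### Exponentials of nilpotent endomorphisms. -/

section NilExp

variable {k V W : Type*} [Field k] [AddCommGroup V] [Module k V]
  [AddCommGroup W] [Module k W]

/-- The exponential `∑ j, a ^ j / j!` of a nilpotent endomorphism. -/
noncomputable def nilExp (a : Module.End k V) : Module.End k V :=
  ∑ j ∈ Finset.range (nilpotencyClass a), (j.factorial : k)⁻¹ • a ^ j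

theorem nilExp_eq_exp [Module ℚ V] (a : Module.End k V) : nilExp a = IsNilpotent.exp a := by
  refine Finset.sum_congr rfl fun j _ => LinearMap.ext fun v => ?_
  rw [LinearMap.smul_apply, LinearMap.smul_apply, inv_natCast_smul_eq k ℚ]

variable [CharZero k]

theorem nilExp_zero : nilExp (0 : Module.End k V) = 1 := by
  let : Module ℚ V := Module.compHom V (algebraMap ℚ k)
  rw [nilExp_eq_exp, IsNilpotent.exp_zero]

theorem nilExp_eq_sum {a : Module.End k V} {N : ℕ} (h : a ^ N = 0) :
    nilExp a = ∑ j ∈ Finset.range N, (j.factorial : k)⁻¹ • a ^ j := by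
  let : Module ℚ V := Module.compHom V (algebraMap ℚ k)
  rw [nilExp_eq_exp, IsNilpotent.exp_eq_sum h]
  refine Finset.sum_congr rfl fun j _ => LinearMap.ext fun v => ?_
  rw [LinearMap.smul_apply, LinearMap.smul_apply, inv_natCast_smul_eq k ℚ]

/-- The truncation depends only on the vector. This makes exponentials on short root strings
explicit without knowing the nilpotency index of `a`. -/
theorem nilExp_apply_eq_sum {a : Module.End k V} (ha : IsNilpotent a) {N : ℕ} {v : V}
    (h : (a ^ N) v = 0) :
    nilExp a v = ∑ j ∈ Finset.range N, (j.factorial : k)⁻¹ • (a ^ j) v := by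
  let : Module ℚ V := Module.compHom V (algebraMap ℚ k)
  have := IsNilpotent.exp_smul_eq_sum (M := V) (a := a) (m := v) h ha
  rw [nilExp_eq_exp]
  refine this.trans (Finset.sum_congr rfl fun j _ => inv_natCast_smul_eq ℚ k _ _)

theorem nilExp_mul_nilExp_neg {a : Module.End k V} (ha : IsNilpotent a) :
    nilExp a * nilExp (-a) = 1 := by
  let : Module ℚ V := Module.compHom V (algebraMap ℚ k)
  rw [nilExp_eq_exp, nilExp_eq_exp, IsNilpotent.exp_mul_exp_neg_self ha]

theorem nilExp_neg_mul_nilExp {a : Module.End k V} (ha : IsNilpotent a) :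
    nilExp (-a) * nilExp a = 1 := by
  simpa using nilExp_mul_nilExp_neg ha.neg

theorem nilExp_comp_eq {a : Module.End k V} {b : Module.End k W} (ha : IsNilpotent a)
    (hb : IsNilpotent b) {g : V →ₗ[k] W} (h : b ∘ₗ g = g ∘ₗ a) :
    nilExp b ∘ₗ g = g ∘ₗ nilExp a := by
  let : Module ℚ V := Module.compHom V (algebraMap ℚ k)
  let : Module ℚ W := Module.compHom W (algebraMap ℚ k)
  rw [nilExp_eq_exp, nilExp_eq_exp, Module.End.commute_exp_left_of_commute ha hb h]

theorem nilExp_add {a b : Module.End k V} (h : Commute a b) (ha : IsNilpotent a)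
    (hb : IsNilpotent b) : nilExp (a + b) = nilExp a * nilExp b := by
  let : Module ℚ V := Module.compHom V (algebraMap ℚ k)
  simp only [nilExp_eq_exp, IsNilpotent.exp_add_of_commute h ha hb]

theorem map_nilExp {a : Module.End k V} (ha : IsNilpotent a)
    (f : Module.End k V →ₐ[k] Module.End k W) : f (nilExp a) = nilExp (f a) := by
  obtain ⟨N, hN⟩ := ha
  have hN' : f a ^ N = 0 := by rw [← map_pow, hN, map_zero]
  rw [nilExp_eq_sum hN, nilExp_eq_sum hN', map_sum]
  simp only [map_smul, map_pow]

/-- By the Leibniz rule the action map $L\otimes W\to W$ intertwines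
$\mathrm{ad}\,x\otimes1+1\otimes x$ with $x$. The two summands commute, so the exponential of the
sum is the product of exponentials. For $W=L$ this says that $\exp(\mathrm{ad}\,x)$ is an
automorphism; in general it lifts that automorphism to $W$. -/
theorem nilExp_lie {L : Type*} [LieRing L] [LieAlgebra k L] [LieRingModule L W] [LieModule k L W]
    {x : L} (hx : IsNilpotent (LieAlgebra.ad k L x)) (hx' : IsNilpotent (LieModule.toEnd k L W x))
    (y : L) (w : W) :
    nilExp (LieModule.toEnd k L W x) ⁅y, w⁆ =
      ⁅nilExp (LieAlgebra.ad k L x) y, nilExp (LieModule.toEnd k L W x) w⁆ := by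
  let m : L ⊗[k] W →ₗ[k] W := TensorProduct.lift (LieModule.toEnd k L W : L →ₗ[k] Module.End k W)
  let a : Module.End k (L ⊗[k] W) := Module.End.rTensorAlgHom k L W (LieAlgebra.ad k L x)
  let b : Module.End k (L ⊗[k] W) := Module.End.lTensorAlgHom k W L (LieModule.toEnd k L W x)
  have hr : ∀ (f : Module.End k L) y w,
      Module.End.rTensorAlgHom k L W f (y ⊗ₜ[k] w) = f y ⊗ₜ[k] w := fun _ _ _ => rfl
  have hl : ∀ (f : Module.End k W) y w,
      Module.End.lTensorAlgHom k W L f (y ⊗ₜ[k] w) = y ⊗ₜ[k] f w := fun _ _ _ => rfl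
  have ha : IsNilpotent a := hx.map _
  have hb : IsNilpotent b := hx'.map _
  have hab : Commute a b := TensorProduct.ext' fun y w => by
    simp only [a, b, Module.End.mul_apply, hr, hl]
  have h1 : nilExp (LieModule.toEnd k L W x) ∘ₗ m = m ∘ₗ nilExp (a + b) := by
    refine nilExp_comp_eq (hab.isNilpotent_add ha hb) hx' ?_
    refine TensorProduct.ext' fun y w => ?_
    simp only [a, b, m, LinearMap.comp_apply, LinearMap.add_apply, hr, hl, map_add,
      TensorProduct.lift.tmul]
    simp
  have h2 := LinearMap.congr_fun h1 (y ⊗ₜ w)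
  rw [nilExp_add hab ha hb, ← map_nilExp hx, ← map_nilExp hx'] at h2
  simp only [m, LinearMap.comp_apply, Module.End.mul_apply, hr, hl, TensorProduct.lift.tmul] at h2
  exact h2

end NilExp

/-! ### The group of elementary automorphisms. -/

section Elementary

variable {k 𝔤 : Type*} [Field k] [LieRing 𝔤] [LieAlgebra k 𝔤]

/-- A Lie algebra automorphism lying in the elementary group. -/
def IsElementary (ι : 𝔤 ≃ₗ⁅k⁆ 𝔤) : Prop := ι.toLinearEquiv ∈ elementaryGroup k 𝔤

theorem isElementary_refl : IsElementary (LieEquiv.refl : 𝔤 ≃ₗ⁅k⁆ 𝔤) :=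
  (elementaryGroup k 𝔤).one_mem

theorem IsElementary.trans {ι κ : 𝔤 ≃ₗ⁅k⁆ 𝔤} (hι : IsElementary ι) (hκ : IsElementary κ) :
    IsElementary (ι.trans κ) :=
  (elementaryGroup k 𝔤).mul_mem hκ hι

theorem IsElementary.symm {ι : 𝔤 ≃ₗ⁅k⁆ 𝔤} (hι : IsElementary ι) : IsElementary ι.symm :=
  (elementaryGroup k 𝔤).inv_mem hι

theorem isNilpotent_ad_map (α : 𝔤 ≃ₗ⁅k⁆ 𝔤) {x : 𝔤} (hx : IsNilpotent (LieAlgebra.ad k 𝔤 x)) :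
    IsNilpotent (LieAlgebra.ad k 𝔤 (α x)) := by
  have : LieAlgebra.ad k 𝔤 (α x) = α.toLinearEquiv.conjAlgEquiv k (LieAlgebra.ad k 𝔤 x) := by
    ext y
    have : (⁅α x, y⁆ : 𝔤) = α ⁅x, α.symm y⁆ := by rw [LieEquiv.map_lie, LieEquiv.apply_symm_apply]
    exact this
  rw [this]
  exact hx.map _

variable [CharZero k]

/-- The automorphism `exp (ad x)` for `ad x` nilpotent. -/
noncomputable def expAd (x : 𝔤) (hx : IsNilpotent (LieAlgebra.ad k 𝔤 x)) : 𝔤 ≃ₗ⁅k⁆ 𝔤 where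
  toLinearMap := nilExp (LieAlgebra.ad k 𝔤 x)
  map_lie' := nilExp_lie hx hx _ _
  invFun := nilExp (-LieAlgebra.ad k 𝔤 x)
  left_inv := LinearMap.congr_fun (nilExp_neg_mul_nilExp hx)
  right_inv := LinearMap.congr_fun (nilExp_mul_nilExp_neg hx)

theorem expAd_apply (x : 𝔤) (hx : IsNilpotent (LieAlgebra.ad k 𝔤 x)) (y : 𝔤) :
    expAd x hx y = nilExp (LieAlgebra.ad k 𝔤 x) y := rfl

theorem isElementary_expAd (x : 𝔤) (hx : IsNilpotent (LieAlgebra.ad k 𝔤 x)) :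
    IsElementary (expAd x hx) :=
  Subgroup.subset_closure ⟨x, hx, rfl⟩

/-- Induction for elementary automorphisms. -/
theorem elementaryGroup_induction {p : (𝔤 ≃ₗ[k] 𝔤) → Prop}
    (exp : ∀ x (hx : IsNilpotent (LieAlgebra.ad k 𝔤 x)), p (expAd x hx).toLinearEquiv)
    (one : p 1) (mul : ∀ e f, p e → p f → p (e * f)) (inv : ∀ e, p e → p e⁻¹)
    {e : 𝔤 ≃ₗ[k] 𝔤} (he : e ∈ elementaryGroup k 𝔤) : p e := by
  induction he using Subgroup.closure_induction with
  | mem e he =>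
    obtain ⟨x, hx, he⟩ := he
    have : e = (expAd x hx).toLinearEquiv := LinearEquiv.toLinearMap_injective he
    exact this ▸ exp x hx
  | one => exact one
  | mul e f _ _ h1 h2 => exact mul e f h1 h2
  | inv e _ h => exact inv e h

theorem expAd_map_apply (α : 𝔤 ≃ₗ⁅k⁆ 𝔤) {x : 𝔤} (hx : IsNilpotent (LieAlgebra.ad k 𝔤 x)) (y : 𝔤) :
    expAd (α x) (isNilpotent_ad_map α hx) (α y) = α (expAd x hx y) := by
  refine LinearMap.congr_fun (nilExp_comp_eq (g := α.toLinearEquiv.toLinearMap) hx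
    (isNilpotent_ad_map α hx) ?_) y
  ext y
  exact (α.map_lie x y).symm

/-- Conjugating $\exp(\mathrm{ad}\,x)$ by an automorphism $\alpha$ gives
$\exp(\mathrm{ad}\,\alpha(x))$. Normality lets factors that are not known to be elementary enter
through conjugation. -/
theorem conj_mem_elementaryGroup (α : 𝔤 ≃ₗ⁅k⁆ 𝔤) {e : 𝔤 ≃ₗ[k] 𝔤} (he : e ∈ elementaryGroup k 𝔤) :
    α.toLinearEquiv * e * α.toLinearEquiv⁻¹ ∈ elementaryGroup k 𝔤 := by
  refine elementaryGroup_induction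
    (p := fun e => α.toLinearEquiv * e * α.toLinearEquiv⁻¹ ∈ elementaryGroup k 𝔤)
    (fun x hx => ?_) (by simp) (fun e f h1 h2 => by simpa [mul_assoc] using mul_mem h1 h2)
    (fun e h => by simpa [mul_assoc] using inv_mem h) he
  · have h : α.toLinearEquiv * (expAd x hx).toLinearEquiv * α.toLinearEquiv⁻¹ =
        (expAd (α x) (isNilpotent_ad_map α hx)).toLinearEquiv := ?_
    · rw [h]
      exact isElementary_expAd (α x) (isNilpotent_ad_map α hx)
    ext y
    have := expAd_map_apply α hx (α.symm y)
    rw [LieEquiv.apply_symm_apply] at this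
    exact this.symm

theorem IsElementary.conj {ι : 𝔤 ≃ₗ⁅k⁆ 𝔤} (hι : IsElementary ι) (α : 𝔤 ≃ₗ⁅k⁆ 𝔤) :
    IsElementary (α.symm.trans (ι.trans α)) :=
  conj_mem_elementaryGroup α hι

end Elementary

/-! ### Polynomial maps into a vector space and their generic image. -/

section PolyMap

open MvPolynomial

variable {τ k V W : Type*} [Field k] [AddCommGroup V] [Module k V] [AddCommGroup W] [Module k W]

/-- A map from affine space to a vector space all of whose coordinates are polynomials. -/
def IsPolyMap (F : (τ → k) → V) : Prop :=
  ∀ f : Module.Dual k V, ∃ p : MvPolynomial τ k, ∀ x, f (F x) = eval x p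

theorem IsPolyMap.sum {ι : Type*} {s : Finset ι} {F : ι → (τ → k) → V}
    (hF : ∀ i ∈ s, IsPolyMap (F i)) : IsPolyMap fun x => ∑ i ∈ s, F i x := by
  intro f
  choose! p hp using fun i hi => hF i hi f
  exact ⟨∑ i ∈ s, p i, fun x => by
    rw [map_sum, map_sum]
    exact Finset.sum_congr rfl fun i hi => hp i hi x⟩

theorem IsPolyMap.linear {F : (τ → k) → V} (hF : IsPolyMap F) (A : V →ₗ[k] W) :
    IsPolyMap fun x => A (F x) := fun f => hF (f ∘ₗ A)

theorem IsPolyMap.smul {F : (τ → k) → V} (hF : IsPolyMap F) (p : MvPolynomial τ k) :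
    IsPolyMap fun x => eval x p • F x := fun f => by
  obtain ⟨q, hq⟩ := hF f
  exact ⟨p * q, fun x => by simp [hq]⟩

theorem isPolyMap_const (v : V) : IsPolyMap fun _ : τ → k => v :=
  fun f => ⟨C (f v), fun x => by simp⟩

theorem IsPolyMap.nilExp [CharZero k] {F : (τ → k) → V} (hF : IsPolyMap F) {a : Module.End k V}
    (ha : IsNilpotent a) (j : τ) : IsPolyMap fun x => nilExp (x j • a) (F x) := by
  obtain ⟨N, hN⟩ := ha
  have h : ∀ x : τ → k, TwistedForms.nilExp (x j • a) (F x) =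
      ∑ i ∈ Finset.range N, eval x (X j ^ i) • ((i.factorial : k)⁻¹ • a ^ i) (F x) := fun x => by
    have : (x j • a) ^ N = 0 := by rw [smul_pow, hN, smul_zero]
    rw [nilExp_eq_sum this, LinearMap.sum_apply]
    refine Finset.sum_congr rfl fun i _ => ?_
    simp only [LinearMap.smul_apply, smul_pow, map_pow, eval_X]
    rw [smul_comm]
  simp only [h]
  exact IsPolyMap.sum fun i _ => (hF.linear _).smul _

theorem eval_aeval {σ : Type*} (y : σ → k) (f : τ → MvPolynomial σ k) (q : MvPolynomial τ k) :
    eval y (aeval f q) = eval (fun j => eval y (f j)) q := by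
  induction q using MvPolynomial.induction_on with
  | C a => simp [← algebraMap_eq]
  | add p q hp hq => simp only [map_add, hp, hq]
  | mul_X p i hp => simp only [map_mul, hp, aeval_X, eval_X]

/-- Along the line the polynomial agrees with an affine function at every point of an infinite
field, hence formally. The chain rule then identifies the slope with the directional derivative. -/
theorem sum_eval_pderiv_mul_eq [Fintype τ] [Infinite k] (p : MvPolynomial τ k) (a v : τ → k)
    (c d : k) (h : ∀ ε : k, eval (a + ε • v) p = c + ε * d) :
    ∑ j, eval a (pderiv j p) * v j = d := by
  let f : τ → MvPolynomial Unit k := fun j => C (a j) + X () * C (v j)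
  have hev : ∀ (x : Unit → k) (q : MvPolynomial τ k),
      eval x (aeval f q) = eval (a + x () • v) q := fun x q => by
    rw [eval_aeval]
    congr 2
    funext j
    simp [f]
  have h1 : aeval f p = C c + X () * C d := MvPolynomial.funext fun x => by
    rw [hev, h]; simp
  have h2 := congrArg (eval 0) (pderiv_aeval f p ())
  rw [h1, map_sum] at h2
  simp only [map_mul, hev] at h2
  simpa [f] using h2.symm

/-- A polynomial map whose differential at some point is surjective hits every point outside some
hypersurface. -/
theorem IsPolyMap.exists_ne_zero_forall_exists {σ : Type*} [Fintype σ] [Fintype τ] [CharZero k]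
    [IsAlgClosed k] (b : Module.Basis σ k V) {F : (τ → k) → V} (hF : IsPolyMap F) (a : τ → k)
    (hs : Submodule.span k {w | ∃ v : τ → k, ∀ ε : k, F (a + ε • v) = F a + ε • w} = ⊤) :
    ∃ g : MvPolynomial σ k, g ≠ 0 ∧ ∀ y : V, eval (b.repr y) g ≠ 0 → ∃ x, F x = y := by
  classical
  choose p hp using fun i => hF (b.coord i)
  let D : (τ → k) →ₗ[k] V := ∑ i, (∑ j, eval a (pderiv j (p i)) • LinearMap.proj j).smulRight (b i)
  have hD : ∀ v i, b.coord i (D v) = ∑ j, eval a (pderiv j (p i)) * v j := fun v i => by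
    simp [D, LinearMap.sum_apply, Finsupp.single_apply]
  -- `D` is the differential of `F` at `a`. Along each line in `hs` the map is exactly affine, so
  -- its slope lies in the image of `D`.
  have hDtop : LinearMap.range D = ⊤ := by
    rw [eq_top_iff, ← hs, Submodule.span_le]
    rintro w ⟨v, hv⟩
    refine ⟨v, b.ext_elem fun i => ?_⟩
    refine (hD v i).trans (sum_eval_pderiv_mul_eq (p i) a v (b.coord i (F a)) _ fun ε => ?_)
    rw [← hp, hv]
    simp
  choose v hv using fun i => LinearMap.range_eq_top.1 hDtop (b i)
  -- Restriction to the affine subspace through `a` spanned by preimages `v l` of the basis vectors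
  -- makes source and target dimensions agree; the Jacobian matrix at the origin is then the
  -- identity.
  let f : τ → MvPolynomial σ k := fun j => C (a j) + ∑ l, X l * C (v l j)
  have hev : ∀ (y : σ → k) (q : MvPolynomial τ k),
      eval y (aeval f q) = eval (a + ∑ l, y l • v l) q := fun x q => by
    rw [eval_aeval]
    congr 2
    funext j
    simp [f]
  have hdet : (Matrix.of fun i l => pderiv l (aeval f (p i))).det ≠ 0 := by
    intro h0
    have h1 := congrArg (eval (0 : σ → k)) h0
    rw [map_zero, RingHom.map_det] at h1
    have h2 : (eval (0 : σ → k)).mapMatrix (Matrix.of fun i l => pderiv l (aeval f (p i))) = 1 := by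
      ext i l
      rw [RingHom.mapMatrix_apply, Matrix.map_apply, Matrix.of_apply, pderiv_aeval, map_sum]
      have : b.coord i (D (v l)) = (1 : Matrix σ σ k) i l := by
        rw [hv, Matrix.one_apply]
        simp [Finsupp.single_apply, eq_comm]
      rw [← this, hD]
      refine Finset.sum_congr rfl fun j _ => ?_
      rw [map_mul, hev]
      simp [f, pderiv_X, Pi.single_apply]
    rw [h2, Matrix.det_one] at h1
    exact one_ne_zero h1
  obtain ⟨g, hg, H⟩ := exists_ne_zero_forall_exists_eval_eq _ hdet
  refine ⟨g, hg, fun y hy => ?_⟩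
  obtain ⟨x, hx⟩ := H _ hy
  refine ⟨a + ∑ l, x l • v l, b.ext_elem fun i => ?_⟩
  rw [← hx, hev, ← hp]
  rfl

end PolyMap

/-! ### Root spaces, heights, and generic conjugacy into the Cartan subalgebra. -/

section Roots

open LieAlgebra LieAlgebra.IsKilling

variable {k 𝔤 : Type*} [Field k] [IsAlgClosed k] [CharZero k] [LieRing 𝔤] [LieAlgebra k 𝔤]
  [FiniteDimensional k 𝔤] [LieAlgebra.IsSimple k 𝔤]
  {𝔥 : LieSubalgebra k 𝔤} [𝔥.IsCartanSubalgebra]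

theorem eq_top_of_cartan_le_of_rootSpace_le {N : Submodule k 𝔤} (h𝔥 : 𝔥.toSubmodule ≤ N)
    (hα : ∀ α : 𝔥.root, (rootSpace 𝔥 α.1).toSubmodule ≤ N) : N = ⊤ := by
  have h := congrArg LieSubmodule.toSubmodule (LieModule.iSup_genWeightSpace_eq_top' k 𝔥 𝔤)
  rw [LieSubmodule.iSup_toSubmodule, LieSubmodule.top_toSubmodule] at h
  rw [eq_top_iff, ← h, iSup_le_iff]
  intro α
  by_cases h0 : α.IsZero
  · have : (α : 𝔥 → k) = 0 := h0
    rw [this]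
    intro x hx
    have hx' : x ∈ rootSpace 𝔥 (0 : 𝔥 → k) := hx
    rw [rootSpace_zero_eq] at hx'
    exact h𝔥 hx'
  · exact hα ⟨α, by simpa using h0⟩

theorem lie_of_mem_rootSpace {α : 𝔥 → k} {x : 𝔤} (hx : x ∈ rootSpace 𝔥 α) (h : 𝔥) :
    ⁅(h : 𝔤), x⁆ = α h • x :=
  lie_eq_smul_of_mem_rootSpace hx h

theorem mem_rootSpace_iff {α : 𝔥 → k} {x : 𝔤} :
    x ∈ rootSpace 𝔥 α ↔ ∀ h : 𝔥, ⁅(h : 𝔤), x⁆ = α h • x := by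
  refine ⟨lie_of_mem_rootSpace, fun hx => LieModule.weightSpace_le_genWeightSpace 𝔤 α ?_⟩
  exact (LieModule.mem_weightSpace ..).2 hx

theorem lie_cartan_cartan (h h' : 𝔥) : ⁅(h : 𝔤), (h' : 𝔤)⁆ = 0 := by
  have : ⁅h, h'⁆ = 0 := trivial_lie_zero _ _ _ _
  exact congrArg Subtype.val this

theorem isNilpotent_ad_of_mem_root (α : 𝔥.root) {x : 𝔤} (hx : x ∈ rootSpace 𝔥 α.1) :
    IsNilpotent (ad k 𝔤 x) :=
  isNilpotent_ad_of_mem_rootSpace 𝔥 (𝔥.isNonZero_coe_root α) hx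

theorem exists_forall_root_eq (b : (rootSystem 𝔥).Base) (c : b.support → k) :
    ∃ h : 𝔥, ∀ i : b.support, i.1.1 h = c i := by
  refine ⟨(Module.evalEquiv k 𝔥).symm (b.toWeightBasis.constr k c), fun i => ?_⟩
  have h1 := Module.apply_evalEquiv_symm_apply k 𝔥 (i.1.1.toLinear : Module.Dual k 𝔥)
    (b.toWeightBasis.constr k c)
  refine h1.trans ?_
  have : (i.1.1.toLinear : Module.Dual k 𝔥) = b.toWeightBasis i := by simp
  rw [this, Module.Basis.constr_basis]

/-- Such an `h` is half the sum of the positive coroots. No root vanishes on it, and its eigenvalues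
grade the Lie algebra by height; it serves as the regular base point throughout. -/
theorem root_apply_eq_height (b : (rootSystem 𝔥).Base) {h : 𝔥} (hh : ∀ i : b.support, i.1.1 h = 1)
    (α : 𝔥.root) : α.1 h = (b.height α : k) := by
  obtain ⟨f, -, -, hf⟩ := b.exists_root_eq_sum_int α
  rw [b.height_eq_sum hf]
  have h1 := LinearMap.congr_fun hf h
  rw [LinearMap.sum_apply] at h1
  refine h1.trans ?_
  push_cast
  refine Finset.sum_congr rfl fun i hi => ?_
  have := hh ⟨i, hi⟩
  simp [this]

theorem exists_forall_root_apply_eq_height (b : (rootSystem 𝔥).Base) :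
    ∃ h : 𝔥, ∀ α : 𝔥.root, α.1 h = (b.height α : k) := by
  obtain ⟨h, hh⟩ := exists_forall_root_eq b fun _ => 1
  exact ⟨h, root_apply_eq_height b hh⟩

theorem list_prod_map_eq_of_nodup {ι M : Type*} [Monoid M] {f : ι → M} {l : List ι} (hl : l.Nodup)
    {a : ι} (ha : a ∈ l) (hf : ∀ i, i ≠ a → f i = 1) : (l.map f).prod = f a := by
  induction l with
  | nil => simp at ha
  | cons i l ih =>
    rw [List.nodup_cons] at hl
    rw [List.map_cons, List.prod_cons]
    by_cases hi : i = a
    · have : (l.map f).prod = 1 := List.prod_eq_one fun m hm => by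
        obtain ⟨j, hj, rfl⟩ := List.mem_map.1 hm
        exact hf j fun h => hl.1 (hi ▸ h ▸ hj)
      rw [this, mul_one, hi]
    · rw [hf i hi, one_mul, ih hl.2 ((List.mem_cons.1 ha).resolve_left (Ne.symm hi))]

/-- The product `∏ exp (t_α ad x_α)` of elementary automorphisms is elementary. -/
theorem exists_isElementary_list_prod {ι : Type*} (x : ι → 𝔤) (hx : ∀ i, IsNilpotent (ad k 𝔤 (x i)))
    (t : ι → k) (l : List ι) : ∃ e : 𝔤 ≃ₗ⁅k⁆ 𝔤, IsElementary e ∧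
      ∀ y, (l.map fun i => nilExp (t i • ad k 𝔤 (x i))).prod y = e y := by
  induction l with
  | nil => exact ⟨LieEquiv.refl, isElementary_refl, fun y => rfl⟩
  | cons i l ih =>
    obtain ⟨e, he, h⟩ := ih
    have hi : IsNilpotent (ad k 𝔤 (t i • x i)) := by
      rw [map_smul]; exact (hx i).smul _
    refine ⟨e.trans (expAd _ hi), he.trans (isElementary_expAd _ _), fun y => ?_⟩
    rw [List.map_cons, List.prod_cons, Module.End.mul_apply, h, ← map_smul]
    rfl

/-- The elements of `𝔤` conjugate to an element of the Cartan subalgebra `𝔥` under the elementary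
group contain the complement of a hypersurface. -/
theorem exists_ne_zero_forall_exists_isElementary (base : (rootSystem 𝔥).Base) {σ : Type*}
    [Fintype σ] (b : Module.Basis σ k 𝔤) :
    ∃ g : MvPolynomial σ k, g ≠ 0 ∧ ∀ y : 𝔤, MvPolynomial.eval (b.repr y) g ≠ 0 →
      ∃ e : 𝔤 ≃ₗ⁅k⁆ 𝔤, IsElementary e ∧ ∃ h : 𝔥, y = e h := by
  classical
  have hx : ∀ α : 𝔥.root, ∃ x ∈ rootSpace 𝔥 α.1, x ≠ 0 := fun α =>
    α.1.exists_ne_zero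
  choose x hxα hx0 using hx
  have hxn : ∀ α, IsNilpotent (ad k 𝔤 (x α)) := fun α => isNilpotent_ad_of_mem_root α (hxα α)
  let c := Module.finBasis k 𝔥
  let H : (𝔥.root ⊕ Fin (Module.finrank k 𝔥) → k) → 𝔤 := fun t => ((∑ i, t (.inr i) • c i : 𝔥) : 𝔤)
  let E (l : List 𝔥.root) (t : 𝔥.root ⊕ Fin (Module.finrank k 𝔥) → k) : Module.End k 𝔤 :=
    (l.map fun α => nilExp (t (.inl α) • ad k 𝔤 (x α))).prod
  -- Parameters are one exponent per root and coordinates on $\mathfrak h$. The value is an element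
  -- of $\mathfrak h$ moved by $\prod_\alpha\exp(t_\alpha\,\mathrm{ad}\,x_\alpha)$, so a dense image
  -- is what is needed.
  let F (t : 𝔥.root ⊕ Fin (Module.finrank k 𝔥) → k) : 𝔤 := E Finset.univ.toList t (H t)
  have hH : IsPolyMap H := by
    have : H = fun t => ∑ i, MvPolynomial.eval t (MvPolynomial.X (.inr i)) • (c i : 𝔤) := by
      funext t
      simp [H]
    rw [this]
    exact IsPolyMap.sum fun i _ => (isPolyMap_const _).smul _
  have hF : IsPolyMap F := by
    have : ∀ l : List 𝔥.root, IsPolyMap fun t => E l t (H t) := fun l => by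
      induction l with
      | nil => exact hH
      | cons α l ih =>
        have := ih.nilExp (hxn α) (.inl α)
        simpa [E] using this
    exact this _
  obtain ⟨h₀, hh₀⟩ := exists_forall_root_apply_eq_height base
  -- Base point: trivial exponentials applied to $h_0$. Varying the coordinates on $\mathfrak h$
  -- produces $\mathfrak h$ in the image of the differential, and varying $t_\alpha$ produces
  -- $\mathfrak g^\alpha$ because $\alpha(h_0)\ne0$.
  let a : 𝔥.root ⊕ Fin (Module.finrank k 𝔥) → k := Sum.elim 0 (c.repr h₀)
  have hE0 : ∀ t : 𝔥.root ⊕ Fin (Module.finrank k 𝔥) → k, (∀ α, t (.inl α) = 0) →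
      E Finset.univ.toList t = 1 := fun t ht => by
    refine List.prod_eq_one fun f hf => ?_
    obtain ⟨α, -, rfl⟩ := List.mem_map.1 hf
    rw [ht, zero_smul, nilExp_zero]
  have hHa : H a = h₀ := congrArg Subtype.val (c.sum_repr h₀)
  have hFa : F a = h₀ := by
    change E _ a (H a) = _
    rw [hE0 a fun _ => rfl, hHa]
    rfl
  obtain ⟨g, hg, Hg⟩ := hF.exists_ne_zero_forall_exists b a (by
    refine eq_top_of_cartan_le_of_rootSpace_le (𝔥 := 𝔥) ?_ ?_
    · intro h hh
      refine Submodule.subset_span ⟨Sum.elim 0 (c.repr ⟨h, hh⟩), fun ε => ?_⟩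
      rw [hFa]
      change E _ _ (H _) = _
      rw [hE0 _ (by simp [a])]
      have : ∀ ε : k, (∑ i, (c.repr h₀ i + ε * c.repr ⟨h, hh⟩ i) • c i) = h₀ + ε • ⟨h, hh⟩ := by
        intro ε
        simp only [add_smul, Finset.sum_add_distrib, mul_smul, ← Finset.smul_sum, c.sum_repr]
      exact congrArg Subtype.val (this ε)
    · intro α y hy
      have hα0 : α.1 h₀ ≠ 0 := by
        rw [hh₀]
        exact_mod_cast base.height_ne_zero α
      obtain ⟨r, rfl⟩ : ∃ r : k, r • x α = y := by
        have := finrank_rootSpace_eq_one α.1 (𝔥.isNonZero_coe_root α)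
        obtain ⟨r, hr⟩ := (finrank_eq_one_iff_of_nonzero' (⟨x α, hxα α⟩ : rootSpace 𝔥 α.1)
          (by simpa using hx0 α)).1 this ⟨y, hy⟩
        exact ⟨r, congrArg Subtype.val hr⟩
      have hmem : (α.1 h₀) • x α ∈ Submodule.span k
          {w | ∃ v, ∀ ε : k, F (a + ε • v) = F a + ε • w} := by
        -- Since $(\mathrm{ad}\,x_\alpha)^2h_0=0$, one has
        -- $\exp(-\varepsilon\,\mathrm{ad}\,x_\alpha)h_0=h_0+\varepsilon\,\alpha(h_0)x_\alpha$
        -- exactly.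
        refine Submodule.subset_span ⟨Sum.elim (Pi.single α (-1)) 0, fun ε => ?_⟩
        have hprod : E Finset.univ.toList (a + ε • Sum.elim (Pi.single α (-1)) 0) =
            nilExp ((-ε) • ad k 𝔤 (x α)) := by
          change List.prod _ = _
          rw [list_prod_map_eq_of_nodup (Finset.nodup_toList _) (a := α) (by simp)]
          · simp [a]
          · intro β hβ
            simp [a, hβ, nilExp_zero]
        have hHε : H (a + ε • Sum.elim (Pi.single α (-1)) 0) = h₀ := by
          rw [← hHa]
          simp [H]
        change E _ _ (H _) = _
        have hlie : ⁅x α, (h₀ : 𝔤)⁆ = -(α.1 h₀ • x α) := by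
          rw [← lie_skew, lie_of_mem_rootSpace (hxα α)]
        rw [hprod, hHε, hFa, nilExp_apply_eq_sum (N := 2) ((hxn α).smul _)]
        · simp [Finset.sum_range_succ, hlie]
        · simp [pow_two, hlie]
      have := Submodule.smul_mem _ (r * (α.1 h₀)⁻¹) hmem
      rwa [smul_smul, inv_mul_cancel_right₀ hα0] at this)
  refine ⟨g, hg, fun y hy => ?_⟩
  obtain ⟨t, ht⟩ := Hg y hy
  obtain ⟨e, he, h⟩ := exists_isElementary_list_prod x hxn (fun α => t (.inl α))
    Finset.univ.toList
  exact ⟨e, he, _, ht.symm.trans (h _)⟩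

end Roots

/-! ### Making an automorphism preserve the Cartan subalgebra. -/

section CartanConjugacy

open LieAlgebra LieAlgebra.IsKilling

variable {k 𝔤 : Type*} [Field k] [IsAlgClosed k] [CharZero k] [LieRing 𝔤] [LieAlgebra k 𝔤]
  [FiniteDimensional k 𝔤] [LieAlgebra.IsSimple k 𝔤]
  {𝔥 : LieSubalgebra k 𝔤} [𝔥.IsCartanSubalgebra]

theorem map_mem_engel_iff (e : 𝔤 ≃ₗ⁅k⁆ 𝔤) (x z : 𝔤) :
    e z ∈ LieSubalgebra.engel k (e x) ↔ z ∈ LieSubalgebra.engel k x := by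
  have h : ∀ n : ℕ, (ad k 𝔤 (e x) ^ n) (e z) = e ((ad k 𝔤 x ^ n) z) := fun n => by
    induction n with
    | zero => rfl
    | succ n ih => rw [pow_succ', pow_succ', Module.End.mul_apply, Module.End.mul_apply, ih, ad_apply,
        ad_apply, LieEquiv.map_lie]
  simp only [LieSubalgebra.mem_engel_iff, h]
  refine exists_congr fun n => ?_
  exact map_eq_zero_iff e e.injective

theorem finrank_engel_map (e : 𝔤 ≃ₗ⁅k⁆ 𝔤) (x : 𝔤) :
    Module.finrank k (LieSubalgebra.engel k (e x)) = Module.finrank k (LieSubalgebra.engel k x) := by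
  have h : (LieSubalgebra.engel k (e x)).toSubmodule =
      (LieSubalgebra.engel k x).toSubmodule.map e.toLinearEquiv.toLinearMap := by
    ext z
    obtain ⟨z, rfl⟩ := e.surjective z
    rw [Submodule.mem_map]
    refine (map_mem_engel_iff e x z).trans ⟨fun h => ⟨z, h, rfl⟩, ?_⟩
    rintro ⟨w, hw, hwz⟩
    exact e.injective hwz ▸ hw
  change Module.finrank k (LieSubalgebra.engel k (e x)).toSubmodule = _
  rw [h]
  exact LinearEquiv.finrank_map_eq e.toLinearEquiv _

/-- The Engel subalgebra of $h_0$ is the kernel of a power of $\mathrm{ad}\,h_0$. That power is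
invertible on every root space, so its range together with $\mathfrak h$ is everything and its
kernel is no larger than $\mathfrak h$. -/
theorem rank_le_finrank_cartan (base : (rootSystem 𝔥).Base) : rank k 𝔤 ≤ Module.finrank k 𝔥 := by
  obtain ⟨h₀, hh₀⟩ := exists_forall_root_apply_eq_height base
  refine (rank_le_finrank_engel k (h₀ : 𝔤)).trans ?_
  obtain ⟨n, hn⟩ : ∃ n, (LieSubalgebra.engel k (h₀ : 𝔤)).toSubmodule ≤
      LinearMap.ker (ad k 𝔤 (h₀ : 𝔤) ^ n) := by
    refine ⟨Module.finrank k 𝔤, fun z hz => ?_⟩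
    obtain ⟨m, hm⟩ := (LieSubalgebra.mem_engel_iff k _ _).1 hz
    rcases le_total m (Module.finrank k 𝔤) with h | h
    · exact Module.End.pow_map_zero_of_le h hm
    · have : z ∈ LinearMap.ker (ad k 𝔤 (h₀ : 𝔤) ^ m) := hm
      rwa [Module.End.ker_pow_eq_ker_pow_finrank_of_le h] at this
  refine (Submodule.finrank_mono hn).trans ?_
  have htop : 𝔥.toSubmodule ⊔ LinearMap.range (ad k 𝔤 (h₀ : 𝔤) ^ n) = ⊤ := by
    refine eq_top_of_cartan_le_of_rootSpace_le (𝔥 := 𝔥) le_sup_left fun α x hx => ?_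
    refine Submodule.mem_sup_right ?_
    have hα0 : α.1 h₀ ≠ 0 := by
      rw [hh₀]
      exact_mod_cast base.height_ne_zero α
    have : ∀ m : ℕ, (ad k 𝔤 (h₀ : 𝔤) ^ m) x = (α.1 h₀) ^ m • x := fun m => by
      induction m with
      | zero => simp
      | succ m ih =>
        rw [pow_succ', Module.End.mul_apply, ih, map_smul, ad_apply, lie_of_mem_rootSpace hx,
          smul_smul, pow_succ]
    refine ⟨((α.1 h₀) ^ n)⁻¹ • x, ?_⟩
    rw [map_smul, this, smul_smul, inv_mul_cancel₀ (pow_ne_zero _ hα0), one_smul]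
  have h1 := LinearMap.finrank_range_add_finrank_ker (ad k 𝔤 (h₀ : 𝔤) ^ n)
  have h2 := Submodule.finrank_add_le_finrank_add_finrank 𝔥.toSubmodule
    (LinearMap.range (ad k 𝔤 (h₀ : 𝔤) ^ n))
  rw [htop, finrank_top] at h2
  change _ ≤ Module.finrank k 𝔥.toSubmodule
  omega

/-- The Cartan subalgebra is abelian, hence contained in the Engel subalgebra, whose dimension for
regular `h` is the rank. Thus $\mathfrak h$ can be recovered from a single regular element. -/
theorem mem_engel_iff_mem_cartan (base : (rootSystem 𝔥).Base) {h : 𝔥}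
    (hr : LieAlgebra.IsRegular k (h : 𝔤)) (x : 𝔤) : x ∈ LieSubalgebra.engel k (h : 𝔤) ↔ x ∈ 𝔥 := by
  have hle : 𝔥.toSubmodule ≤ (LieSubalgebra.engel k (h : 𝔤)).toSubmodule := fun y hy =>
    (LieSubalgebra.mem_engel_iff k _ _).2 ⟨1, by simpa using lie_cartan_cartan h ⟨y, hy⟩⟩
  have := Submodule.eq_of_le_of_finrank_le hle (by
    have := (isRegular_iff_finrank_engel_eq_rank k (h : 𝔤)).1 hr
    exact this.le.trans (rank_le_finrank_cartan base))
  change x ∈ (LieSubalgebra.engel k (h : 𝔤)).toSubmodule ↔ x ∈ 𝔥.toSubmodule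
  rw [this]

/-- Every automorphism can be corrected by an elementary one so that it preserves the Cartan
subalgebra. -/
theorem exists_isElementary_map_mem_cartan_iff (base : (rootSystem 𝔥).Base) (α : 𝔤 ≃ₗ⁅k⁆ 𝔤) :
    ∃ ι : 𝔤 ≃ₗ⁅k⁆ 𝔤, IsElementary ι ∧ ∀ x, ι (α x) ∈ 𝔥 ↔ x ∈ 𝔥 := by
  classical
  let b := Module.finBasis k 𝔤
  obtain ⟨g, hg, Hg⟩ := exists_ne_zero_forall_exists_isElementary base b
  obtain ⟨g', hg', Hg'⟩ := exists_ne_zero_forall_exists_isElementary base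
    (b.map α.symm.toLinearEquiv)
  have hr := polyCharpoly_coeff_rank_ne_zero k 𝔤 b
  -- Three nonempty open conditions on one element `y`: it is conjugate into $\mathfrak h$, so is
  -- $\alpha^{-1}(y)$, and it is regular. Transporting the basis by $\alpha^{-1}$ makes the second a
  -- condition on the coordinates of `y`.
  obtain ⟨c, hc⟩ : ∃ c, MvPolynomial.eval c
      (g * g' * ((↑(ad k 𝔤) : 𝔤 →ₗ[k] Module.End k 𝔤).polyCharpoly b).coeff (rank k 𝔤)) ≠ 0 := by
    by_contra! hcon
    exact mul_ne_zero (mul_ne_zero hg hg') hr (MvPolynomial.funext fun c => by rw [hcon, map_zero])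
  obtain ⟨y, rfl⟩ : ∃ y, ⇑(b.repr y) = c := ⟨b.equivFun.symm c, by
    rw [← b.equivFun_apply, LinearEquiv.apply_symm_apply]⟩
  rw [map_mul, map_mul] at hc
  have hyreg := (isRegular_iff_coeff_polyCharpoly_rank_ne_zero k b y).2 (right_ne_zero_of_mul hc)
  have hc := left_ne_zero_of_mul hc
  obtain ⟨e, he, h, hy⟩ := Hg y (left_ne_zero_of_mul hc)
  obtain ⟨e', he', h', hy'⟩ := Hg' (α.symm y) (by
    have : ((b.map α.symm.toLinearEquiv).repr (α.symm y)) = b.repr y := by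
      simp only [Module.Basis.map_repr, LinearEquiv.trans_apply]
      congr 1
      exact α.apply_symm_apply y
    rw [this]
    exact right_ne_zero_of_mul hc)
  have hy'' : y = α (e' h') := by rw [← hy', α.apply_symm_apply]
  have hreg : ∀ (f : 𝔤 ≃ₗ⁅k⁆ 𝔤) (z : 𝔤), LieAlgebra.IsRegular k (f z) →
      LieAlgebra.IsRegular k z := fun f z hz => by
    rw [isRegular_iff_finrank_engel_eq_rank] at hz ⊢
    rw [← hz, finrank_engel_map]
  have h1 : ∀ x, e x ∈ LieSubalgebra.engel k y ↔ x ∈ 𝔥 := fun x => by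
    rw [hy, map_mem_engel_iff]
    exact mem_engel_iff_mem_cartan base (hreg e _ (hy ▸ hyreg)) x
  have h2 : ∀ x, α (e' x) ∈ LieSubalgebra.engel k y ↔ x ∈ 𝔥 := fun x => by
    rw [hy'', map_mem_engel_iff, map_mem_engel_iff]
    exact mem_engel_iff_mem_cartan base (hreg e' _ (hreg α _ (hy'' ▸ hyreg))) x
  -- Both $e(\mathfrak h)$ and $\alpha e'(\mathfrak h)$ are the Engel subalgebra of `y`, so
  -- $e^{-1}\alpha e'$ preserves $\mathfrak h$; it equals $\iota\alpha$ for $\iota=e^{-1}(\alpha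
  -- e'\alpha^{-1})$.
  refine ⟨(α.symm.trans (e'.trans α)).trans e.symm, (he'.conj α).trans he.symm, fun x => ?_⟩
  rw [← h1, ← h2 x]
  simp

end CartanConjugacy

/-! ### Root permutations, reflections, and making an automorphism preserve the base. -/

section Weyl

open LieAlgebra LieAlgebra.IsKilling

variable {k 𝔤 : Type*} [Field k] [IsAlgClosed k] [CharZero k] [LieRing 𝔤] [LieAlgebra k 𝔤]
  [FiniteDimensional k 𝔤] [LieAlgebra.IsSimple k 𝔤]
  {𝔥 : LieSubalgebra k 𝔤} [𝔥.IsCartanSubalgebra]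

theorem root_ext {β γ : 𝔥.root} (h : ∀ x : 𝔥, β.1 x = γ.1 x) : β = γ :=
  Subtype.ext (LieModule.Weight.ext h)

theorem weight_map_sub_smul (γ : LieModule.Weight k 𝔥 𝔤) (x y : 𝔥) (c : k) :
    γ (x - c • y) = γ x - c * γ y := by
  change LieModule.Weight.toLinear k 𝔥 𝔤 γ _ = _
  simp

theorem weight_map_neg (γ : LieModule.Weight k 𝔥 𝔤) (x : 𝔥) : γ (-x) = -γ x := by
  change LieModule.Weight.toLinear k 𝔥 𝔤 γ _ = _
  simp

/-- The restriction to `𝔥` of an automorphism preserving `𝔥`. -/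
def cartanMap (α : 𝔤 ≃ₗ⁅k⁆ 𝔤) (hα : ∀ x, α x ∈ 𝔥 ↔ x ∈ 𝔥) : 𝔥 →ₗ[k] 𝔥 :=
  α.toLinearEquiv.toLinearMap.restrict (p := 𝔥.toSubmodule) (q := 𝔥.toSubmodule)
    fun x hx => (hα x).2 hx

theorem coe_cartanMap (α : 𝔤 ≃ₗ⁅k⁆ 𝔤) (hα : ∀ x, α x ∈ 𝔥 ↔ x ∈ 𝔥) (h : 𝔥) :
    (cartanMap α hα h : 𝔤) = α h := rfl

theorem cartanMap_surjective (α : 𝔤 ≃ₗ⁅k⁆ 𝔤) (hα : ∀ x, α x ∈ 𝔥 ↔ x ∈ 𝔥) :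
    Function.Surjective (cartanMap α hα) := fun h =>
  ⟨⟨α.symm h, (hα _).1 (by rw [α.apply_symm_apply]; exact h.2)⟩,
    Subtype.ext (α.apply_symm_apply _)⟩

/-- An automorphism preserving `𝔥` permutes the roots. -/
theorem exists_perm_root (α : 𝔤 ≃ₗ⁅k⁆ 𝔤) (hα : ∀ x, α x ∈ 𝔥 ↔ x ∈ 𝔥) :
    ∃ π : Equiv.Perm 𝔥.root, (∀ β h, (π β).1 (cartanMap α hα h) = β.1 h) ∧
      ∀ (β : 𝔥.root) x, x ∈ rootSpace 𝔥 β.1 → α x ∈ rootSpace 𝔥 (π β).1 := by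
  have key : ∀ β : 𝔥.root, ∃ γ : 𝔥.root, ∀ h, γ.1 (cartanMap α hα h) = β.1 h := fun β => by
    obtain ⟨x, hx, hx0⟩ := β.1.exists_ne_zero
    choose g hg using cartanMap_surjective α hα
    have hmem : α x ∈ rootSpace 𝔥 (fun h => β.1 (g h)) := mem_rootSpace_iff.2 fun h => by
      conv_lhs => rw [← hg h]
      rw [coe_cartanMap, ← LieEquiv.map_lie, lie_of_mem_rootSpace hx, map_smul]
    have hne : rootSpace 𝔥 (fun h => β.1 (g h)) ≠ ⊥ := fun h => by
      rw [h, LieSubmodule.mem_bot] at hmem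
      exact hx0 ((map_eq_zero_iff α α.injective).1 hmem)
    have hval : ∀ h, β.1 (g (cartanMap α hα h)) = β.1 h := fun h => by
      congr 1
      have := congrArg Subtype.val (hg (cartanMap α hα h))
      exact Subtype.ext (α.injective this)
    let w : LieModule.Weight k 𝔥 𝔤 := ⟨fun h => β.1 (g h), hne⟩
    have hw : w.IsNonZero := fun h0 => 𝔥.isNonZero_coe_root β (funext fun h => by
      rw [← hval h]
      exact congrFun h0 _)
    exact ⟨⟨w, by simpa using hw⟩, hval⟩
  choose π hπ using key
  have hinj : Function.Injective π := fun β γ h => root_ext fun x => by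
    rw [← hπ β x, ← hπ γ x, h]
  refine ⟨Equiv.ofBijective π (Finite.injective_iff_bijective.1 hinj), hπ, fun β x hx => ?_⟩
  refine mem_rootSpace_iff.2 fun h => ?_
  obtain ⟨h, rfl⟩ := cartanMap_surjective α hα h
  rw [coe_cartanMap, ← LieEquiv.map_lie, lie_of_mem_rootSpace hx, map_smul]
  congr 1
  exact (hπ β h).symm

/-- The reflection in a root is induced by an elementary automorphism. -/
theorem exists_isElementary_reflection (β : 𝔥.root) :
    ∃ w : 𝔤 ≃ₗ⁅k⁆ 𝔤, IsElementary w ∧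
      ∀ h : 𝔥, w h = (h - β.1 h • coroot β.1 : 𝔥) := by
  obtain ⟨c, e, f, hsl, he, hf⟩ :=
    exists_isSl2Triple_of_weight_isNonZero (𝔥.isNonZero_coe_root β)
  have hc : c = (coroot β.1 : 𝔤) := hsl.h_eq_coroot (𝔥.isNonZero_coe_root β) he hf
  have hen : IsNilpotent (ad k 𝔤 e) := isNilpotent_ad_of_mem_root β he
  have hfn : IsNilpotent (ad k 𝔤 (-f)) := by
    rw [map_neg]
    exact (isNilpotent_ad_of_mem_rootSpace 𝔥 (by simp) hf).neg
  have hhe : ∀ h : 𝔥, ⁅e, (h : 𝔤)⁆ = -(β.1 h • e) := fun h => by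
    rw [← lie_skew, lie_of_mem_rootSpace he]
  have hhf : ∀ h : 𝔥, ⁅f, (h : 𝔤)⁆ = β.1 h • f := fun h => by
    rw [← lie_skew, lie_of_mem_rootSpace hf]
    simp
  have hec : ⁅e, c⁆ = -(2 : k) • e := by
    rw [← lie_skew, hsl.lie_h_e_smul k, neg_smul]
  have hfc : ⁅f, c⁆ = (2 : k) • f := by
    rw [← lie_skew, hsl.lie_lie_smul_f k, neg_neg]
  have hfe : ⁅f, e⁆ = -c := by rw [← lie_skew, hsl.lie_e_f]
  have e1 : ∀ h : 𝔥, expAd e hen h = h - β.1 h • e := fun h => by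
    rw [expAd_apply, nilExp_apply_eq_sum (N := 2) hen (by simp [pow_two, hhe])]
    simp [Finset.sum_range_succ, hhe, sub_eq_add_neg]
  have e2 : expAd e hen e = e := by
    rw [expAd_apply, nilExp_apply_eq_sum (N := 1) hen (by simp)]
    simp
  have e3 : expAd e hen c = c - (2 : k) • e := by
    rw [expAd_apply, nilExp_apply_eq_sum (N := 2) hen (by simp [pow_two, hec])]
    simp [Finset.sum_range_succ, hec, sub_eq_add_neg]
  have f1 : ∀ h : 𝔥, expAd (-f) hfn h = h - β.1 h • f := fun h => by
    rw [expAd_apply, nilExp_apply_eq_sum (N := 2) hfn (by simp [pow_two, hhf])]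
    simp [Finset.sum_range_succ, hhf, sub_eq_add_neg]
  have f2 : expAd (-f) hfn e = e + c - f := by
    rw [expAd_apply, nilExp_apply_eq_sum (N := 3) hfn (by simp [pow_succ, hfe, hfc])]
    simp [Finset.sum_range_succ, hfe, hfc, pow_succ, sub_eq_add_neg, smul_smul]
  -- The classical representative $\exp(\mathrm{ad}\,e)\exp(-\mathrm{ad}\,f)\exp(\mathrm{ad}\,e)$ of
  -- a reflection, computed from the truncated series above.
  refine ⟨(expAd e hen).trans ((expAd (-f) hfn).trans (expAd e hen)),
    (isElementary_expAd _ _).trans ((isElementary_expAd _ _).trans (isElementary_expAd _ _)),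
    fun h => ?_⟩
  have : (h - β.1 h • coroot β.1 : 𝔥) = (h : 𝔤) - β.1 h • c := by simp [hc]
  rw [this]
  simp only [LieEquiv.trans_apply, e1, map_sub, map_smul, f1, f2]
  simp only [map_add, e2, e3]
  module

/-- The invariant form `∑ β, β(x) β(y)` on `𝔥`. -/
noncomputable def rootSumForm (x y : 𝔥) : k := ∑ β : 𝔥.root, β.1 x * β.1 y

theorem rootSumForm_map (α : 𝔤 ≃ₗ⁅k⁆ 𝔤) (hα : ∀ x, α x ∈ 𝔥 ↔ x ∈ 𝔥) (x y : 𝔥) :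
    rootSumForm (cartanMap α hα x) (cartanMap α hα y) = rootSumForm x y := by
  obtain ⟨π, hπ, -⟩ := exists_perm_root α hα
  refine (Fintype.sum_equiv π _ _ fun β => ?_).symm
  rw [hπ, hπ]

theorem mem_cartan_iff_of_forall_mem {w : 𝔤 ≃ₗ⁅k⁆ 𝔤} (hw : ∀ x ∈ 𝔥, w x ∈ 𝔥) (x : 𝔤) :
    w x ∈ 𝔥 ↔ x ∈ 𝔥 := by
  refine ⟨fun h => ?_, hw x⟩
  have hle : 𝔥.toSubmodule.map w.toLinearEquiv.toLinearMap ≤ 𝔥.toSubmodule := by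
    rintro _ ⟨y, hy, rfl⟩
    exact hw y hy
  have heq := Submodule.eq_of_le_of_finrank_le hle
    (LinearEquiv.finrank_map_eq w.toLinearEquiv 𝔥.toSubmodule).ge
  have : w x ∈ 𝔥.toSubmodule := h
  rw [← heq] at this
  obtain ⟨y, hy, hyx⟩ := this
  exact w.injective hyx ▸ hy

/-- Invariance of the form under the reflection in $\beta$, which negates the coroot. -/
theorem two_mul_rootSumForm_coroot (β : 𝔥.root) (x : 𝔥) :
    2 * rootSumForm x (coroot β.1) = β.1 x * rootSumForm (coroot β.1) (coroot β.1) := by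
  obtain ⟨w, -, hw⟩ := exists_isElementary_reflection β
  have hw' := mem_cartan_iff_of_forall_mem (𝔥 := 𝔥) (w := w) fun x hx => by
    rw [hw ⟨x, hx⟩]
    exact Subtype.coe_prop _
  have hwc : ∀ h, cartanMap w hw' h = h - β.1 h • coroot β.1 := fun h => Subtype.ext (hw h)
  have h1 := rootSumForm_map w hw' x (coroot β.1)
  have h2 : β.1 (coroot β.1) = 2 := root_apply_coroot (𝔥.isNonZero_coe_root β)
  have h3 : (coroot β.1 : 𝔥) - (2 : k) • coroot β.1 = -coroot β.1 := by module
  rw [hwc, hwc, h2, h3] at h1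
  have h4 : rootSumForm (x - β.1 x • coroot β.1) (-coroot β.1) =
      -rootSumForm x (coroot β.1) + β.1 x * rootSumForm (coroot β.1) (coroot β.1) := by
    simp only [rootSumForm, Finset.mul_sum, ← Finset.sum_neg_distrib, ← Finset.sum_add_distrib]
    refine Finset.sum_congr rfl fun γ _ => ?_
    rw [weight_map_sub_smul, weight_map_neg]
    ring
  rw [h4] at h1
  linear_combination -h1

/-- Every automorphism preserving `𝔥` can be corrected by an elementary one so that it fixes the
element of `𝔥` on which all simple roots take the value `1`. -/
theorem exists_isElementary_map_eq_self (base : (rootSystem 𝔥).Base) {h₀ : 𝔥}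
    (hh₀ : ∀ α : 𝔥.root, α.1 h₀ = (base.height α : k))
    (α : 𝔤 ≃ₗ⁅k⁆ 𝔤) (hα : ∀ x, α x ∈ 𝔥 ↔ x ∈ 𝔥) :
    ∃ ι : 𝔤 ≃ₗ⁅k⁆ 𝔤, IsElementary ι ∧ (∀ x, ι (α x) ∈ 𝔥 ↔ x ∈ 𝔥) ∧ ι (α h₀) = h₀ := by
  classical
  let T : Set (Equiv.Perm 𝔥.root) := {π | ∃ ι : 𝔤 ≃ₗ⁅k⁆ 𝔤, IsElementary ι ∧
    ∃ hι : ∀ x, α.trans ι x ∈ 𝔥 ↔ x ∈ 𝔥, ∀ β h, (π β).1 (cartanMap (α.trans ι) hι h) = β.1 h}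
  have hT : T.Nonempty := by
    obtain ⟨π, hπ, -⟩ := exists_perm_root α hα
    exact ⟨π, LieEquiv.refl, isElementary_refl, hα, hπ⟩
  -- This is the invariant form paired on $h_0$ and its image. Maximizing it over the finitely many
  -- root permutations reachable by elementary corrections selects the correction bringing the image
  -- into the dominant chamber.
  let z : Equiv.Perm 𝔥.root → ℤ := fun π => ∑ β, base.height (π.symm β) * base.height β
  obtain ⟨π, ⟨ι, hι, hmem, hπ⟩, hmax⟩ := Set.exists_max_image T z (Set.toFinite T) hT
  have hzval : ∀ (π : Equiv.Perm 𝔥.root) (h : 𝔥), (∀ β, β.1 h = base.height (π.symm β)) →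
      (z π : k) = rootSumForm h h₀ := fun π h hh => by
    simp [z, rootSumForm, hh, hh₀]
  set h₁ := cartanMap (α.trans ι) hmem h₀ with hh₁
  have hval : ∀ β : 𝔥.root, β.1 h₁ = base.height (π.symm β) := fun β => by
    rw [← hh₀, ← hπ (π.symm β) h₀, Equiv.apply_symm_apply]
  -- Were the image of $h_0$ negative on a simple root, reflecting in that root would strictly
  -- increase `z`; `e6` computes the change, with the sum of squared pairings positive.
  have hpos : ∀ i ∈ base.support, 0 < base.height (π.symm i) := by
    intro i hi
    by_contra hneg
    have hneg : base.height (π.symm i) < 0 :=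
      lt_of_le_of_ne (not_lt.1 hneg) (base.height_ne_zero _)
    obtain ⟨w, hwE, hw⟩ := exists_isElementary_reflection i
    have hw' := mem_cartan_iff_of_forall_mem (𝔥 := 𝔥) (w := w) fun x hx => by
      rw [hw ⟨x, hx⟩]
      exact Subtype.coe_prop _
    have hmem' : ∀ x, α.trans (ι.trans w) x ∈ 𝔥 ↔ x ∈ 𝔥 := fun x =>
      (hw' _).trans (hmem x)
    obtain ⟨π', hπ', -⟩ := exists_perm_root (α.trans (ι.trans w)) hmem'
    have hle := hmax π' ⟨ι.trans w, hι.trans hwE, hmem', hπ'⟩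
    have hval' : ∀ β : 𝔥.root, β.1 (h₁ - i.1 h₁ • coroot i.1) = base.height (π'.symm β) :=
      fun β => by
        rw [← hh₀, ← hπ' (π'.symm β) h₀, Equiv.apply_symm_apply]
        congr 1
        exact Subtype.ext (hw h₁).symm
    have e1 := hzval π h₁ hval
    have e2 := hzval π' _ hval'
    have e3 : rootSumForm (h₁ - i.1 h₁ • coroot i.1) h₀ =
        rootSumForm h₁ h₀ - i.1 h₁ * rootSumForm h₀ (coroot i.1) := by
      simp only [rootSumForm, Finset.mul_sum, ← Finset.sum_sub_distrib]
      refine Finset.sum_congr rfl fun γ _ => ?_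
      rw [weight_map_sub_smul]
      ring
    have e4 := two_mul_rootSumForm_coroot i h₀
    have e5 : rootSumForm (coroot i.1) (coroot i.1) =
        ((∑ β : 𝔥.root, (rootSystem 𝔥).pairingIn ℤ β i ^ 2 : ℤ) : k) := by
      rw [rootSumForm, Int.cast_sum]
      refine Finset.sum_congr rfl fun β _ => ?_
      have := (rootSystem 𝔥).algebraMap_pairingIn ℤ β i
      rw [rootSystem_pairing_apply] at this
      rw [← this]
      push_cast
      simp [pow_two]
    have e6 : (2 : k) * z π' = 2 * z π - base.height (π.symm i) *
        ((∑ β : 𝔥.root, (rootSystem 𝔥).pairingIn ℤ β i ^ 2 : ℤ) : k) := by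
      rw [hh₀, base.height_one_of_mem_support hi, e5, Int.cast_one, one_mul] at e4
      rw [e1, e2, e3, ← e4, hval]
      ring
    have e7 : 2 * z π' = 2 * z π - base.height (π.symm i) *
        ∑ β : 𝔥.root, (rootSystem 𝔥).pairingIn ℤ β i ^ 2 := by exact_mod_cast e6
    have e8 : 0 < ∑ β : 𝔥.root, (rootSystem 𝔥).pairingIn ℤ β i ^ 2 :=
      Finset.sum_pos' (fun _ _ => sq_nonneg _) ⟨i, Finset.mem_univ _, by simp⟩
    nlinarith
  -- Positive integer values on simple roots can only enlarge absolute heights. A permutation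
  -- preserves their sum, so equality holds for each root and the simple roots take the value $1$.
  have hle : ∀ β : 𝔥.root, |base.height β| ≤ |base.height (π.symm β)| := by
    intro β
    obtain ⟨f, -, hf, hsum⟩ := base.exists_root_eq_sum_int β
    have hN : base.height (π.symm β) = ∑ j ∈ base.support, f j * base.height (π.symm j) := by
      have h1 := LinearMap.congr_fun hsum h₁
      rw [LinearMap.sum_apply] at h1
      have h2 : β.1 h₁ = ∑ j ∈ base.support, (f j : k) * j.1 h₁ := by
        refine h1.trans (Finset.sum_congr rfl fun j _ => ?_)
        simp
      simp only [hval] at h2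
      exact_mod_cast h2
    rw [base.height_eq_sum hsum, hN]
    rcases hf with hf | hf
    · have h0 : ∀ j, 0 ≤ f j := hf.le
      rw [abs_of_nonneg (Finset.sum_nonneg fun j _ => h0 j), abs_of_nonneg
        (Finset.sum_nonneg fun j hj => mul_nonneg (h0 j) (hpos j hj).le)]
      exact Finset.sum_le_sum fun j hj => le_mul_of_one_le_right (h0 j) (hpos j hj)
    · have h0 : ∀ j, f j ≤ 0 := hf.le
      rw [abs_of_nonpos (Finset.sum_nonpos fun j _ => h0 j), abs_of_nonpos
        (Finset.sum_nonpos fun j hj => mul_nonpos_of_nonpos_of_nonneg (h0 j) (hpos j hj).le),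
        neg_le_neg_iff]
      exact Finset.sum_le_sum fun j hj => mul_le_of_one_le_right (h0 j) (hpos j hj)
  have hsum : ∑ β : 𝔥.root, |base.height β| = ∑ β : 𝔥.root, |base.height (π.symm β)| :=
    (Equiv.sum_comp π.symm fun β => |base.height β|).symm
  have heq := (Finset.sum_eq_sum_iff_of_le fun β _ => hle β).1 hsum
  refine ⟨ι, hι, hmem, ?_⟩
  have h1 : h₁ = h₀ := by
    rw [← sub_eq_zero, ← Module.forall_dual_apply_eq_zero_iff k]
    intro φ
    suffices Module.Dual.eval k 𝔥 (h₁ - h₀) = 0 from LinearMap.congr_fun this φ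
    refine base.toWeightBasis.ext fun i => ?_
    have h2 := heq i.1 (Finset.mem_univ _)
    rw [base.height_one_of_mem_support i.2, abs_one, abs_of_pos (hpos i.1 i.2)] at h2
    have h3 : i.1.1 h₁ = i.1.1 h₀ := by
      rw [hval, hh₀, ← h2, base.height_one_of_mem_support i.2]
    simp [h3]
  exact congrArg Subtype.val h1

end Weyl

/-! ### Torus elements and the existence of the outer part. -/

section Torus

open LieAlgebra LieAlgebra.IsKilling

/-- The operator acting on the eigenspace of `D` for the integer `m` by `t ^ m`. -/
theorem exists_linearMap_zpow_eigenspace {k V : Type*} [Field k] [CharZero k] [AddCommGroup V]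
    [Module k V] {D : Module.End k V} (hD : ⨆ m : ℤ, D.eigenspace (m : k) = ⊤) (t : kˣ) :
    ∃ T : Module.End k V, ∀ (m : ℤ) (v : V), D v = (m : k) • v → T v = ((t ^ m : kˣ) : k) • v := by
  classical
  have hind : iSupIndep fun m : ℤ => D.eigenspace (m : k) :=
    D.eigenspaces_iSupIndep.comp (Int.cast_injective (α := k))
  have hint := DirectSum.isInternal_submodule_of_iSupIndep_of_iSup_eq_top hind hD
  let e := LinearEquiv.ofBijective (DirectSum.coeLinearMap fun m : ℤ => D.eigenspace (m : k)) hint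
  refine ⟨(DirectSum.toModule k ℤ V fun m => ((t ^ m : kˣ) : k) • (D.eigenspace (m : k)).subtype) ∘ₗ
    e.symm.toLinearMap, fun m v hv => ?_⟩
  have hv' : v ∈ D.eigenspace (m : k) := Module.End.mem_eigenspace_iff.2 hv
  have : e.symm v = DirectSum.lof k ℤ (fun m : ℤ => D.eigenspace (m : k)) m ⟨v, hv'⟩ := by
    rw [LinearEquiv.symm_apply_eq]
    exact (DirectSum.coeLinearMap_lof (R := k) (fun m : ℤ => D.eigenspace (m : k)) m ⟨v, hv'⟩).symm
  simp [this]

/-- Grading automorphisms: if `ad h` is diagonalizable with integer eigenvalues, there is an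
automorphism acting on the eigenspace of `m` by `t ^ m`. -/
theorem exists_lieEquiv_zpow_eigenspace {k 𝔤 : Type*} [Field k] [CharZero k] [LieRing 𝔤]
    [LieAlgebra k 𝔤] {h : 𝔤} (hD : ⨆ m : ℤ, (ad k 𝔤 h).eigenspace (m : k) = ⊤) (t : kˣ) :
    ∃ T : 𝔤 ≃ₗ⁅k⁆ 𝔤, ∀ (m : ℤ) (v : 𝔤), ⁅h, v⁆ = (m : k) • v → T v = ((t ^ m : kˣ) : k) • v := by
  obtain ⟨T, hT⟩ := exists_linearMap_zpow_eigenspace hD t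
  obtain ⟨T', hT'⟩ := exists_linearMap_zpow_eigenspace hD t⁻¹
  have hind : ∀ N : Submodule k 𝔤, (∀ (m : ℤ) v, ⁅h, v⁆ = (m : k) • v → v ∈ N) → ∀ v, v ∈ N := by
    intro N hN v
    have : (⊤ : Submodule k 𝔤) ≤ N := by
      rw [← hD, iSup_le_iff]
      exact fun m v hv => hN m v (Module.End.mem_eigenspace_iff.1 hv)
    exact this trivial
  have hinv : ∀ v, T' (T v) = v := hind (LinearMap.eqLocus (T' ∘ₗ T) LinearMap.id) fun m v hv => by
    change T' (T v) = v
    rw [hT m v hv, map_smul, hT' m v hv, smul_smul, ← Units.val_mul, ← mul_zpow, mul_inv_cancel,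
      one_zpow, Units.val_one, one_smul]
  have hinv' : ∀ v, T (T' v) = v := hind (LinearMap.eqLocus (T ∘ₗ T') LinearMap.id) fun m v hv => by
    change T (T' v) = v
    rw [hT' m v hv, map_smul, hT m v hv, smul_smul, ← Units.val_mul, ← mul_zpow, inv_mul_cancel,
      one_zpow, Units.val_one, one_smul]
  have hlie : ∀ x y, T ⁅x, y⁆ = ⁅T x, T y⁆ := by
    intro x
    refine hind (LinearMap.eqLocus (T ∘ₗ (ad k 𝔤 x : 𝔤 →ₗ[k] 𝔤)) ((ad k 𝔤 (T x) : 𝔤 →ₗ[k] 𝔤) ∘ₗ T))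
      fun n y hy => ?_
    change T ⁅x, y⁆ = ⁅T x, T y⁆
    revert x
    have := hind (LinearMap.eqLocus (T ∘ₗ (-(ad k 𝔤 y : 𝔤 →ₗ[k] 𝔤)))
      ((-(ad k 𝔤 (T y) : 𝔤 →ₗ[k] 𝔤)) ∘ₗ T)) fun m x hx => ?_
    · intro x
      have h1 : T (-⁅y, x⁆) = -⁅T y, T x⁆ := this x
      rwa [lie_skew, lie_skew] at h1
    · change T (-⁅y, x⁆) = -⁅T y, T x⁆
      rw [lie_skew, lie_skew, hT m x hx, hT n y hy, hT (m + n) ⁅x, y⁆, smul_lie, lie_smul, smul_smul,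
        zpow_add, Units.val_mul]
      rw [ad_apply, leibniz_lie, hx, hy, smul_lie, lie_smul, Int.cast_add, add_smul]
  let E : 𝔤 ≃ₗ⁅k⁆ 𝔤 :=
    { toLinearMap := T
      map_lie' := hlie _ _
      invFun := T'
      left_inv := hinv
      right_inv := hinv' }
  exact ⟨E, hT⟩

variable {k 𝔤 : Type*} [Field k] [IsAlgClosed k] [CharZero k] [LieRing 𝔤] [LieAlgebra k 𝔤]
  [FiniteDimensional k 𝔤] [LieAlgebra.IsSimple k 𝔤]
  {𝔥 : LieSubalgebra k 𝔤} [𝔥.IsCartanSubalgebra]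

theorem cast_pairingIn (γ j : 𝔥.root) :
    (((rootSystem 𝔥).pairingIn ℤ γ j : ℤ) : k) = γ.1 (coroot j.1) := by
  have := (rootSystem 𝔥).algebraMap_pairingIn ℤ γ j
  rw [rootSystem_pairing_apply] at this
  simpa using this

/-- The one-parameter subgroups of the torus attached to simple coroots are elementary. -/
theorem exists_isElementary_smul_rootSpace (base : (rootSystem 𝔥).Base) {j : 𝔥.root}
    (hj : j ∈ base.support) (t : kˣ) :
    ∃ τ : 𝔤 ≃ₗ⁅k⁆ 𝔤, IsElementary τ ∧ (∀ h ∈ 𝔥, τ h = h) ∧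
      ∀ (γ : 𝔥.root) (x : 𝔤), x ∈ rootSpace 𝔥 γ.1 →
        τ x = ((t ^ (rootSystem 𝔥).pairingIn ℤ γ j : kˣ) : k) • x := by
  classical
  obtain ⟨h, hh⟩ := exists_forall_root_eq base (Pi.single ⟨j, hj⟩ 1)
  have hjh : j.1 h = 1 := by rw [hh ⟨j, hj⟩, Pi.single_eq_same]
  have hint : ∀ γ : 𝔥.root, ∃ m : ℤ, γ.1 h = (m : k) := fun γ => by
    obtain ⟨f, -, -, hf⟩ := base.exists_root_eq_sum_int γ
    have h1 := LinearMap.congr_fun hf h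
    rw [LinearMap.sum_apply] at h1
    refine ⟨f j, h1.trans ?_⟩
    rw [Finset.sum_eq_single j]
    · simp [hjh]
    · intro i hi hij
      have := hh ⟨i, hi⟩
      rw [Pi.single_eq_of_ne (by simpa using hij)] at this
      simp [this]
    · exact fun h => absurd hj h
  have hD : ⨆ m : ℤ, (ad k 𝔤 (h : 𝔤)).eigenspace (m : k) = ⊤ := by
    refine eq_top_of_cartan_le_of_rootSpace_le (𝔥 := 𝔥) (fun x hx => ?_) fun γ x hx => ?_
    · refine Submodule.mem_iSup_of_mem 0 (Module.End.mem_eigenspace_iff.2 ?_)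
      simpa using lie_cartan_cartan h ⟨x, hx⟩
    · obtain ⟨m, hm⟩ := hint γ
      refine Submodule.mem_iSup_of_mem m (Module.End.mem_eigenspace_iff.2 ?_)
      rw [← hm]
      exact lie_of_mem_rootSpace hx h
  -- `T` need not be known to be elementary: the witness is the commutator $TwT^{-1}w^{-1}$, a
  -- product of elementary factors. On $\mathfrak g^\gamma$ it has exponent
  -- $\gamma(h)-(s_j\gamma)(h)$, the pairing of $\gamma$ with the coroot of `j`, because
  -- $\alpha_j(h)=1$.
  obtain ⟨T, hT⟩ := exists_lieEquiv_zpow_eigenspace hD t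
  obtain ⟨w, hwE, hw⟩ := exists_isElementary_reflection j
  have hT' : ∀ (m : ℤ) (v : 𝔤), ⁅(h : 𝔤), v⁆ = (m : k) • v →
      T.symm v = ((t ^ (-m) : kˣ) : k) • v := fun m v hv => by
    refine T.injective ?_
    change T (T.symm v) = T _
    rw [T.apply_symm_apply, map_smul, hT m v hv, smul_smul, ← Units.val_mul, zpow_neg,
      inv_mul_cancel, Units.val_one, one_smul]
  have hcalc : ∀ (m n : ℤ) (x : 𝔤), ⁅(h : 𝔤), x⁆ = (m : k) • x →
      ⁅((coroot j.1 : 𝔥) : 𝔤), x⁆ = (n : k) • x →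
      T (w (T.symm (w.symm x))) = ((t ^ n : kˣ) : k) • x := fun m n x hm hn => by
    have h1 : ⁅(h : 𝔤), w.symm x⁆ = ((m - n : ℤ) : k) • w.symm x := by
      refine w.injective ?_
      change w _ = w _
      rw [LieEquiv.map_lie, map_smul, w.apply_symm_apply, hw, hjh, one_smul]
      change ⁅(h : 𝔤) - ((coroot j.1 : 𝔥) : 𝔤), x⁆ = _
      rw [sub_lie, hm, hn, Int.cast_sub, sub_smul]
    rw [hT' _ _ h1, map_smul, map_smul, w.apply_symm_apply, hT _ _ hm, smul_smul, ← Units.val_mul,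
      ← zpow_add]
    congr 3
    ring
  refine ⟨w.symm.trans (T.symm.trans (w.trans T)), hwE.symm.trans (hwE.conj T), fun x hx => ?_,
    fun γ x hx => ?_⟩
  · have := hcalc 0 0 x (by simpa using lie_cartan_cartan h ⟨x, hx⟩)
      (by simpa using lie_cartan_cartan (coroot j.1) ⟨x, hx⟩)
    simpa using this
  · obtain ⟨m, hm⟩ := hint γ
    exact hcalc m _ x (by rw [← hm]; exact lie_of_mem_rootSpace hx h)
      (by rw [cast_pairingIn]; exact lie_of_mem_rootSpace hx _)

theorem exists_isElementary_smul_rootSpace_finset (base : (rootSystem 𝔥).Base)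
    (t : base.support → kˣ) (s : Finset base.support) :
    ∃ τ : 𝔤 ≃ₗ⁅k⁆ 𝔤, IsElementary τ ∧ (∀ h ∈ 𝔥, τ h = h) ∧
      ∀ (γ : 𝔥.root) (x : 𝔤), x ∈ rootSpace 𝔥 γ.1 →
        τ x = ((∏ j ∈ s, t j ^ (rootSystem 𝔥).pairingIn ℤ γ j : kˣ) : k) • x := by
  classical
  induction s using Finset.induction_on with
  | empty => exact ⟨LieEquiv.refl, isElementary_refl, fun _ _ => rfl, fun γ x _ => by simp⟩
  | insert j s hj ih =>
    obtain ⟨τ, hτ, h1, h2⟩ := ih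
    obtain ⟨τ', hτ', h1', h2'⟩ := exists_isElementary_smul_rootSpace base j.2 (t j)
    refine ⟨τ.trans τ', hτ.trans hτ', fun h hh => ?_, fun γ x hx => ?_⟩
    · rw [LieEquiv.trans_apply, h1 h hh, h1' h hh]
    · rw [LieEquiv.trans_apply, h2 γ x hx, map_smul, h2' γ x hx, smul_smul, ← Units.val_mul,
        Finset.prod_insert hj, mul_comm]

/-- Extract roots of order $\det A$ and apply the adjugate matrix to the exponents. For the Cartan
matrix this reaches arbitrary rescalings of the simple root vectors. -/
theorem exists_units_prod_zpow_eq {k ι : Type*} [Field k] [IsAlgClosed k] [CharZero k] [Fintype ι]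
    [DecidableEq ι] (A : Matrix ι ι ℤ) (hA : A.det ≠ 0) (c : ι → kˣ) :
    ∃ t : ι → kˣ, ∀ i, ∏ j, t j ^ A i j = c i := by
  have hroot : ∀ x : kˣ, ∃ s : kˣ, s ^ A.det = x := fun x => by
    obtain ⟨s, hs⟩ := IsAlgClosed.exists_pow_nat_eq (x : k) (Int.natAbs_pos.2 hA)
    have hs0 : s ≠ 0 := fun h => by
      rw [h, zero_pow (Int.natAbs_ne_zero.2 hA)] at hs
      exact x.ne_zero hs.symm
    have hs' : (Units.mk0 s hs0) ^ A.det.natAbs = x := Units.ext (by simpa using hs)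
    rcases Int.natAbs_eq A.det with h | h
    · exact ⟨Units.mk0 s hs0, by rw [h, zpow_natCast]; exact hs'⟩
    · exact ⟨(Units.mk0 s hs0)⁻¹, by rw [h, zpow_neg, inv_zpow, inv_inv, zpow_natCast]; exact hs'⟩
  choose s hs using fun i => hroot (c i)
  refine ⟨fun j => ∏ l, s l ^ A.adjugate j l, fun i => ?_⟩
  have h1 : ∀ j, (∏ l, s l ^ A.adjugate j l) ^ A i j = ∏ l, s l ^ (A i j * A.adjugate j l) :=
    fun j => by
      rw [← Finset.prod_zpow]
      exact Finset.prod_congr rfl fun l _ => by rw [← zpow_mul, mul_comm]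
  simp only [h1]
  rw [Finset.prod_comm]
  have h2 : ∀ l, ∏ j, s l ^ (A i j * A.adjugate j l) = s l ^ ((A * A.adjugate) i l) := fun l => by
    rw [Matrix.mul_apply]
    induction (Finset.univ : Finset ι) using Finset.induction_on with
    | empty => simp
    | insert j u hj ih => rw [Finset.prod_insert hj, Finset.sum_insert hj, ih, zpow_add]
  simp only [h2, Matrix.mul_adjugate, Matrix.smul_apply, Matrix.one_apply]
  rw [Finset.prod_eq_single i]
  · simp [hs]
  · intro l _ hl
    simp [hl.symm]
  · simp

/-- Simple root vectors can be rescaled arbitrarily by an elementary automorphism fixing `𝔥`. -/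
theorem exists_isElementary_smul_simple (base : (rootSystem 𝔥).Base) (c : base.support → kˣ) :
    ∃ τ : 𝔤 ≃ₗ⁅k⁆ 𝔤, IsElementary τ ∧ (∀ h ∈ 𝔥, τ h = h) ∧
      ∀ (i : base.support) (x : 𝔤), x ∈ rootSpace 𝔥 i.1.1 → τ x = (c i : k) • x := by
  classical
  have hdet : base.cartanMatrix.det ≠ 0 :=
    Matrix.nondegenerate_iff_det_ne_zero.1 base.cartanMatrix_nondegenerate
  obtain ⟨t, ht⟩ := exists_units_prod_zpow_eq _ hdet c
  obtain ⟨τ, hτ, h1, h2⟩ := exists_isElementary_smul_rootSpace_finset base t Finset.univ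
  refine ⟨τ, hτ, h1, fun i x hx => ?_⟩
  rw [h2 i.1 x hx, ← ht i]
  rfl

theorem mem_support_of_height_eq_one (base : (rootSystem 𝔥).Base) {γ : 𝔥.root}
    (hγ : base.height γ = 1) : γ ∈ base.support := by
  classical
  obtain ⟨f, -, hf, hsum⟩ := base.exists_root_eq_sum_int γ
  rw [base.height_eq_sum hsum] at hγ
  have hf : 0 < f := hf.resolve_right fun h => by
    have := Finset.sum_nonpos (s := base.support) fun j _ => h.le j
    simp only [hγ] at this
    exact absurd this (by norm_num)
  have h0 : ∀ j, 0 ≤ f j := hf.le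
  obtain ⟨i, hi, hi0⟩ : ∃ i ∈ base.support, f i ≠ 0 := by
    by_contra! h
    rw [Finset.sum_eq_zero h] at hγ
    exact zero_ne_one hγ
  have hsplit := Finset.add_sum_erase base.support f hi
  have hrest : 0 ≤ ∑ j ∈ base.support.erase i, f j := Finset.sum_nonneg fun j _ => h0 j
  have hi1 : 1 ≤ f i := lt_of_le_of_ne (h0 i) hi0.symm
  have hrest0 : ∑ j ∈ base.support.erase i, f j = 0 := by omega
  have hfi : f i = 1 := by omega
  rw [Finset.sum_eq_zero_iff_of_nonneg fun j _ => h0 j] at hrest0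
  have : γ = i := (rootSystem 𝔥).root.injective (by
    rw [hsum, ← Finset.add_sum_erase _ _ hi, hfi, one_smul,
      Finset.sum_eq_zero fun j hj => by rw [hrest0 j hj, zero_smul], add_zero])
  exact this ▸ hi

/-- Every automorphism is the product of an elementary one and one preserving the pinning. -/
theorem exists_isOuterPart (P : Pinning 𝔥) (α : 𝔤 ≃ₗ⁅k⁆ 𝔤) : ∃ δ, IsOuterPart P α δ := by
  obtain ⟨ι₁, hι₁, h₁⟩ := exists_isElementary_map_mem_cartan_iff P.base α
  obtain ⟨h₀, hh₀⟩ := exists_forall_root_apply_eq_height P.base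
  obtain ⟨ι₂, hι₂, h₂, h₂'⟩ := exists_isElementary_map_eq_self P.base hh₀ (α.trans ι₁) h₁
  let β := (α.trans ι₁).trans ι₂
  obtain ⟨π, hπ, hπ'⟩ := exists_perm_root β h₂
  have hfix : cartanMap β h₂ h₀ = h₀ := Subtype.ext h₂'
  -- Fixing $h_0$ forces the permutation to preserve heights, hence to permute the simple roots,
  -- which are the roots of height $1$.
  have hheight : ∀ γ, P.base.height (π γ) = P.base.height γ := fun γ => by
    have := hπ γ h₀
    rw [hfix, hh₀, hh₀] at this
    exact_mod_cast this
  have hsupp : ∀ i : P.base.support, π i.1 ∈ P.base.support := fun i =>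
    mem_support_of_height_eq_one P.base (by
      rw [hheight, P.base.height_one_of_mem_support i.2])
  let ρ : Equiv.Perm P.base.support := Equiv.ofBijective (fun i => ⟨π i.1, hsupp i⟩)
    (Finite.injective_iff_bijective.1 fun i j h =>
      Subtype.ext (π.injective (congrArg Subtype.val h)))
  have hc : ∀ i, ∃ c : kˣ, β (P.vec i) = (c : k) • P.vec (ρ i) := fun i => by
    have h1 := hπ' i.1 _ (P.vec_mem i)
    have h2 : P.vec (ρ i) ∈ rootSpace 𝔥 (π i.1).1 := P.vec_mem (ρ i)
    obtain ⟨r, hr⟩ := (finrank_eq_one_iff_of_nonzero' (⟨_, h2⟩ : rootSpace 𝔥 (π i.1).1)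
      (by simpa using P.vec_ne_zero (ρ i))).1
      (finrank_rootSpace_eq_one (π i.1).1 (𝔥.isNonZero_coe_root _)) ⟨_, h1⟩
    have hr' : r • P.vec (ρ i) = β (P.vec i) := congrArg Subtype.val hr
    have hr0 : r ≠ 0 := fun h => by
      rw [h, zero_smul] at hr'
      exact P.vec_ne_zero i ((map_eq_zero_iff β β.injective).1 hr'.symm)
    exact ⟨Units.mk0 r hr0, hr'.symm⟩
  choose c hc using hc
  -- The inverse permutation appears because the vector at `ρ i` carries the scalar `c i`.
  obtain ⟨τ, hτ, hτ𝔥, hτv⟩ := exists_isElementary_smul_simple P.base fun j => (c (ρ.symm j))⁻¹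
  refine ⟨β.trans τ, ⟨fun x => ?_, ρ, fun i => ?_⟩, ((ι₁.trans ι₂).trans τ).symm,
    ((hι₁.trans hι₂).trans hτ).symm, fun x => ?_⟩
  · refine (mem_cartan_iff_of_forall_mem (w := τ) (fun x hx => ?_) _).trans (h₂ x)
    rwa [hτ𝔥 x hx]
  · rw [LieEquiv.trans_apply, hc, map_smul, hτv _ _ (P.vec_mem (ρ i)), Equiv.symm_apply_apply,
      smul_smul, ← Units.val_mul, mul_inv_cancel, Units.val_one, one_smul]
  · exact (((ι₁.trans ι₂).trans τ).symm_apply_apply (α x)).symm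

end Torus

/-! ### Tracelessness, faithfulness, and lifting elementary automorphisms to modules. -/

section SimpleModules

open LieAlgebra

variable {k 𝔤 : Type*} [Field k] [LieRing 𝔤] [LieAlgebra k 𝔤]

/-- A simple Lie algebra is its own derived algebra, and commutators have trace zero. -/
theorem trace_toEnd_eq_zero_of_isSimple [LieAlgebra.IsSimple k 𝔤] (W : Type*) [AddCommGroup W]
    [Module k W] [LieRingModule 𝔤 W] [LieModule k 𝔤 W] (x : 𝔤) :
    LinearMap.trace k W (LieModule.toEnd k 𝔤 W x) = 0 := by
  refine LieModule.trace_toEnd_eq_zero_of_mem_lcs k 𝔤 W (k := 1) le_rfl ?_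
  have : LieModule.lowerCentralSeries k 𝔤 𝔤 1 = ⊤ := by
    rcases LieAlgebra.IsSimple.eq_bot_or_eq_top (R := k) (LieModule.lowerCentralSeries k 𝔤 𝔤 1)
      with h | h
    · exfalso
      refine LieAlgebra.IsSimple.non_abelian (R := k) (L := 𝔤) ⟨fun x y => ?_⟩
      have : ⁅x, y⁆ ∈ LieModule.lowerCentralSeries k 𝔤 𝔤 1 := by
        rw [LieModule.lowerCentralSeries_succ]
        exact LieSubmodule.lie_mem_lie trivial trivial
      rwa [h, LieSubmodule.mem_bot] at this
    · exact h
  rw [this]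
  trivial

theorem eq_zero_of_toEnd_eq_zero [LieAlgebra.IsSimple k 𝔤] {W : Type*} [AddCommGroup W] [Module k W]
    [LieRingModule 𝔤 W] [LieModule k 𝔤 W] (hW : ∃ (x : 𝔤) (w : W), ⁅x, w⁆ ≠ 0) {x : 𝔤}
    (hx : LieModule.toEnd k 𝔤 W x = 0) : x = 0 := by
  have hx : x ∈ LieModule.ker k 𝔤 W := (LieModule.mem_ker k 𝔤 W _).2 fun w => LinearMap.congr_fun hx w
  rcases LieAlgebra.IsSimple.eq_bot_or_eq_top (R := k) (LieModule.ker k 𝔤 W) with h | h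
  · rwa [h, LieSubmodule.mem_bot] at hx
  · obtain ⟨y, w, hyw⟩ := hW
    have hy : y ∈ LieModule.ker k 𝔤 W := by rw [h]; trivial
    exact absurd ((LieModule.mem_ker k 𝔤 W _).1 hy w) hyw

/-- In an irreducible module, `ad`-nilpotent elements act nilpotently. -/
theorem isNilpotent_toEnd_of_isNilpotent_ad [IsAlgClosed k] [CharZero k] [LieAlgebra.IsSimple k 𝔤]
    {W : Type*} [AddCommGroup W] [Module k W] [LieRingModule 𝔤 W] [LieModule k 𝔤 W]
    [FiniteDimensional k W] (hW : LieModule.IsIrreducible k 𝔤 W) {x : 𝔤}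
    (hx : IsNilpotent (ad k 𝔤 x)) : IsNilpotent (LieModule.toEnd k 𝔤 W x) := by
  have := LieModule.nontrivial_of_isIrreducible k 𝔤 W
  obtain ⟨c, hc⟩ := Module.End.exists_eigenvalue (LieModule.toEnd k 𝔤 W x)
  obtain ⟨n, hn⟩ := hx
  -- Nilpotency of $\mathrm{ad}\,x$ makes the generalized eigenspace stable under all of $\mathfrak
  -- g$, hence everything. So `x` acts as a scalar plus a nilpotent, and tracelessness makes the
  -- scalar zero.
  let N : LieSubmodule k 𝔤 W :=
    { (LieModule.toEnd k 𝔤 W x).maxGenEigenspace c with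
      lie_mem := fun {y w} hw => by
        have hy : y ∈ (LieModule.toEnd k 𝔤 𝔤 x).maxGenEigenspace 0 := by
          rw [Module.End.mem_maxGenEigenspace]
          refine ⟨n, ?_⟩
          rw [zero_smul, sub_zero]
          exact LinearMap.congr_fun hn y
        simpa using LieModule.lie_mem_maxGenEigenspace_toEnd hy hw }
  have hN : N = ⊤ := by
    refine (hW.eq_bot_or_eq_top N).resolve_left fun h => ?_
    obtain ⟨w, hw⟩ := hc.exists_hasEigenvector
    have hwN : w ∈ N :=
      ((LieModule.toEnd k 𝔤 W x).genEigenspace c).monotone le_top hw.1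
    rw [h, LieSubmodule.mem_bot] at hwN
    exact hw.2 hwN
  have hnil : IsNilpotent (LieModule.toEnd k 𝔤 W x - c • 1) := by
    rw [Module.End.isNilpotent_iff_of_finite]
    intro w
    have : w ∈ N := by rw [hN]; trivial
    exact (Module.End.mem_maxGenEigenspace _ _ _).1 this
  have htr := (LinearMap.isNilpotent_trace_of_isNilpotent hnil).eq_zero
  rw [map_sub, trace_toEnd_eq_zero_of_isSimple, map_smul, LinearMap.trace_one, zero_sub,
    neg_eq_zero, smul_eq_mul, mul_eq_zero, Nat.cast_eq_zero] at htr
  have hc0 : c = 0 := htr.resolve_right Module.finrank_pos.ne'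
  simpa [hc0] using hnil

/-- Twisting an irreducible module by an elementary automorphism does not change it. -/
theorem exists_linearEquiv_of_mem_elementaryGroup [IsAlgClosed k] [CharZero k]
    [LieAlgebra.IsSimple k 𝔤] {W : Type*} [AddCommGroup W] [Module k W] [LieRingModule 𝔤 W]
    [LieModule k 𝔤 W] [FiniteDimensional k W] (hW : LieModule.IsIrreducible k 𝔤 W)
    {e : 𝔤 ≃ₗ[k] 𝔤} (he : e ∈ elementaryGroup k 𝔤) :
    ∃ g : W ≃ₗ[k] W, ∀ x w, g ⁅x, w⁆ = ⁅e x, g w⁆ := by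
  refine elementaryGroup_induction (p := fun e => ∃ g : W ≃ₗ[k] W, ∀ x w, g ⁅x, w⁆ = ⁅e x, g w⁆)
    (fun x hx => ?_) ⟨1, fun _ _ => rfl⟩ ?_ ?_ he
  · have hx' := isNilpotent_toEnd_of_isNilpotent_ad hW hx
    refine ⟨LinearEquiv.ofLinearMap (nilExp (LieModule.toEnd k 𝔤 W x))
      (nilExp (-LieModule.toEnd k 𝔤 W x)) (nilExp_mul_nilExp_neg hx') (nilExp_neg_mul_nilExp hx'),
      fun y w => nilExp_lie hx hx' y w⟩
  · rintro e f ⟨g, hg⟩ ⟨g', hg'⟩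
    exact ⟨g * g', fun x w => by rw [LinearEquiv.mul_apply, LinearEquiv.mul_apply, hg', hg]; rfl⟩
  · rintro e ⟨g, hg⟩
    refine ⟨g⁻¹, fun x w => ?_⟩
    refine g.injective ?_
    rw [hg]
    change g (g.symm _) = ⁅e (e.symm x), g (g.symm w)⁆
    simp

end SimpleModules

/-! ### Highest weight vectors and uniqueness of the highest weight. -/

section HighestWeight

open LieAlgebra LieAlgebra.IsKilling

variable {k 𝔤 : Type*} [Field k] [IsAlgClosed k] [CharZero k] [LieRing 𝔤] [LieAlgebra k 𝔤]
  [FiniteDimensional k 𝔤] [LieAlgebra.IsSimple k 𝔤]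
  {𝔥 : LieSubalgebra k 𝔤} [𝔥.IsCartanSubalgebra]

/-- A vector of weight `wt` annihilated by the positive root spaces. -/
structure IsHighestWeightVector (base : (rootSystem 𝔥).Base) (wt : Module.Dual k 𝔥) {V : Type*}
    [AddCommGroup V] [Module k V] [LieRingModule 𝔤 V] (v : V) : Prop where
  lie_eq_zero : ∀ α : 𝔥.root, base.IsPos α → ∀ x ∈ rootSpace 𝔥 α.1, ⁅x, v⁆ = 0
  lie_cartan : ∀ h : 𝔥, ⁅(h : 𝔤), v⁆ = wt h • v

variable {V : Type*} [AddCommGroup V] [Module k V] [LieRingModule 𝔤 V] [LieModule k 𝔤 V]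

/-- The span of the vectors `y₁ ⋯ yₙ v` with each `yᵢ` in a negative root space. -/
def descend (base : (rootSystem 𝔥).Base) (v : V) : ℕ → Submodule k V
  | 0 => Submodule.span k {v}
  | n + 1 => Submodule.span k {u | ∃ α : 𝔥.root, ¬ base.IsPos α ∧
      ∃ y ∈ rootSpace 𝔥 α.1, ∃ w ∈ descend base v n, ⁅y, w⁆ = u}

/-- Induction on word length by $z(yw)=[z,y]w+y(zw)$. The element `z` stays arbitrary because
$[z,y]$ need not lie in a root space. -/
theorem lie_mem_iSup_descend {base : (rootSystem 𝔥).Base} {wt : Module.Dual k 𝔥} {v : V}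
    (hv : IsHighestWeightVector base wt v) (n : ℕ) :
    ∀ z : 𝔤, ∀ w ∈ descend base v n, ⁅z, w⁆ ∈ ⨆ n, descend (k := k) base v n := by
  have hneg : ∀ α : 𝔥.root, ¬ base.IsPos α → ∀ y ∈ rootSpace 𝔥 α.1, ∀ w ∈ ⨆ n, descend base v n,
      ⁅y, w⁆ ∈ ⨆ n, descend (k := k) base v n := fun α hα y hy w hw => by
    refine Submodule.iSup_induction _ (motive := fun w => ⁅y, w⁆ ∈ ⨆ n, descend (k := k) base v n) hw
      (fun n w hw => Submodule.mem_iSup_of_mem (n + 1)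
        (Submodule.subset_span ⟨α, hα, y, hy, w, hw, rfl⟩)) (by simp) fun a b ha hb => ?_
    rw [lie_add]
    exact add_mem ha hb
  have hred : ∀ n, ((∀ h : 𝔥, ∀ w ∈ descend base v n, ⁅(h : 𝔤), w⁆ ∈ ⨆ n, descend (k := k) base v n) ∧
      ∀ α : 𝔥.root, base.IsPos α → ∀ x ∈ rootSpace 𝔥 α.1, ∀ w ∈ descend base v n,
        ⁅x, w⁆ ∈ ⨆ n, descend (k := k) base v n) →
      ∀ z : 𝔤, ∀ w ∈ descend base v n, ⁅z, w⁆ ∈ ⨆ n, descend (k := k) base v n := by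
    rintro n ⟨h1, h2⟩ z w hw
    let Z : Submodule k 𝔤 := (⨆ n, descend (k := k) base v n).comap
      ((LieModule.toEnd k 𝔤 V : 𝔤 →ₗ[k] Module.End k V).flip w)
    have hZ : Z = ⊤ := eq_top_of_cartan_le_of_rootSpace_le (𝔥 := 𝔥)
      (fun x hx => h1 ⟨x, hx⟩ w hw) fun α x hx => by
        by_cases hα : base.IsPos α
        · exact h2 α hα x hx w hw
        · exact hneg α hα x hx w (Submodule.mem_iSup_of_mem n hw)
    have : z ∈ Z := by rw [hZ]; trivial
    exact this
  induction n with
  | zero =>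
    refine hred 0 ⟨fun h w hw => ?_, fun α hα x hx w hw => ?_⟩
    · obtain ⟨c, rfl⟩ := Submodule.mem_span_singleton.1 hw
      rw [lie_smul, hv.lie_cartan]
      exact Submodule.smul_mem _ _ (Submodule.smul_mem _ _
        (Submodule.mem_iSup_of_mem 0 (Submodule.mem_span_singleton_self v)))
    · obtain ⟨c, rfl⟩ := Submodule.mem_span_singleton.1 hw
      rw [lie_smul, hv.lie_eq_zero α hα x hx, smul_zero]
      exact zero_mem _
  | succ n ih =>
    intro z w hw
    induction hw using Submodule.span_induction with
    | mem u hu =>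
      obtain ⟨α, hα, y, hy, w, hw, rfl⟩ := hu
      rw [leibniz_lie]
      exact add_mem (ih _ w hw) (hneg α hα y hy _ (ih z w hw))
    | zero => simp
    | add a b _ _ ha hb => rw [lie_add]; exact add_mem ha hb
    | smul c a _ ha => rw [lie_smul]; exact Submodule.smul_mem _ _ ha

/-- Negative root vectors lower the $h_0$-eigenvalue by a positive integer, so the single operator
$h_0$ already separates the line of `v` from the longer words. -/
theorem descend_succ_le {base : (rootSystem 𝔥).Base} {wt : Module.Dual k 𝔥} {v : V}
    (hv : IsHighestWeightVector base wt v) {h₀ : 𝔥}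
    (hh₀ : ∀ α : 𝔥.root, α.1 h₀ = (base.height α : k)) (n : ℕ) :
    descend base v (n + 1) ≤
      ⨆ m : ℕ, (LieModule.toEnd k 𝔤 V (h₀ : 𝔤)).eigenspace (wt h₀ - (m + 1 : ℕ)) := by
  have hstep : ∀ (α : 𝔥.root), ¬ base.IsPos α → ∀ y ∈ rootSpace 𝔥 α.1, ∀ (m : ℕ) (w : V),
      ⁅(h₀ : 𝔤), w⁆ = (wt h₀ - m) • w →
      ⁅y, w⁆ ∈ ⨆ m : ℕ, (LieModule.toEnd k 𝔤 V (h₀ : 𝔤)).eigenspace (wt h₀ - (m + 1 : ℕ)) := by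
    intro α hα y hy m w hw
    obtain ⟨p, hp⟩ : ∃ p : ℕ, base.height α = -(p + 1 : ℕ) := by
      have h1 : base.height α < 0 := lt_of_le_of_ne (not_lt.1 hα) (base.height_ne_zero α)
      exact ⟨(-base.height α - 1).toNat, by omega⟩
    refine Submodule.mem_iSup_of_mem (m + p) (Module.End.mem_eigenspace_iff.2 ?_)
    rw [LieModule.toEnd_apply_apply, leibniz_lie, lie_of_mem_rootSpace hy, hw, hh₀, hp, smul_lie,
      lie_smul, ← add_smul]
    congr 1
    push_cast
    ring
  induction n with
  | zero =>
    refine Submodule.span_le.2 ?_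
    rintro _ ⟨α, hα, y, hy, w, hw, rfl⟩
    obtain ⟨c, rfl⟩ := Submodule.mem_span_singleton.1 hw
    refine hstep α hα y hy 0 _ ?_
    rw [lie_smul, hv.lie_cartan, smul_comm]
    simp
  | succ n ih =>
    refine Submodule.span_le.2 ?_
    rintro _ ⟨α, hα, y, hy, w, hw, rfl⟩
    have hw := ih hw
    refine Submodule.iSup_induction _ (motive := fun w => ⁅y, w⁆ ∈
      ⨆ m : ℕ, (LieModule.toEnd k 𝔤 V (h₀ : 𝔤)).eigenspace (wt h₀ - (m + 1 : ℕ))) hw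
      (fun m w hw => hstep α hα y hy (m + 1) w (Module.End.mem_eigenspace_iff.1 hw)) (by simp)
      fun a b ha hb => ?_
    rw [lie_add]
    exact add_mem ha hb

/-- A highest weight vector lies in a submodule whose remaining weights are all lower. -/
theorem IsHighestWeightVector.exists_lieSubmodule {base : (rootSystem 𝔥).Base}
    {wt : Module.Dual k 𝔥} {v : V} (hv : IsHighestWeightVector base wt v) {h₀ : 𝔥}
    (hh₀ : ∀ α : 𝔥.root, α.1 h₀ = (base.height α : k)) :
    ∃ N : LieSubmodule k 𝔤 V, v ∈ N ∧ ∀ w ∈ N, ∃ c : k, w - c • v ∈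
      ⨆ m : ℕ, (LieModule.toEnd k 𝔤 V (h₀ : 𝔤)).eigenspace (wt h₀ - (m + 1 : ℕ)) := by
  let N : LieSubmodule k 𝔤 V :=
    { (⨆ n, descend (k := k) base v n : Submodule k V) with
      lie_mem := fun {z w} hw => by
        have hw : w ∈ ⨆ n, descend (k := k) base v n := hw
        change ⁅z, w⁆ ∈ ⨆ n, descend (k := k) base v n
        refine Submodule.iSup_induction _
          (motive := fun w => ⁅z, w⁆ ∈ ⨆ n, descend (k := k) base v n) hw
          (fun n w hw => lie_mem_iSup_descend hv n z w hw) (by simp) fun a b ha hb => ?_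
        rw [lie_add]
        exact add_mem ha hb }
  refine ⟨N, Submodule.mem_iSup_of_mem 0 (Submodule.mem_span_singleton_self v), fun w hw => ?_⟩
  have hw : w ∈ ⨆ n, descend (k := k) base v n := hw
  refine Submodule.iSup_induction _ (motive := fun w => ∃ c : k, w - c • v ∈
    ⨆ m : ℕ, (LieModule.toEnd k 𝔤 V (h₀ : 𝔤)).eigenspace (wt h₀ - (m + 1 : ℕ))) hw
    (fun n w hw => ?_) ⟨0, by simp⟩ fun a b ha hb => ?_
  · cases n with
    | zero =>
      obtain ⟨c, rfl⟩ := Submodule.mem_span_singleton.1 hw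
      exact ⟨c, by simp⟩
    | succ n => exact ⟨0, by simpa using descend_succ_le hv hh₀ n hw⟩
  · obtain ⟨c, hc⟩ := ha
    obtain ⟨d, hd⟩ := hb
    exact ⟨c + d, by convert add_mem hc hd using 1; module⟩

theorem eq_zero_of_mem_iSup_eigenspace {D : Module.End k V} {ι : Type*} {c : ι → k} {a : k}
    (hc : ∀ i, c i ≠ a) {w : V} (hw : D w = a • w) (hw' : w ∈ ⨆ i, D.eigenspace (c i)) : w = 0 := by
  have h1 := D.eigenspaces_iSupIndep a
  refine Submodule.disjoint_def.1 h1 w (Module.End.mem_eigenspace_iff.2 hw) ?_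
  have hle : ⨆ i, D.eigenspace (c i) ≤ ⨆ b, ⨆ (_ : b ≠ a), D.eigenspace b :=
    iSup_le fun i => le_iSup₂_of_le (c i) (hc i) le_rfl
  exact hle hw'

/-- The highest weight of an irreducible module is unique. -/
theorem IsHighestWeightVector.wt_eq {base : (rootSystem 𝔥).Base}
    (hV : LieModule.IsIrreducible k 𝔤 V) {wt wt' : Module.Dual k 𝔥} {v v' : V} (hv0 : v ≠ 0)
    (hv0' : v' ≠ 0) (hv : IsHighestWeightVector base wt v)
    (hv' : IsHighestWeightVector base wt' v') : wt = wt' := by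
  obtain ⟨h₀, hh₀⟩ := exists_forall_root_apply_eq_height base
  -- Either the two vectors are proportional or the second weight is strictly lower at $h_0$. Strict
  -- inequality cannot hold in both directions in characteristic zero.
  have key : ∀ {wt wt' : Module.Dual k 𝔥} {v v' : V}, v ≠ 0 → v' ≠ 0 →
      IsHighestWeightVector base wt v → IsHighestWeightVector base wt' v' →
      (∃ c : k, v' = c • v) ∨ ∃ m : ℕ, wt h₀ - (m + 1 : ℕ) = wt' h₀ := by
    intro wt wt' v v' hv0 hv0' hv hv'
    by_contra! hcon
    obtain ⟨N, hvN, hN⟩ := hv.exists_lieSubmodule hh₀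
    have hNtop : N = ⊤ := (hV.eq_bot_or_eq_top N).resolve_left fun h => by
      rw [h, LieSubmodule.mem_bot] at hvN
      exact hv0 hvN
    obtain ⟨c, hc⟩ := hN v' (by rw [hNtop]; trivial)
    by_cases hwt : wt h₀ = wt' h₀
    · refine hcon.1 c (sub_eq_zero.1 ?_)
      refine eq_zero_of_mem_iSup_eigenspace (a := wt h₀) (fun m => ?_) ?_ hc
      · have : ((m + 1 : ℕ) : k) ≠ 0 := Nat.cast_ne_zero.2 (Nat.succ_ne_zero m)
        simpa using this
      · rw [LieModule.toEnd_apply_apply, lie_sub, lie_smul, hv.lie_cartan, hv'.lie_cartan, hwt,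
          smul_sub, smul_comm]
    · have hmem : v' ∈ ⨆ m : ℕ, (LieModule.toEnd k 𝔤 V (h₀ : 𝔤)).eigenspace (wt h₀ - m) := by
        rw [← sub_add_cancel v' (c • v)]
        have hle : ⨆ m : ℕ, (LieModule.toEnd k 𝔤 V (h₀ : 𝔤)).eigenspace (wt h₀ - (m + 1 : ℕ)) ≤
            ⨆ m : ℕ, (LieModule.toEnd k 𝔤 V (h₀ : 𝔤)).eigenspace (wt h₀ - m) := iSup_le fun m => ?_
        · refine add_mem (hle hc) (Submodule.smul_mem _ _ ?_)
          refine Submodule.mem_iSup_of_mem 0 (Module.End.mem_eigenspace_iff.2 ?_)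
          simpa using hv.lie_cartan h₀
        · exact le_iSup (fun m : ℕ => (LieModule.toEnd k 𝔤 V (h₀ : 𝔤)).eigenspace (wt h₀ - m)) (m + 1)
      refine hv0' (eq_zero_of_mem_iSup_eigenspace (a := wt' h₀) (fun m => ?_) (hv'.lie_cartan h₀) hmem)
      cases m with
      | zero => simpa using hwt
      | succ m => exact hcon.2 m
  have hprop : ∀ {wt wt' : Module.Dual k 𝔥} {v v' : V}, v' ≠ 0 →
      IsHighestWeightVector base wt v → IsHighestWeightVector base wt' v' →
      (∃ c : k, v' = c • v) → wt = wt' := by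
    rintro wt wt' v _ hv0' hv hv' ⟨c, rfl⟩
    ext h
    have h1 := hv'.lie_cartan h
    rw [lie_smul, hv.lie_cartan, smul_comm] at h1
    exact smul_left_injective k hv0' h1
  rcases key hv0 hv0' hv hv' with h | ⟨m, hm⟩
  · exact hprop hv0' hv hv' h
  rcases key hv0' hv0 hv' hv with h | ⟨m', hm'⟩
  · exact (hprop hv0 hv' hv h).symm
  exfalso
  have : ((m + 1 + (m' + 1) : ℕ) : k) = 0 := by
    push_cast at hm hm' ⊢
    linear_combination -hm - hm'
  exact absurd (Nat.cast_eq_zero.1 this) (by omega)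

end HighestWeight

/-! ### Schur's lemma for Lie modules. -/

section Schur

variable {k L : Type*} [Field k] [LieRing L] [LieAlgebra k L]
  {V W : Type*} [AddCommGroup V] [Module k V] [LieRingModule L V] [LieModule k L V]
  [AddCommGroup W] [Module k W] [LieRingModule L W] [LieModule k L W]

/-- A nonzero homomorphism of irreducible modules is bijective. -/
theorem bijective_of_isIrreducible (hV : LieModule.IsIrreducible k L V)
    (hW : LieModule.IsIrreducible k L W) (f : V →ₗ⁅k,L⁆ W) (hf : ∃ v, f v ≠ 0) :
    Function.Bijective f := by
  obtain ⟨v, hv⟩ := hf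
  constructor
  · rw [← LieModuleHom.ker_eq_bot]
    refine (hV.eq_bot_or_eq_top _).resolve_right fun h => hv ?_
    have : v ∈ f.ker := by rw [h]; trivial
    exact (LieModuleHom.mem_ker).1 this
  · rw [← LieModuleHom.range_eq_top]
    refine (hW.eq_bot_or_eq_top _).resolve_left fun h => hv ?_
    have : f v ∈ f.range := (LieModuleHom.mem_range f _).2 ⟨v, rfl⟩
    rwa [h, LieSubmodule.mem_bot] at this

/-- The equivalence of Lie modules given by a bijective homomorphism. -/
noncomputable def lieModuleEquivOfBijective (f : V →ₗ⁅k,L⁆ W) (hf : Function.Bijective f) :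
    V ≃ₗ⁅k,L⁆ W :=
  { LinearEquiv.ofBijective (f : V →ₗ[k] W) hf with
    map_lie' := fun {x m} => f.map_lie x m }

/-- **Schur's lemma**: an operator commuting with an irreducible action is scalar. -/
theorem exists_eq_smul_one_of_isIrreducible [IsAlgClosed k] [FiniteDimensional k V]
    (hV : LieModule.IsIrreducible k L V) (T : Module.End k V)
    (hT : ∀ (x : L) v, T ⁅x, v⁆ = ⁅x, T v⁆) : ∃ c : k, T = c • 1 := by
  have := LieModule.nontrivial_of_isIrreducible k L V
  obtain ⟨c, hc⟩ := Module.End.exists_eigenvalue T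
  refine ⟨c, ?_⟩
  let N : LieSubmodule k L V :=
    { T.eigenspace c with
      lie_mem := fun {x v} hv => by
        have hv : T v = c • v := Module.End.mem_eigenspace_iff.1 hv
        exact Module.End.mem_eigenspace_iff.2 (by rw [hT, hv, lie_smul]) }
  have hN : N = ⊤ := (hV.eq_bot_or_eq_top N).resolve_left fun h => by
    obtain ⟨v, hv⟩ := hc.exists_hasEigenvector
    have : v ∈ N := hv.1
    rw [h, LieSubmodule.mem_bot] at this
    exact hv.2 this
  ext v
  have : v ∈ N := by rw [hN]; trivial
  exact Module.End.mem_eigenspace_iff.1 this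

end Schur

/-! ### Submodules of a direct sum of two irreducible modules. -/

section Prod

variable {k L : Type*} [Field k] [LieRing L] [LieAlgebra k L]
  {V W : Type*} [AddCommGroup V] [Module k V] [LieRingModule L V] [LieModule k L V]
  [AddCommGroup W] [Module k W] [LieRingModule L W] [LieModule k L W]

instance : LieRingModule L (V × W) where
  bracket x p := (⁅x, p.1⁆, ⁅x, p.2⁆)
  add_lie _ _ _ := Prod.ext (add_lie _ _ _) (add_lie _ _ _)
  lie_add _ _ _ := Prod.ext (lie_add _ _ _) (lie_add _ _ _)
  leibniz_lie _ _ _ := Prod.ext (leibniz_lie _ _ _) (leibniz_lie _ _ _)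

instance : LieModule k L (V × W) where
  smul_lie _ _ _ := Prod.ext (smul_lie _ _ _) (smul_lie _ _ _)
  lie_smul _ _ _ := Prod.ext (lie_smul _ _ _) (lie_smul _ _ _)

theorem lie_mk (x : L) (v : V) (w : W) : ⁅x, (v, w)⁆ = (⁅x, v⁆, ⁅x, w⁆) := rfl

variable (k L V W) in
/-- The first projection, as a homomorphism of Lie modules. -/
def lieFst : V × W →ₗ⁅k,L⁆ V := { LinearMap.fst k V W with map_lie' := rfl }

variable (k L V W) in
/-- The second projection, as a homomorphism of Lie modules. -/
def lieSnd : V × W →ₗ⁅k,L⁆ W := { LinearMap.snd k V W with map_lie' := rfl }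

/-- The first inclusion, as a homomorphism of Lie modules. -/
def lieInl : V →ₗ⁅k,L⁆ V × W :=
  { LinearMap.inl k V W with map_lie' := fun {x _} => Prod.ext rfl (lie_zero x).symm }

/-- The second inclusion, as a homomorphism of Lie modules. -/
def lieInr : W →ₗ⁅k,L⁆ V × W :=
  { LinearMap.inr k V W with map_lie' := fun {x _} => Prod.ext (lie_zero x).symm rfl }

/-- Goursat's argument: the intersection of `N` with the second summand is a proper submodule, hence
zero, while the projection to the first summand is nonzero, hence onto. -/
theorem bijective_fst_of_isIrreducible (hV : LieModule.IsIrreducible k L V)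
    (hW : LieModule.IsIrreducible k L W) (N : LieSubmodule k L (V × W)) {v : V} {w : W}
    (hv : v ≠ 0) (hvw : (v, w) ∈ N) (hw : (0, w) ∉ N) :
    Function.Bijective ((lieFst k L V W).comp N.incl) := by
  constructor
  · rw [← LieModuleHom.ker_eq_bot, LieSubmodule.eq_bot_iff]
    rintro ⟨⟨a, b⟩, hab⟩ h
    have ha : a = 0 := LieModuleHom.mem_ker.1 h
    subst ha
    have : N.comap (lieInr (k := k) (L := L) (V := V)) = ⊥ :=
      (hW.eq_bot_or_eq_top _).resolve_right fun h => hw <| by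
        have : w ∈ N.comap (lieInr (k := k) (L := L) (V := V)) := by rw [h]; trivial
        exact this
    have hb : b ∈ N.comap (lieInr (k := k) (L := L) (V := V)) := hab
    rw [this, LieSubmodule.mem_bot] at hb
    subst hb
    rfl
  · rw [← LieModuleHom.range_eq_top]
    refine (hV.eq_bot_or_eq_top _).resolve_left fun h => hv ?_
    have : v ∈ ((lieFst k L V W).comp N.incl).range :=
      (LieModuleHom.mem_range _ _).2 ⟨⟨_, hvw⟩, rfl⟩
    rwa [h, LieSubmodule.mem_bot] at this

theorem bijective_snd_of_isIrreducible (hV : LieModule.IsIrreducible k L V)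
    (hW : LieModule.IsIrreducible k L W) (N : LieSubmodule k L (V × W)) {v : V} {w : W}
    (hw : w ≠ 0) (hvw : (v, w) ∈ N) (hv : (v, 0) ∉ N) :
    Function.Bijective ((lieSnd k L V W).comp N.incl) := by
  constructor
  · rw [← LieModuleHom.ker_eq_bot, LieSubmodule.eq_bot_iff]
    rintro ⟨⟨a, b⟩, hab⟩ h
    have hb : b = 0 := LieModuleHom.mem_ker.1 h
    subst hb
    have : N.comap (lieInl (k := k) (L := L) (W := W)) = ⊥ :=
      (hV.eq_bot_or_eq_top _).resolve_right fun h => hv <| by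
        have : v ∈ N.comap (lieInl (k := k) (L := L) (W := W)) := by rw [h]; trivial
        exact this
    have ha : a ∈ N.comap (lieInl (k := k) (L := L) (W := W)) := hab
    rw [this, LieSubmodule.mem_bot] at ha
    subst ha
    rfl
  · rw [← LieModuleHom.range_eq_top]
    refine (hW.eq_bot_or_eq_top _).resolve_left fun h => hw ?_
    have : w ∈ ((lieSnd k L V W).comp N.incl).range :=
      (LieModuleHom.mem_range _ _).2 ⟨⟨_, hvw⟩, rfl⟩
    rwa [h, LieSubmodule.mem_bot] at this

end Prod

/-! ### Classification by highest weight, and pinned automorphisms. -/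

section HighestWeightModules

open LieAlgebra LieAlgebra.IsKilling

variable {k 𝔤 : Type*} [Field k] [IsAlgClosed k] [CharZero k] [LieRing 𝔤] [LieAlgebra k 𝔤]
  [FiniteDimensional k 𝔤] [LieAlgebra.IsSimple k 𝔤]
  {𝔥 : LieSubalgebra k 𝔤} [𝔥.IsCartanSubalgebra]
  {V W : Type*} [AddCommGroup V] [Module k V] [LieRingModule 𝔤 V] [LieModule k 𝔤 V]
  [AddCommGroup W] [Module k W] [LieRingModule 𝔤 W] [LieModule k 𝔤 W]

/-- Irreducible modules with the same highest weight are isomorphic. -/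
theorem IsHighestWeightVector.nonempty_equiv {base : (rootSystem 𝔥).Base}
    (hV : LieModule.IsIrreducible k 𝔤 V) (hW : LieModule.IsIrreducible k 𝔤 W)
    {wt : Module.Dual k 𝔥} {v : V} {w : W} (hv0 : v ≠ 0) (hw0 : w ≠ 0)
    (hv : IsHighestWeightVector base wt v) (hw : IsHighestWeightVector base wt w) :
    Nonempty (V ≃ₗ⁅k,𝔤⁆ W) := by
  obtain ⟨h₀, hh₀⟩ := exists_forall_root_apply_eq_height base
  have hvw : IsHighestWeightVector base wt (v, w) :=
    ⟨fun α hα x hx => Prod.ext (hv.lie_eq_zero α hα x hx) (hw.lie_eq_zero α hα x hx),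
      fun h => Prod.ext (hv.lie_cartan h) (hw.lie_cartan h)⟩
  obtain ⟨N, hN, hN'⟩ := hvw.exists_lieSubmodule hh₀
  -- The top eigenspace of `N` is one line, so `N` contains neither $(v,0)$ nor $(0,w)$ and is the
  -- graph of an isomorphism.
  have key : ∀ p ∈ N, ⁅(h₀ : 𝔤), p⁆ = wt h₀ • p → ∃ c : k, p = c • (v, w) := fun p hp hp' => by
    obtain ⟨c, hc⟩ := hN' p hp
    refine ⟨c, sub_eq_zero.1 (eq_zero_of_mem_iSup_eigenspace (a := wt h₀) (fun m => ?_) ?_ hc)⟩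
    · have : ((m + 1 : ℕ) : k) ≠ 0 := Nat.cast_ne_zero.2 (Nat.succ_ne_zero m)
      simpa using this
    · rw [LieModule.toEnd_apply_apply, lie_sub, lie_smul, hvw.lie_cartan, hp', smul_sub, smul_comm]
  have h1 : (0, w) ∉ N := fun h => by
    obtain ⟨c, hc⟩ := key _ h (by rw [lie_mk, hw.lie_cartan, lie_zero]; simp)
    have h2 := congrArg Prod.fst hc
    have h3 := congrArg Prod.snd hc
    have : c = 0 := (smul_eq_zero.1 h2.symm).resolve_right hv0
    rw [this, zero_smul] at h3
    exact hw0 h3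
  have h2 : (v, 0) ∉ N := fun h => by
    obtain ⟨c, hc⟩ := key _ h (by rw [lie_mk, hv.lie_cartan, lie_zero]; simp)
    have h2 := congrArg Prod.snd hc
    have h3 := congrArg Prod.fst hc
    have : c = 0 := (smul_eq_zero.1 h2.symm).resolve_right hw0
    rw [this, zero_smul] at h3
    exact hv0 h3
  exact ⟨(lieModuleEquivOfBijective _ (bijective_fst_of_isIrreducible hV hW N hv0 hN h1)).symm.trans
    (lieModuleEquivOfBijective _ (bijective_snd_of_isIrreducible hV hW N hw0 hN h2))⟩

theorem IsHighestWeightVector.map {base : (rootSystem 𝔥).Base} {wt : Module.Dual k 𝔥} {v : V}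
    (hv : IsHighestWeightVector base wt v) (f : V →ₗ⁅k,𝔤⁆ W) :
    IsHighestWeightVector base wt (f v) :=
  ⟨fun α hα x hx => by rw [← f.map_lie, hv.lie_eq_zero α hα x hx, map_zero],
    fun h => by rw [← f.map_lie, hv.lie_cartan, map_smul]⟩

theorem IsSimpleOfHighestWeight.exists_isHighestWeightVector {P : Pinning 𝔥}
    {μ : Module.Dual k 𝔥} (hV : IsSimpleOfHighestWeight P μ V) :
    ∃ v : V, v ≠ 0 ∧ IsHighestWeightVector P.base μ v := by
  obtain ⟨v, hv0, hv1, hv2⟩ := hV.exists_highest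
  exact ⟨v, hv0, hv1, hv2⟩

/-- Simple highest weight modules are classified by their highest weight. -/
theorem IsSimpleOfHighestWeight.nonempty_equiv_iff {P : Pinning 𝔥} {μ ν : Module.Dual k 𝔥}
    (hV : IsSimpleOfHighestWeight P μ V) (hW : IsSimpleOfHighestWeight P ν W) :
    Nonempty (V ≃ₗ⁅k,𝔤⁆ W) ↔ μ = ν := by
  obtain ⟨v, hv0, hv⟩ := hV.exists_isHighestWeightVector
  obtain ⟨w, hw0, hw⟩ := hW.exists_isHighestWeightVector
  constructor
  · rintro ⟨f⟩
    exact (hv.map (f : V →ₗ⁅k,𝔤⁆ W)).wt_eq hW.irreducible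
      (fun h => hv0 (f.injective (h.trans (map_zero f.toLinearEquiv).symm))) hw0 hw
  · rintro rfl
    exact IsHighestWeightVector.nonempty_equiv hV.irreducible hW.irreducible hv0 hw0 hv hw

theorem IsSimpleOfHighestWeight.exists_lie_ne_zero {P : Pinning 𝔥} {μ : Module.Dual k 𝔥}
    (hV : IsSimpleOfHighestWeight P μ V) (hμ : μ ≠ 0) : ∃ (x : 𝔤) (v : V), ⁅x, v⁆ ≠ 0 := by
  obtain ⟨v, hv0, hv⟩ := hV.exists_isHighestWeightVector
  obtain ⟨h, hh⟩ : ∃ h, μ h ≠ 0 := by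
    by_contra! h
    exact hμ (LinearMap.ext h)
  exact ⟨h, v, by rw [hv.lie_cartan]; exact smul_ne_zero hh hv0⟩

/-- An automorphism preserving the pinning permutes the positive root spaces. -/
theorem IsPinned.exists_isPos {P : Pinning 𝔥} {δ : 𝔤 ≃ₗ⁅k⁆ 𝔤} (hδ : IsPinned P δ) {α : 𝔥.root}
    (hα : P.base.IsPos α) {x : 𝔤} (hx : x ∈ rootSpace 𝔥 α.1) :
    ∃ β : 𝔥.root, P.base.IsPos β ∧ δ x ∈ rootSpace 𝔥 β.1 := by
  obtain ⟨ρ, hρ⟩ := hδ.permutes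
  obtain ⟨π, hπ, hπ'⟩ := exists_perm_root δ hδ.mem_iff
  obtain ⟨h₀, hh₀⟩ := exists_forall_root_apply_eq_height P.base
  have hsimple : ∀ i : P.base.support, π i.1 = (ρ i).1 := fun i => by
    refine root_ext fun h => smul_left_injective k (P.vec_ne_zero (ρ i)) ?_
    change (π i.1).1 h • P.vec (ρ i) = (ρ i).1.1 h • P.vec (ρ i)
    rw [← lie_of_mem_rootSpace (P.vec_mem (ρ i)), ← hρ,
      ← lie_of_mem_rootSpace (hπ' _ _ (P.vec_mem i))]
  -- Permuting the simple roots preserves the defining values of $h_0$, so heights, and with them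
  -- positivity, are preserved.
  have hone : ∀ i : P.base.support, i.1.1 (cartanMap δ hδ.mem_iff h₀) = 1 := fun i => by
    have h1 := hπ (ρ.symm i).1 h₀
    rw [hsimple, Equiv.apply_symm_apply, hh₀,
      P.base.height_one_of_mem_support (ρ.symm i).2] at h1
    simpa using h1
  refine ⟨π α, ?_, hπ' α x hx⟩
  have h1 := hπ α h₀
  rw [root_apply_eq_height P.base hone, hh₀] at h1
  have h2 : P.base.height (π α) = P.base.height α := by exact_mod_cast h1
  change 0 < P.base.height (π α)
  rw [h2]
  exact hα

end HighestWeightModules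

/-! ### Twisting a module by an automorphism. -/

section Twist

open LieAlgebra LieAlgebra.IsKilling

variable {k 𝔤 : Type*} [Field k] [LieRing 𝔤] [LieAlgebra k 𝔤]

/-- The vector space underlying a `𝔤`-module `W`, on which `𝔤` acts through the automorphism `θ`. -/
@[nolint unusedArguments]
def TwistModule (_θ : 𝔤 ≃ₗ⁅k⁆ 𝔤) (W : Type*) : Type _ := W

variable (θ : 𝔤 ≃ₗ⁅k⁆ 𝔤) (W : Type*) [AddCommGroup W] [Module k W] [LieRingModule 𝔤 W]
  [LieModule k 𝔤 W]

instance : AddCommGroup (TwistModule θ W) := inferInstanceAs (AddCommGroup W)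

instance : Module k (TwistModule θ W) := inferInstanceAs (Module k W)

instance : LieRingModule 𝔤 (TwistModule θ W) :=
  LieRingModule.compLieHom W (θ : 𝔤 →ₗ⁅k⁆ 𝔤)

instance : LieModule k 𝔤 (TwistModule θ W) :=
  LieModule.compLieHom W (θ : 𝔤 →ₗ⁅k⁆ 𝔤)

/-- The identity map from a module to its twist. -/
def toTwist : W ≃ₗ[k] TwistModule θ W := LinearEquiv.refl k W

variable {W}

theorem lie_toTwist (x : 𝔤) (w : W) : ⁅x, toTwist θ W w⁆ = toTwist θ W ⁅θ x, w⁆ := rfl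

theorem isIrreducible_twistModule (hW : LieModule.IsIrreducible k 𝔤 W) :
    LieModule.IsIrreducible k 𝔤 (TwistModule θ W) := by
  have := LieModule.nontrivial_of_isIrreducible k 𝔤 W
  have : Nontrivial (TwistModule θ W) := (toTwist θ W).symm.toEquiv.nontrivial
  refine LieModule.IsIrreducible.mk fun N hN => ?_
  let N' : LieSubmodule k 𝔤 W :=
    { N.toSubmodule.comap (toTwist θ W).toLinearMap with
      lie_mem := fun {x w} hw => by
        have h := N.lie_mem (x := θ.symm x) hw
        change ⁅θ.symm x, toTwist θ W w⁆ ∈ N at h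
        rw [lie_toTwist, θ.apply_symm_apply] at h
        exact h }
  have hN' : N' = ⊤ := (hW.eq_bot_or_eq_top N').resolve_left fun h => hN <| by
    rw [LieSubmodule.eq_bot_iff]
    intro w hw
    have : (toTwist θ W).symm w ∈ N' := hw
    rwa [h, LieSubmodule.mem_bot] at this
  rw [eq_top_iff]
  intro w _
  have : (toTwist θ W).symm w ∈ N' := by rw [hN']; trivial
  exact this

variable [IsAlgClosed k] [CharZero k] [FiniteDimensional k 𝔤] [LieAlgebra.IsSimple k 𝔤]
  {𝔥 : LieSubalgebra k 𝔤} [𝔥.IsCartanSubalgebra]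

/-- The default branch in `outPart` is never reached. Any pinned factor that the choice returns
serves below, so uniqueness of the decomposition plays no role. -/
theorem isOuterPart_outPart (P : Pinning 𝔥) (θ : 𝔤 ≃ₗ⁅k⁆ 𝔤) :
    IsOuterPart P θ (outPart P θ).1 := by
  have h := exists_isOuterPart P θ
  rw [outPart, dif_pos h]
  exact h.choose_spec

/-- Twisting by `θ` changes the highest weight by the outer part of `θ`. -/
theorem IsSimpleOfHighestWeight.twistModule {P : Pinning 𝔥} {μ : Module.Dual k 𝔥}
    (hW : IsSimpleOfHighestWeight P μ W) :
    IsSimpleOfHighestWeight P (μ ∘ₗ restrictCartan P (outPart P θ)) (TwistModule θ W) := by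
  have := hW.finite
  obtain ⟨w, hw0, hw⟩ := hW.exists_isHighestWeightVector
  obtain ⟨hδ, ι, hι, hθ⟩ := isOuterPart_outPart P θ
  -- `g` implements the inner part on the module, so `g w` is the highest weight vector of the
  -- twist.
  obtain ⟨g, hg⟩ := exists_linearEquiv_of_mem_elementaryGroup hW.irreducible hι
  refine ⟨inferInstanceAs (FiniteDimensional k W), isIrreducible_twistModule θ hW.irreducible,
    toTwist θ W (g w), ?_, fun α hα x hx => ?_, fun h => ?_⟩
  · simpa using hw0
  · obtain ⟨β, hβ, hβx⟩ := hδ.exists_isPos hα hx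
    rw [lie_toTwist, hθ]
    have := hg ((outPart P θ).1 x) w
    rw [hw.lie_eq_zero β hβ _ hβx, map_zero] at this
    rw [show ⁅ι ((outPart P θ).1 x), g w⁆ = 0 from this.symm, map_zero]
  · rw [lie_toTwist, hθ]
    have := hg ((outPart P θ).1 h) w
    have h2 : ⁅(outPart P θ).1 h, w⁆ = μ (restrictCartan P (outPart P θ) h) • w :=
      hw.lie_cartan (restrictCartan P (outPart P θ) h)
    rw [h2, map_smul] at this
    rw [show ⁅ι ((outPart P θ).1 h), g w⁆ = _ from this.symm, map_smul]
    rfl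

end Twist

/-! ### Separating points by functions from the base ring. -/

section Residue

variable {k S : Type*} [Field k] [CommRing S] [Algebra k S]

theorem algHom_eq_of_ker_le {f g : S →ₐ[k] k} (h : ∀ s, g s = 0 → f s = 0) : f = g := by
  ext s
  have := h (s - algebraMap k S (g s)) (by simp)
  simpa [sub_eq_zero] using this

variable [IsAlgClosed k] [Algebra.FiniteType k S]

theorem residue_eq_zero_iff (M : MaximalSpectrum S) {s : S} :
    residue (k := k) M s = 0 ↔ s ∈ M.asIdeal := by
  rw [residue, AlgHom.comp_apply]
  refine (map_eq_zero_iff (AlgEquiv.ofBijective _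
    (algebraMap_quotient_bijective (k := k) M)).symm (AlgEquiv.injective _)).trans ?_
  exact Ideal.Quotient.eq_zero_iff_mem

variable {R : Type*} [CommRing R] [Algebra k R] [Algebra R S] [IsScalarTower k R S]

theorem exists_residue_eq_one {ι : Type*} [Finite ι] {M : ι → MaximalSpectrum S}
    (hM : ∀ i j, i ≠ j → (M i).asIdeal.under R ≠ (M j).asIdeal.under R) (i : ι) :
    ∃ r : R, residue (k := k) (M i) (algebraMap R S r) = 1 ∧
      ∀ j, j ≠ i → residue (k := k) (M j) (algebraMap R S r) = 0 := by
  classical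
  cases nonempty_fintype ι
  let f : ι → R →ₐ[k] k := fun j => (residue (M j)).comp (IsScalarTower.toAlgHom k R S)
  have hf : ∀ j r, f j r = 0 ↔ r ∈ (M j).asIdeal.under R := fun j r => residue_eq_zero_iff (M j)
  have key : ∀ j, ∃ r, j ≠ i → f i r ≠ 0 ∧ f j r = 0 := fun j => by
    by_cases hj : j = i
    · exact ⟨0, fun h => absurd hj h⟩
    · by_contra! hcon
      have : f i = f j := algHom_eq_of_ker_le fun s hs => by
        by_contra hs'
        exact (hcon s).2 hs' hs
      refine hM i j (Ne.symm hj) ?_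
      ext r
      rw [← hf, ← hf, this]
  choose r hr using key
  have hp : f i (∏ j ∈ Finset.univ.erase i, r j) ≠ 0 := by
    rw [map_prod]
    exact Finset.prod_ne_zero_iff.2 fun j hj => (hr j (Finset.ne_of_mem_erase hj)).1
  refine ⟨(f i (∏ j ∈ Finset.univ.erase i, r j))⁻¹ • ∏ j ∈ Finset.univ.erase i, r j, ?_,
    fun j hj => ?_⟩
  · change f i _ = 1
    rw [map_smul, smul_eq_mul, inv_mul_cancel₀ hp]
  · change f j _ = 0
    have : f j (∏ l ∈ Finset.univ.erase i, r l) = 0 := by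
      rw [map_prod]
      exact Finset.prod_eq_zero (Finset.mem_erase.2 ⟨hj, Finset.mem_univ j⟩) (hr j hj).2
    rw [map_smul, this, smul_zero]

end Residue

/-! ### Galois descent and evaluation of the twisted form. -/

section GaloisDescent

variable {k R S 𝔤 Γ : Type*} [Field k] [CommRing R] [Algebra k R] [CommRing S] [Algebra k S]
  [Algebra R S] [IsScalarTower k R S] [LieRing 𝔤] [LieAlgebra k 𝔤]
  [Group Γ] [MulSemiringAction Γ S] [SMulCommClass Γ R S] [SMulCommClass Γ k S]

theorem galAct_tmul (γ : Γ) (s : S) (x : 𝔤) :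
    galAct k 𝔤 γ (s ⊗ₜ[k] x) = (γ • s) ⊗ₜ[k] x := rfl

theorem galAct_smul (γ : Γ) (s : S) (z : S ⊗[k] 𝔤) :
    galAct k 𝔤 γ (s • z) = (γ • s) • galAct k 𝔤 γ z := by
  induction z with
  | zero => simp
  | add a b ha hb => simp only [smul_add, map_add, ha, hb]
  | tmul t x => simp [galAct_tmul, TensorProduct.smul_tmul', smul_mul']

theorem galAct_mul (γ δ : Γ) (z : S ⊗[k] 𝔤) :
    galAct k 𝔤 (γ * δ) z = galAct k 𝔤 γ (galAct k 𝔤 δ z) := by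
  induction z with
  | zero => simp
  | add a b ha hb => simp only [map_add, ha, hb]
  | tmul t x => simp [galAct_tmul, mul_smul]

theorem galAct_one (z : S ⊗[k] 𝔤) : galAct k 𝔤 (1 : Γ) z = z := by
  induction z with
  | zero => simp
  | add a b ha hb => simp only [map_add, ha, hb]
  | tmul t x => simp [galAct_tmul]

variable {u : Γ → (S ⊗[k] 𝔤 ≃ₗ⁅S⁆ S ⊗[k] 𝔤)}

theorem IsCocycle.apply_one (hu : IsCocycle u) (z : S ⊗[k] 𝔤) : u 1 z = z := by
  have h := hu 1 1 z
  rw [inv_one, galAct_one, galAct_one, mul_one] at h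
  exact ((u 1).injective h).symm

/-- The twisted trace: by the cocycle identity, $\delta$ sends the summand of $\gamma$ to that of
$\delta\gamma$. -/
theorem IsCocycle.sum_mem [Fintype Γ] (hu : IsCocycle u) (z : S ⊗[k] 𝔤) :
    ∑ γ, u γ (galAct k 𝔤 γ z) ∈ twistedForm u := by
  intro δ
  rw [map_sum, map_sum]
  refine (Finset.sum_congr rfl fun γ _ => ?_).trans
    (Equiv.sum_comp (Equiv.mulLeft δ) fun γ => u γ (galAct k 𝔤 γ z))
  rw [Equiv.coe_mulLeft, hu δ γ, galAct_mul, ← galAct_mul δ⁻¹, inv_mul_cancel, galAct_one]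

theorem galoisMap_tmul (a b : S) (γ : Γ) : galoisMap Γ R S (a ⊗ₜ[R] b) γ = a * γ • b := rfl

/-- The twisted form spans `𝔤(S)` over `S`. -/
theorem IsCocycle.span_eq_top (hu : IsCocycle u) (hΓ : IsGaloisExtension Γ R S) :
    Submodule.span S (twistedForm u : Set (S ⊗[k] 𝔤)) = ⊤ := by
  classical
  have := hΓ.finite
  cases nonempty_fintype Γ
  rw [eq_top_iff]
  rintro z -
  have key : ∀ t : S ⊗[R] S, ∑ γ, galoisMap Γ R S t γ • u γ (galAct k 𝔤 γ z) ∈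
      Submodule.span S (twistedForm u : Set (S ⊗[k] 𝔤)) := fun t => by
    induction t with
    | zero => simp
    | add a b ha hb =>
      simp only [map_add, Pi.add_apply, add_smul, Finset.sum_add_distrib]
      exact add_mem ha hb
    | tmul a b =>
      have : ∑ γ, galoisMap Γ R S (a ⊗ₜ[R] b) γ • u γ (galAct k 𝔤 γ z) =
          a • ∑ γ, u γ (galAct k 𝔤 γ (b • z)) := by
        rw [Finset.smul_sum]
        refine Finset.sum_congr rfl fun γ _ => ?_
        rw [galoisMap_tmul, mul_smul, galAct_smul, map_smul]
      rw [this]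
      exact Submodule.smul_mem _ _ (Submodule.subset_span (hu.sum_mem _))
  -- The Galois isomorphism provides coefficients that isolate the summand at the identity, writing
  -- `z` as an $S$-combination of twisted traces.
  obtain ⟨t, ht⟩ := hΓ.bijective.2 (Pi.single 1 1)
  have h := key t
  rw [ht, Finset.sum_eq_single 1 (fun γ _ hγ => by rw [Pi.single_eq_of_ne hγ, zero_smul])
    (fun h => absurd (Finset.mem_univ _) h), Pi.single_eq_same, one_smul, galAct_one,
    hu.apply_one] at h
  exact h

variable [IsAlgClosed k] [Algebra.FiniteType k S]

/-- At a single point a coefficient in $S$ may be replaced by its value in $k$, under which the form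
is stable. Spanning over $S$ therefore gives surjectivity of evaluation. -/
theorem IsCocycle.exists_evalAt_eq (hu : IsCocycle u) (hΓ : IsGaloisExtension Γ R S)
    (M : MaximalSpectrum S) (x : 𝔤) : ∃ l ∈ twistedForm u, evalAt M l = x := by
  have key : ∀ z ∈ Submodule.span S (twistedForm u : Set (S ⊗[k] 𝔤)),
      ∃ l ∈ twistedForm u, evalAt M l = evalAt M z := fun z hz => by
    induction hz using Submodule.span_induction with
    | mem z hz => exact ⟨z, hz, rfl⟩
    | zero => exact ⟨0, zero_mem _, rfl⟩
    | add a b _ _ ha hb =>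
      obtain ⟨l, hl, hl'⟩ := ha
      obtain ⟨m, hm, hm'⟩ := hb
      exact ⟨l + m, add_mem hl hm, by rw [map_add, map_add, hl', hm']⟩
    | smul s a _ ha =>
      obtain ⟨l, hl, hl'⟩ := ha
      exact ⟨residue (k := k) M s • l, (twistedForm u).smul_mem _ hl, by
        rw [map_smul, hl', evalAt_smul]⟩
  obtain ⟨l, hl, hl'⟩ := key (1 ⊗ₜ[k] x) (by rw [hu.span_eq_top hΓ]; trivial)
  exact ⟨l, hl, by simpa using hl'⟩

theorem algebraMap_smul_mem_twistedForm (r : R) {z : S ⊗[k] 𝔤} (hz : z ∈ twistedForm u) :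
    algebraMap R S r • z ∈ twistedForm u := fun γ => by
  rw [galAct_smul, smul_algebraMap, map_smul, hz γ]

/-- Over maximal ideals with distinct contractions to `R`, the values of elements of the twisted
form can be prescribed independently. -/
theorem IsCocycle.exists_evalAt_eq_of_ne (hu : IsCocycle u) (hΓ : IsGaloisExtension Γ R S)
    {ι : Type*} [Finite ι] {M : ι → MaximalSpectrum S}
    (hM : ∀ i j, i ≠ j → (M i).asIdeal.under R ≠ (M j).asIdeal.under R) (i : ι) (x : 𝔤) :
    ∃ l : twistedForm u, evalAt (M i) (l : S ⊗[k] 𝔤) = x ∧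
      ∀ j, j ≠ i → evalAt (M j) (l : S ⊗[k] 𝔤) = 0 := by
  obtain ⟨l, hl, hx⟩ := hu.exists_evalAt_eq hΓ (M i) x
  obtain ⟨r, hr, hr'⟩ := exists_residue_eq_one (k := k) hM i
  refine ⟨⟨_, algebraMap_smul_mem_twistedForm r hl⟩, ?_, fun j hj => ?_⟩
  · rw [evalAt_smul, hr, one_smul, hx]
  · rw [evalAt_smul, hr' j hj, zero_smul]

theorem mem_galConj_iff (γ : Γ) (N : MaximalSpectrum S) (s : S) :
    s ∈ (galConj γ N).asIdeal ↔ γ⁻¹ • s ∈ N.asIdeal := Iff.rfl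

theorem residue_galConj_smul (γ : Γ) (N : MaximalSpectrum S) (s : S) :
    residue (k := k) (galConj γ N) (γ • s) = residue (k := k) N s := by
  have : (residue (k := k) (galConj γ N)).comp (MulSemiringAction.toAlgHom k S γ) = residue N :=
    algHom_eq_of_ker_le fun t ht => by
      rw [AlgHom.comp_apply, MulSemiringAction.toAlgHom_apply, residue_eq_zero_iff,
        mem_galConj_iff, inv_smul_smul]
      exact (residue_eq_zero_iff N).1 ht
  exact AlgHom.congr_fun this s

theorem evalAt_galConj_galAct (γ : Γ) (N : MaximalSpectrum S) (z : S ⊗[k] 𝔤) :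
    evalAt (galConj γ N) (galAct k 𝔤 γ z) = evalAt N z := by
  induction z with
  | zero => simp
  | add a b ha hb => simp only [map_add, ha, hb]
  | tmul t x => rw [galAct_tmul, evalAt_tmul, evalAt_tmul, residue_galConj_smul]

/-- For `z` in the form, ${}^\gamma z=u_\gamma^{-1}(z)$; evaluate both sides at ${}^\gamma N$. This
is the source of the twist in `galPair`. -/
theorem evalAt_eq_specialize {z : S ⊗[k] 𝔤} (hz : z ∈ twistedForm u) (γ : Γ)
    (N : MaximalSpectrum S) :
    evalAt N z = specialize (u γ).symm (galConj γ N) (evalAt (galConj γ N) z) := by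
  have h : (u γ).symm z = galAct k 𝔤 γ z := by
    conv_lhs => rw [← hz γ]
    exact (u γ).symm_apply_apply _
  refine Eq.trans ?_ (specializeHom_evalAt (u γ).symm (galConj γ N) z).symm
  rw [h, evalAt_galConj_galAct]

theorem IsGaloisExtension.exists_eq_galConj (hΓ : IsGaloisExtension Γ R S)
    {M N : MaximalSpectrum S} (h : M.asIdeal.under R = N.asIdeal.under R) :
    ∃ γ : Γ, M = galConj γ N := by
  have := hΓ.finite
  have : Algebra.IsInvariant R S Γ := ⟨hΓ.invariant⟩
  have := M.isMaximal
  have := N.isMaximal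
  obtain ⟨γ, hγ⟩ := Algebra.IsInvariant.exists_smul_of_under_eq R S Γ N.asIdeal M.asIdeal h.symm
  refine ⟨γ, MaximalSpectrum.ext ?_⟩
  ext s
  rw [hγ, mem_galConj_iff, ← Ideal.mem_inv_pointwise_smul_iff, inv_inv]

end GaloisDescent

/-! ### Contractions and Lie actions on tensor products. -/

section PiTensor

variable {ι k L : Type*} [dec : DecidableEq ι] [Fintype ι] [Field k] [LieRing L] [LieAlgebra k L]
  {V W : ι → Type*} [∀ i, AddCommGroup (V i)] [∀ i, Module k (V i)]
  [∀ i, AddCommGroup (W i)] [∀ i, Module k (W i)]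

theorem tensorAt_tprod (i : ι) (f : Module.End k (V i)) (v : ∀ i, V i) :
    tensorAt i f (PiTensorProduct.tprod k v) =
      PiTensorProduct.tprod k (Function.update v i (f (v i))) := by
  refine (PiTensorProduct.map_tprod _ _).trans (congrArg _ (funext fun j => ?_))
  by_cases h : j = i
  · subst h; simp
  · simp [Function.update_of_ne h]

theorem prod_erase_update_of_ne {i l : ι} (hl : l ≠ i) (f : ∀ i, Module.Dual k (V i))
    (v : ∀ i, V i) (x : V l) :
    ∏ j ∈ Finset.univ.erase i, f j (Function.update v l x j) =
      f l x * ∏ j ∈ (Finset.univ.erase i).erase l, f j (v j) := by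
  rw [← Finset.mul_prod_erase _ _ (Finset.mem_erase.2 ⟨hl, Finset.mem_univ l⟩),
    Function.update_self]
  congr 1
  exact Finset.prod_congr rfl fun j hj => by rw [Function.update_of_ne (Finset.ne_of_mem_erase hj)]

theorem prod_erase_update_self (i : ι) (f : ∀ i, Module.Dual k (V i)) (v : ∀ i, V i) (x : V i) :
    ∏ j ∈ Finset.univ.erase i, f j (Function.update v i x j) =
      ∏ j ∈ Finset.univ.erase i, f j (v j) :=
  Finset.prod_congr rfl fun j hj => by rw [Function.update_of_ne (Finset.ne_of_mem_erase hj)]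

/-- Contraction of `⨂ V j` onto `V i` by linear forms on the other factors. -/
noncomputable def contract (i : ι) (f : ∀ i, Module.Dual k (V i)) : (⨂[k] i, V i) →ₗ[k] V i :=
  PiTensorProduct.lift
    { toFun := fun v => (∏ j ∈ Finset.univ.erase i, f j (v j)) • v i
      map_update_add' := fun {inst} v l x y => by
        -- Multilinearity is required for every decidability instance; this identifies it with the
        -- ambient one.
        obtain rfl : inst = dec := Subsingleton.elim _ _
        by_cases h : l = i
        · subst h
          simp only [prod_erase_update_self, Function.update_self, smul_add]
        · simp only [prod_erase_update_of_ne h, Function.update_of_ne (Ne.symm h), map_add, add_mul,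
            add_smul]
      map_update_smul' := fun {inst} v l c x => by
        obtain rfl : inst = dec := Subsingleton.elim _ _
        by_cases h : l = i
        · subst h
          simp only [prod_erase_update_self, Function.update_self, smul_comm c]
        · simp only [prod_erase_update_of_ne h, Function.update_of_ne (Ne.symm h), map_smul,
            smul_eq_mul, mul_smul] }

theorem contract_tprod (i : ι) (f : ∀ i, Module.Dual k (V i)) (v : ∀ i, V i) :
    contract i f (PiTensorProduct.tprod k v) = (∏ j ∈ Finset.univ.erase i, f j (v j)) • v i :=
  PiTensorProduct.lift.tprod _

theorem contract_tensorAt (i : ι) (f : ∀ i, Module.Dual k (V i)) (g : Module.End k (V i))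
    (t : ⨂[k] i, V i) : contract i f (tensorAt i g t) = g (contract i f t) := by
  have : contract i f ∘ₗ tensorAt i g = g ∘ₗ contract i f := PiTensorProduct.ext <|
    MultilinearMap.ext fun v => by
      simp [tensorAt_tprod, contract_tprod, prod_erase_update_self]
  exact LinearMap.congr_fun this t

/-- Some coordinate of `t` in a product basis is nonzero, and it factors through contraction by the
coordinate forms of the other factors. -/
theorem exists_contract_ne_zero (i : ι) {t : ⨂[k] i, V i} (ht : t ≠ 0) :
    ∃ f : ∀ i, Module.Dual k (V i), contract i f t ≠ 0 := by
  let b := fun i => Module.Basis.ofVectorSpace k (V i)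
  obtain ⟨p, hp⟩ : ∃ p, (Basis.piTensorProduct b).repr t p ≠ 0 := by
    by_contra! h
    exact ht ((Basis.piTensorProduct b).repr.map_eq_zero_iff.1 (Finsupp.ext h))
  let f : ∀ i, Module.Dual k (V i) := fun j => (b j).coord (p j)
  have : f i ∘ₗ contract i f = (Basis.piTensorProduct b).coord p := PiTensorProduct.ext <|
    MultilinearMap.ext fun v => by
      simp only [LinearMap.compMultilinearMap_apply, LinearMap.comp_apply, contract_tprod,
        map_smul, smul_eq_mul, Module.Basis.coord_apply, Basis.piTensorProduct_repr_tprod_apply]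
      rw [mul_comm]
      exact Finset.mul_prod_erase Finset.univ (fun j => f j (v j)) (Finset.mem_univ i)
  refine ⟨f, fun h => hp ?_⟩
  rw [← Module.Basis.coord_apply, ← this, LinearMap.comp_apply, h, map_zero]

theorem exists_tprod_ne_zero {X : Type*} [AddCommGroup X] [Module k X]
    {φ : (⨂[k] i, V i) →ₗ[k] X} (hφ : φ ≠ 0) : ∃ v, φ (PiTensorProduct.tprod k v) ≠ 0 := by
  by_contra! h
  exact hφ (PiTensorProduct.ext (MultilinearMap.ext h))

variable [∀ i, LieRingModule L (V i)] [∀ i, LieModule k L (V i)]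
  [∀ i, LieRingModule L (W i)] [∀ i, LieModule k L (W i)]

theorem lie_tensor_eq_sum (x : L) (t : ⨂[k] i, V i) :
    ⁅x, t⁆ = ∑ i, tensorAt i (LieModule.toEnd k L (V i) x) t := by
  change piTensorAction k L V x t = _
  simp [piTensorAction]

theorem lie_tensor_eq_tensorAt {i : ι} {x : L} (hx : ∀ j, j ≠ i → LieModule.toEnd k L (V j) x = 0)
    (t : ⨂[k] i, V i) : ⁅x, t⁆ = tensorAt i (LieModule.toEnd k L (V i) x) t := by
  rw [lie_tensor_eq_sum]
  exact Finset.sum_eq_single i (fun j _ hj => by rw [hx j hj, map_zero, LinearMap.zero_apply])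
    fun h => absurd (Finset.mem_univ i) h

/-- Isomorphic modules have isomorphic tensor products. -/
theorem nonempty_piTensor_equiv (e : ∀ i, V i ≃ₗ⁅k,L⁆ W i) :
    Nonempty ((⨂[k] i, V i) ≃ₗ⁅k,L⁆ ⨂[k] i, W i) := by
  refine ⟨{ PiTensorProduct.congr fun i => (e i).toLinearEquiv with
    map_lie' := fun {x t} => ?_ }⟩
  change PiTensorProduct.congr _ ⁅x, t⁆ = ⁅x, PiTensorProduct.congr _ t⁆
  simp only [lie_tensor_eq_sum, map_sum]
  refine Finset.sum_congr rfl fun i _ => ?_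
  have : (PiTensorProduct.congr fun i => (e i).toLinearEquiv).toLinearMap ∘ₗ
        tensorAt i (LieModule.toEnd k L (V i) x) =
      tensorAt i (LieModule.toEnd k L (W i) x) ∘ₗ
        (PiTensorProduct.congr fun i => (e i).toLinearEquiv).toLinearMap :=
    PiTensorProduct.ext <| MultilinearMap.ext fun v => by
      simp only [LinearMap.compMultilinearMap_apply, LinearMap.comp_apply, tensorAt_tprod,
        LinearEquiv.coe_coe, PiTensorProduct.congr_tprod]
      refine congrArg _ (funext fun j => ?_)
      by_cases h : j = i
      · subst h
        rw [Function.update_self, Function.update_self]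
        exact (e j).toLieModuleHom.map_lie x (v j)
      · simp [Function.update_of_ne h]
  exact LinearMap.congr_fun this t

end PiTensor

/-! ### The mixed Casimir operator on two tensor factors. -/

section Casimir

variable {ι k L 𝔤 : Type*} [DecidableEq ι] [Fintype ι] [Field k] [IsAlgClosed k] [CharZero k]
  [LieRing L] [LieAlgebra k L] [LieRing 𝔤] [LieAlgebra k 𝔤] [FiniteDimensional k 𝔤]
  [LieAlgebra.IsKilling k 𝔤]

variable (k 𝔤) in
/-- The basis of `𝔤` dual to a chosen one for the Killing form. -/
noncomputable def killingDual : Module.Basis (Fin (Module.finrank k 𝔤)) k 𝔤 :=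
  (killingForm k 𝔤).dualBasis (LieAlgebra.IsKilling.killingForm_nondegenerate k 𝔤)
    (Module.finBasis k 𝔤)

theorem killingForm_killingDual (a b : Fin (Module.finrank k 𝔤)) :
    killingForm k 𝔤 (killingDual k 𝔤 a) (Module.finBasis k 𝔤 b) = if b = a then 1 else 0 :=
  LinearMap.BilinForm.apply_dualBasis_left _ _ a b

theorem sum_killingForm_smul_finBasis (x : 𝔤) :
    ∑ b, killingForm k 𝔤 (killingDual k 𝔤 b) x • Module.finBasis k 𝔤 b = x := by
  conv_rhs => rw [← (Module.finBasis k 𝔤).sum_repr x]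
  refine Finset.sum_congr rfl fun b _ => ?_
  congr 1
  have h := congrArg (killingForm k 𝔤 (killingDual k 𝔤 b)) ((Module.finBasis k 𝔤).sum_repr x)
  simp only [map_sum, map_smul, killingForm_killingDual] at h
  rw [← h]
  simp

theorem sum_killingForm_smul_killingDual (x : 𝔤) :
    ∑ a, killingForm k 𝔤 x (Module.finBasis k 𝔤 a) • killingDual k 𝔤 a = x := by
  conv_rhs => rw [← (killingDual k 𝔤).sum_repr x]
  refine Finset.sum_congr rfl fun a _ => ?_
  congr 1
  exact (LinearMap.BilinForm.dualBasis_repr_apply _ _ x a).symm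

/-- The Casimir tensor `∑ xₐ ⊗ xᵃ` is invariant. -/
theorem sum_lie_killingDual {X : Type*} [AddCommGroup X] [Module k X] (β : 𝔤 →ₗ[k] 𝔤 →ₗ[k] X)
    (y : 𝔤) :
    ∑ a, (β ⁅y, Module.finBasis k 𝔤 a⁆ (killingDual k 𝔤 a) +
      β (Module.finBasis k 𝔤 a) ⁅y, killingDual k 𝔤 a⁆) = 0 := by
  rw [Finset.sum_add_distrib]
  have h1 : ∀ a, β ⁅y, Module.finBasis k 𝔤 a⁆ (killingDual k 𝔤 a) =
      ∑ b, killingForm k 𝔤 (killingDual k 𝔤 b) ⁅y, Module.finBasis k 𝔤 a⁆ •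
        β (Module.finBasis k 𝔤 b) (killingDual k 𝔤 a) := fun a => by
    conv_lhs => rw [← sum_killingForm_smul_finBasis (k := k) ⁅y, Module.finBasis k 𝔤 a⁆]
    simp only [map_sum, map_smul, LinearMap.sum_apply, LinearMap.smul_apply]
  have h2 : ∀ b, β (Module.finBasis k 𝔤 b) ⁅y, killingDual k 𝔤 b⁆ =
      ∑ a, -killingForm k 𝔤 (killingDual k 𝔤 b) ⁅y, Module.finBasis k 𝔤 a⁆ •
        β (Module.finBasis k 𝔤 b) (killingDual k 𝔤 a) := fun b => by
    conv_lhs => rw [← sum_killingForm_smul_killingDual (k := k) ⁅y, killingDual k 𝔤 b⁆]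
    simp only [map_sum, map_smul]
    refine Finset.sum_congr rfl fun a _ => ?_
    rw [← LieModule.traceForm_apply_lie_apply, ← lie_skew y, map_neg,
      LinearMap.neg_apply]
  simp only [h1, h2]
  rw [Finset.sum_comm, ← Finset.sum_add_distrib]
  exact Finset.sum_eq_zero fun b _ => by simp

variable {V : ι → Type*} [∀ i, AddCommGroup (V i)] [∀ i, Module k (V i)]
  [∀ i, LieRingModule L (V i)] [∀ i, LieModule k L (V i)]

/-- If `L` acts on two factors of an irreducible tensor product through the same homomorphism
to `𝔤`, the second action being faithful by traceless operators, then the first is trivial. -/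
theorem eq_zero_of_isIrreducible_piTensor [∀ i, FiniteDimensional k (V i)]
    [∀ i, Nontrivial (V i)] (hirr : LieModule.IsIrreducible k L (⨂[k] i, V i)) {i j : ι}
    (hij : i ≠ j) (p : L → 𝔤) (ρ : 𝔤 →ₗ[k] Module.End k (V i)) (σ : 𝔤 →ₗ[k] Module.End k (V j))
    (hρ : ∀ x y, ρ ⁅x, y⁆ = ρ x * ρ y - ρ y * ρ x) (hσ : ∀ x y, σ ⁅x, y⁆ = σ x * σ y - σ y * σ x)
    (hρL : ∀ l, LieModule.toEnd k L (V i) l = ρ (p l))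
    (hσL : ∀ l, LieModule.toEnd k L (V j) l = σ (p l))
    (htr : ∀ x, LinearMap.trace k (V j) (σ x) = 0) (hinj : Function.Injective σ) : ρ = 0 := by
  let β : 𝔤 →ₗ[k] 𝔤 →ₗ[k] Module.End k (⨂[k] i, V i) :=
    (LinearMap.mul k (Module.End k (⨂[k] i, V i))).compl₁₂ ((tensorAt i).comp ρ)
      ((tensorAt j).comp σ)
  have hβ : ∀ x y, β x y = tensorAt i (ρ x) * tensorAt j (σ y) := fun _ _ => rfl
  -- The mixed part $\sum_a\rho(x_a)\otimes\sigma(x^a)$ of the Casimir operator. Factors other than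
  -- `i` and `j` commute with it, and invariance of $\sum_a x_a\otimes x^a$ handles these two.
  let T := ∑ a, β (Module.finBasis k 𝔤 a) (killingDual k 𝔤 a)
  have hcomm : ∀ (l : L) x y, piTensorAction k L V l * β x y - β x y * piTensorAction k L V l =
      β ⁅p l, x⁆ y + β x ⁅p l, y⁆ := fun l x y => by
    have hact : piTensorAction k L V l = ∑ m, tensorAt m (LieModule.toEnd k L (V m) l) := by
      simp [piTensorAction]
    rw [hact, Finset.sum_mul, Finset.mul_sum, ← Finset.sum_sub_distrib]
    rw [Finset.sum_eq_add i j hij (fun m _ hm => ?_) (fun h => absurd (Finset.mem_univ _) h)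
      (fun h => absurd (Finset.mem_univ _) h)]
    · simp only [hβ, hρL, hσL, hρ, hσ, map_sub, tensorAt_mul, sub_mul, mul_sub]
      have h1 := tensorAt_comm (V := V) hij (ρ (p l)) (σ y)
      have h2 := tensorAt_comm (V := V) hij (ρ x) (σ (p l))
      rw [mul_assoc (tensorAt i (ρ x)) (tensorAt j (σ y)) (tensorAt i (ρ (p l))), ← h1,
        ← mul_assoc (tensorAt j (σ (p l))), ← h2]
      simp only [mul_assoc]
    · rw [hβ, ← mul_assoc, tensorAt_comm hm.1, mul_assoc, tensorAt_comm hm.2, mul_assoc, sub_self]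
  have : FiniteDimensional k (⨂[k] i, V i) :=
    Module.Finite.of_basis (Basis.piTensorProduct fun i => Module.finBasis k (V i))
  obtain ⟨c, hc⟩ := exists_eq_smul_one_of_isIrreducible hirr T fun l t => by
    have h : piTensorAction k L V l * T - T * piTensorAction k L V l = 0 := by
      rw [Finset.mul_sum, Finset.sum_mul, ← Finset.sum_sub_distrib]
      simp only [hcomm]
      exact sum_lie_killingDual β (p l)
    exact (LinearMap.congr_fun (sub_eq_zero.1 h) t).symm
  choose w hw using fun m => exists_ne (0 : V m)
  choose F hF using fun m => Module.Projective.exists_dual_eq_one k (hw m)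
  -- Contracting the scalar operator in all factors but `j` exhibits a scalar in the image of
  -- $\sigma$. It is traceless, hence zero; injectivity of $\sigma$ and independence of the dual
  -- basis then kill every matrix coefficient of $\rho$.
  have key : ∀ (v : V i) (f : Module.Dual k (V i)),
      σ (∑ a, f (ρ (Module.finBasis k 𝔤 a) v) • killingDual k 𝔤 a) = (c * f v) • 1 := by
    intro v f
    ext y
    have h := congrArg (contract j (Function.update F i f)) (LinearMap.congr_fun hc
      (PiTensorProduct.tprod k (Function.update (Function.update w i v) j y)))
    have hcon : ∀ (v' : V i) (y' : V j), contract j (Function.update F i f)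
        (PiTensorProduct.tprod k (Function.update (Function.update w i v') j y')) =
          f v' • y' := fun v' y' => by
      rw [contract_tprod, prod_erase_update_self, Function.update_self,
        prod_erase_update_of_ne hij, Function.update_self, Finset.prod_eq_one, mul_one]
      intro m hm
      rw [Function.update_of_ne (Finset.ne_of_mem_erase hm), hF]
    have hT : ∀ a, β (Module.finBasis k 𝔤 a) (killingDual k 𝔤 a)
        (PiTensorProduct.tprod k (Function.update (Function.update w i v) j y)) =
        PiTensorProduct.tprod k (Function.update (Function.update w i
          (ρ (Module.finBasis k 𝔤 a) v)) j (σ (killingDual k 𝔤 a) y)) := fun a => by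
      rw [hβ, Module.End.mul_apply, tensorAt_tprod, Function.update_self, Function.update_idem,
        tensorAt_tprod, Function.update_of_ne hij, Function.update_self,
        Function.update_comm hij.symm, Function.update_idem]
    simp only [T, LinearMap.sum_apply, map_sum, hT, hcon, LinearMap.smul_apply, map_smul,
      Module.End.one_apply] at h
    simpa [mul_smul] using h
  have hzero : ∀ (v : V i) (f : Module.Dual k (V i)) a, f (ρ (Module.finBasis k 𝔤 a) v) = 0 := by
    intro v f
    have h := key v f
    have h' := htr (∑ a, f (ρ (Module.finBasis k 𝔤 a) v) • killingDual k 𝔤 a)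
    rw [h, map_smul, LinearMap.trace_one, smul_eq_mul, mul_eq_zero, Nat.cast_eq_zero,
      or_iff_left Module.finrank_pos.ne'] at h'
    rw [h', zero_smul, ← map_zero σ] at h
    exact Fintype.linearIndependent_iff.1 (killingDual k 𝔤).linearIndependent _ (hinj h)
  refine (Module.finBasis k 𝔤).ext fun a => LinearMap.ext fun v => ?_
  exact (Module.forall_dual_apply_eq_zero_iff k _).1 fun f => hzero v f a

end Casimir

/-! ### Comparing tensor products of evaluation modules. -/

section EvaluationModules

variable {k R S 𝔤 Γ : Type*} [Field k] [IsAlgClosed k] [CharZero k]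
  [CommRing R] [Algebra k R] [CommRing S] [Algebra k S] [Algebra.FiniteType k S]
  [Algebra R S] [IsScalarTower k R S]
  [Group Γ] [MulSemiringAction Γ S] [SMulCommClass Γ R S] [SMulCommClass Γ k S]
  [LieRing 𝔤] [LieAlgebra k 𝔤] [FiniteDimensional k 𝔤] [LieAlgebra.IsSimple k 𝔤]
  {𝔥 : LieSubalgebra k 𝔤} [𝔥.IsCartanSubalgebra] {P : Pinning 𝔥}
  {u : Γ → (S ⊗[k] 𝔤 ≃ₗ⁅S⁆ S ⊗[k] 𝔤)}
  {ι : Type*} [Fintype ι] [DecidableEq ι] {wt μ : ι → Module.Dual k 𝔥} {M N : ι → MaximalSpectrum S}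
  {V W : ι → Type*}
  [∀ i, AddCommGroup (V i)] [∀ i, Module k (V i)]
  [∀ i, LieRingModule 𝔤 (V i)] [∀ i, LieModule k 𝔤 (V i)]
  [∀ i, AddCommGroup (W i)] [∀ i, Module k (W i)]
  [∀ i, LieRingModule 𝔤 (W i)] [∀ i, LieModule k 𝔤 (W i)]

/-- If a tensor product of nontrivial evaluation modules is irreducible, then the maximal ideals
lie over distinct maximal ideals of `R`. -/
theorem under_ne_of_isIrreducible (hΓ : IsGaloisExtension Γ R S) (hwt : ∀ i, wt i ≠ 0)
    (hV : ∀ i, IsSimpleOfHighestWeight P (wt i) (V i))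
    (hirr : LieModule.IsIrreducible k (twistedForm u)
      (⨂[k] i, EvalModule (twistedForm u) (M i) (V i))) (i j : ι) (hij : i ≠ j) :
    (M i).asIdeal.under R ≠ (M j).asIdeal.under R := by
  intro h
  obtain ⟨γ, hγ⟩ := hΓ.exists_eq_galConj h
  have : ∀ m, FiniteDimensional k (EvalModule (twistedForm u) (M m) (V m)) := fun m => (hV m).finite
  have : ∀ m, Nontrivial (EvalModule (twistedForm u) (M m) (V m)) := fun m =>
    have := (hV m).irreducible
    LieModule.nontrivial_of_isIrreducible k 𝔤 (V m)
  let θ := specialize (u γ).symm (M i)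
  let ρ : 𝔤 →ₗ[k] Module.End k (EvalModule (twistedForm u) (M i) (V i)) :=
    (LieModule.toEnd k 𝔤 (V i) : 𝔤 →ₗ[k] Module.End k (V i))
  let σ₀ : 𝔤 →ₗ[k] Module.End k (EvalModule (twistedForm u) (M j) (V j)) :=
    (LieModule.toEnd k 𝔤 (V j) : 𝔤 →ₗ[k] Module.End k (V j))
  have hρ : ∀ x y, ρ ⁅x, y⁆ = ρ x * ρ y - ρ y * ρ x := fun x y => LinearMap.ext fun v =>
    lie_lie x y (show V i from v)
  have hσ₀ : ∀ x y, σ₀ ⁅x, y⁆ = σ₀ x * σ₀ y - σ₀ y * σ₀ x := fun x y => LinearMap.ext fun v =>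
    lie_lie x y (show V j from v)
  have htr : ∀ x, LinearMap.trace k (V j) (LieModule.toEnd k 𝔤 (V j) x) = 0 :=
    trace_toEnd_eq_zero_of_isSimple (V j)
  -- Since $M_i={}^\gamma M_j$, evaluation at $M_j$ is $\theta$ composed with evaluation at $M_i$,
  -- so both factors are acted on through evaluation at $M_i$.
  have hρ0 : ρ = 0 := eq_zero_of_isIrreducible_piTensor hirr hij
    (fun l => evalAt (M i) (l : S ⊗[k] 𝔤)) ρ (σ₀ ∘ₗ (θ : 𝔤 →ₗ[k] 𝔤)) hρ
    (fun x y => by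
      change σ₀ (θ ⁅x, y⁆) = _
      rw [LieEquiv.map_lie, hσ₀]
      rfl)
    (fun l => rfl)
    (fun l => by
      change σ₀ (evalAt (M j) (l : S ⊗[k] 𝔤)) = σ₀ (θ (evalAt (M i) (l : S ⊗[k] 𝔤)))
      rw [evalAt_eq_specialize l.2 γ (M j), ← hγ])
    (fun x => htr (θ x))
    (by
      rw [← LinearMap.ker_eq_bot, LinearMap.ker_eq_bot']
      intro x hx
      have : θ x = 0 := eq_zero_of_toEnd_eq_zero ((hV j).exists_lie_ne_zero (hwt j)) hx
      exact (map_eq_zero_iff θ θ.injective).1 this)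
  obtain ⟨x, v, hxv⟩ := (hV i).exists_lie_ne_zero (hwt i)
  exact hxv (LinearMap.congr_fun (LinearMap.congr_fun hρ0 x) v)

/-- An isomorphism of tensor products of evaluation modules induces isomorphisms of the factors
up to twist. -/
theorem nonempty_equiv_twistModule (hΓ : IsGaloisExtension Γ R S) (hu : IsCocycle u)
    (hV : ∀ i, IsSimpleOfHighestWeight P (wt i) (V i))
    (hW : ∀ i, IsSimpleOfHighestWeight P (μ i) (W i))
    (hM : ∀ i j, i ≠ j → (M i).asIdeal.under R ≠ (M j).asIdeal.under R)
    (hVirr : LieModule.IsIrreducible k (twistedForm u)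
      (⨂[k] i, EvalModule (twistedForm u) (M i) (V i)))
    {θ : ι → 𝔤 ≃ₗ⁅k⁆ 𝔤}
    (hθ : ∀ i, ∀ l : twistedForm u, evalAt (N i) (l : S ⊗[k] 𝔤) = θ i (evalAt (M i) (l : S ⊗[k] 𝔤)))
    (φ : (⨂[k] i, EvalModule (twistedForm u) (M i) (V i)) ≃ₗ⁅k, twistedForm u⁆
        (⨂[k] i, EvalModule (twistedForm u) (N i) (W i))) (i : ι) :
    Nonempty (V i ≃ₗ⁅k,𝔤⁆ TwistModule (θ i) (W i)) := by
  have := LieModule.nontrivial_of_isIrreducible k (twistedForm u)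
      (⨂[k] i, EvalModule (twistedForm u) (M i) (V i))
  have hφ0 : φ.toLinearEquiv.toLinearMap ≠ 0 := fun h => by
    obtain ⟨t, ht⟩ := exists_ne (0 : ⨂[k] i, EvalModule (twistedForm u) (M i) (V i))
    exact ht (φ.toLinearEquiv.map_eq_zero_iff.1 (LinearMap.congr_fun h t))
  obtain ⟨v, hv⟩ := exists_tprod_ne_zero hφ0
  obtain ⟨f, hf⟩ := exists_contract_ne_zero i hv
  let ins : EvalModule (twistedForm u) (M i) (V i) →ₗ[k]
      ⨂[k] i, EvalModule (twistedForm u) (M i) (V i) := (PiTensorProduct.tprod k).toLinearMap v i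
  -- Insert a vector in position `i`, apply the isomorphism, contract back to position `i`. The
  -- choices of `v` and `f` ensure that `v i` is not sent to zero.
  let ψ : EvalModule (twistedForm u) (M i) (V i) →ₗ[k] EvalModule (twistedForm u) (N i) (W i) :=
    contract i f ∘ₗ φ.toLinearEquiv.toLinearMap ∘ₗ ins
  let ψ₀ : V i →ₗ[k] W i := ψ
  have hψ : ∀ (x : 𝔤) (y : V i), ψ₀ ⁅x, y⁆ = ⁅θ i x, ψ₀ y⁆ := fun x y => by
    -- This `l` acts as `x` on factor `i` and by zero on the others, on both sides, so insertion and
    -- contraction are equivariant for it.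
    obtain ⟨l, hl, hl'⟩ := hu.exists_evalAt_eq_of_ne hΓ hM i x
    have h1 : ∀ j, j ≠ i → LieModule.toEnd k (twistedForm u)
        (EvalModule (twistedForm u) (M j) (V j)) l = 0 := fun j hj => LinearMap.ext fun w => by
      change ⁅evalAt (M j) (l : S ⊗[k] 𝔤), (show V j from w)⁆ = 0
      rw [hl' j hj, zero_lie]
    have h2 : ∀ j, j ≠ i → LieModule.toEnd k (twistedForm u)
        (EvalModule (twistedForm u) (N j) (W j)) l = 0 := fun j hj => LinearMap.ext fun w => by
      change ⁅evalAt (N j) (l : S ⊗[k] 𝔤), (show W j from w)⁆ = 0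
      rw [hθ, hl' j hj, map_zero, zero_lie]
    have h3 : ∀ y : EvalModule (twistedForm u) (M i) (V i), ins ⁅l, y⁆ = ⁅l, ins y⁆ := fun y => by
      rw [lie_tensor_eq_tensorAt h1, MultilinearMap.toLinearMap_apply,
        MultilinearMap.toLinearMap_apply, tensorAt_tprod, Function.update_idem,
        Function.update_self]
      rfl
    have h4 : ∀ y, ψ ⁅l, y⁆ = ⁅l, ψ y⁆ := fun y => by
      change contract i f (φ.toLieModuleHom (ins ⁅l, y⁆)) = _
      rw [h3, φ.toLieModuleHom.map_lie, lie_tensor_eq_tensorAt h2, contract_tensorAt]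
      rfl
    have h5 : ψ₀ ⁅evalAt (M i) (l : S ⊗[k] 𝔤), y⁆ = ⁅evalAt (N i) (l : S ⊗[k] 𝔤), ψ₀ y⁆ := h4 y
    rwa [hθ, hl] at h5
  let Ψ : V i →ₗ⁅k,𝔤⁆ TwistModule (θ i) (W i) :=
    { (show V i →ₗ[k] TwistModule (θ i) (W i) from ψ₀) with map_lie' := fun {x y} => hψ x y }
  refine ⟨lieModuleEquivOfBijective Ψ (bijective_of_isIrreducible (hV i).irreducible
    (isIrreducible_twistModule _ (hW i).irreducible) Ψ ⟨v i, ?_⟩)⟩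
  change contract i f (φ.toLinearEquiv (ins (v i))) ≠ 0
  rwa [MultilinearMap.toLinearMap_apply, Function.update_eq_self]

theorem nonempty_equiv_of_twistModule {θ : ι → 𝔤 ≃ₗ⁅k⁆ 𝔤}
    (hθ : ∀ i, ∀ l : twistedForm u, evalAt (N i) (l : S ⊗[k] 𝔤) = θ i (evalAt (M i) (l : S ⊗[k] 𝔤)))
    (e : ∀ i, V i ≃ₗ⁅k,𝔤⁆ TwistModule (θ i) (W i)) :
    Nonempty ((⨂[k] i, EvalModule (twistedForm u) (M i) (V i)) ≃ₗ⁅k, twistedForm u⁆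
        (⨂[k] i, EvalModule (twistedForm u) (N i) (W i))) := by
  refine nonempty_piTensor_equiv fun i =>
    { (show EvalModule (twistedForm u) (M i) (V i) ≃ₗ[k] EvalModule (twistedForm u) (N i) (W i) from
        (e i).toLinearEquiv) with
      map_lie' := fun {l v} => ?_ }
  change (e i) ⁅evalAt (M i) (l : S ⊗[k] 𝔤), (show V i from v)⁆ =
    ⁅evalAt (N i) (l : S ⊗[k] 𝔤), (show W i from e i v)⁆
  rw [hθ]
  exact (e i).toLieModuleHom.map_lie _ _

end EvaluationModules

end TwistedForms

open TwistedForms in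
theorem proposition3p5
    {k R S 𝔤 Γ : Type*} [Field k] [IsAlgClosed k] [CharZero k]
    [CommRing R] [Algebra k R] [Algebra.FiniteType k R]
    [CommRing S] [Algebra k S] [Algebra.FiniteType k S] [Algebra R S] [IsScalarTower k R S]
    [Group Γ] [MulSemiringAction Γ S] [SMulCommClass Γ R S] [SMulCommClass Γ k S]
    (hΓ : IsGaloisExtension Γ R S)
    [LieRing 𝔤] [LieAlgebra k 𝔤] [FiniteDimensional k 𝔤] [LieAlgebra.IsSimple k 𝔤]
    (𝔥 : LieSubalgebra k 𝔤) [𝔥.IsCartanSubalgebra] (P : Pinning 𝔥)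
    (u : Γ → (S ⊗[k] 𝔤 ≃ₗ⁅S⁆ S ⊗[k] 𝔤)) (hu : IsCocycle u)
    {n : ℕ} (wt μ : Fin n → Module.Dual k 𝔥) (M N : Fin n → MaximalSpectrum S)
    (hwt : ∀ i, IsDominantIntegral P (wt i) ∧ wt i ≠ 0)
    (hμ : ∀ i, IsDominantIntegral P (μ i) ∧ μ i ≠ 0)
    (V W : Fin n → Type*)
    [∀ i, AddCommGroup (V i)] [∀ i, Module k (V i)]
    [∀ i, LieRingModule 𝔤 (V i)] [∀ i, LieModule k 𝔤 (V i)]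
    [∀ i, AddCommGroup (W i)] [∀ i, Module k (W i)]
    [∀ i, LieRingModule 𝔤 (W i)] [∀ i, LieModule k 𝔤 (W i)]
    (hV : ∀ i, IsSimpleOfHighestWeight P (wt i) (V i))
    (hW : ∀ i, IsSimpleOfHighestWeight P (μ i) (W i))
    (hVirr : LieModule.IsIrreducible k (twistedForm u)
      (⨂[k] i, EvalModule (twistedForm u) (M i) (V i)))
    (hWirr : LieModule.IsIrreducible k (twistedForm u)
      (⨂[k] i, EvalModule (twistedForm u) (N i) (W i)))
    (hMN : ∀ i, (M i).asIdeal.under R = (N i).asIdeal.under R) :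
    Nonempty ((⨂[k] i, EvalModule (twistedForm u) (M i) (V i)) ≃ₗ⁅k, twistedForm u⁆
        (⨂[k] i, EvalModule (twistedForm u) (N i) (W i))) ↔
      ∃ γ : Fin n → Γ, ∀ i, (wt i, M i) = galPair P u (γ i) (μ i, N i) := by
  have hM := under_ne_of_isIrreducible hΓ (fun i => (hwt i).2) hV hVirr
  constructor
  · rintro ⟨φ⟩
    -- Any $\gamma_i$ carrying $N_i$ to $M_i$ will do: the equality of weights is then forced by the
    -- isomorphism of factors.
    choose γ hγ using fun i => hΓ.exists_eq_galConj (hMN i)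
    refine ⟨γ, fun i => ?_⟩
    have hθ : ∀ i, ∀ l : twistedForm u, evalAt (N i) (l : S ⊗[k] 𝔤) =
        specialize (u (γ i)).symm (galConj (γ i) (N i)) (evalAt (M i) (l : S ⊗[k] 𝔤)) :=
      fun i l => by rw [evalAt_eq_specialize l.2 (γ i) (N i), ← hγ i]
    have h := ((hV i).nonempty_equiv_iff ((hW i).twistModule _)).1
      (nonempty_equiv_twistModule hΓ hu hV hW hM hVirr hθ φ i)
    exact Prod.ext h (hγ i)
  · rintro ⟨γ, hγ⟩
    have hγ' : ∀ i, M i = galConj (γ i) (N i) := fun i => congrArg Prod.snd (hγ i)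
    have hθ : ∀ i, ∀ l : twistedForm u, evalAt (N i) (l : S ⊗[k] 𝔤) =
        specialize (u (γ i)).symm (galConj (γ i) (N i)) (evalAt (M i) (l : S ⊗[k] 𝔤)) :=
      fun i l => by rw [evalAt_eq_specialize l.2 (γ i) (N i), ← hγ' i]
    have h := fun i => ((hV i).nonempty_equiv_iff ((hW i).twistModule _)).2
      (congrArg Prod.fst (hγ i))
    exact nonempty_equiv_of_twistModule hθ fun i => (h i).some
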